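/- A polygonal curve $P$ with $m\ge 1$ vertices in $\mathbb{R}^d$ is a piecewise-linear map $P\colon[1,m]\to\mathbb{R}^d$ whose vertices are at the integer parameters; $|P|=m$, $P[a,b]$ is its restriction to $[a,b]$, and for integers $1\le a\le b\le m$ it is called a vertex subcurve of $P$, with $b-a+1$ vertices. The Fréchet distance $d_F(P,Q)$ is the infimum of $\max_{t\in[0,1]}\lVert P(f(t))-Q(g(t))\rVert$ over all non-decreasing surjections $f,g$ from $[0,1]$ onto the parameter intervals of $P$ and $Q$. Fix the dimension $d$. Let $T$ be a polygonal curve with $n\ge 2$ vertices, $S$ a polygonal curve with at most $n$ vertices, $\ell\ge 2$ an integer and $\Delta\ge 0$. An $(\ell,4\Delta)$-pathlet is a pair $(P,\mathcal I)$ of a polygonal curve $P$ with $|P|\le\ell$ and a set $\mathcal I$ of closed intervals in $[1,n]$ such that $d_F(P,T[a,b])\le 4\Delta$ for all $[a,b]\in\mathcal I$. It is vertex-to-vertex if its reference curve $P$ is a vertex subcurve of $S$. Let $\mathcal U$ be a universe, i.e. a set of interior-disjoint closed intervals of positive length whose union is $[1,n]$, of size $|\mathcal U|=O(n^3)$. Put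 $\mathrm{Cov}(P,\mathcal I)=\{J\in\mathcal U: J\subseteq\bigcup\mathcal I\}$, and for a set $C$ of pairs $(P,\mathcal I)$ of a curve and a set of intervals put $\mathrm{Cov}(C)=\bigcup_{(P,\mathcal I)\in C}\mathrm{Cov}(P,\mathcal I)$. Theorem. Suppose that $\mathcal U$ and $\mathrm{Cov}(C)$ have been preprocessed, each into a table of its intervals sorted from left to right. Then an optimal vertex-to-vertex $(\ell,4\Delta)$-pathlet, i.e. a vertex-to-vertex $(\ell,4\Delta)$-pathlet $(P,\mathcal I)$ for which $|\mathrm{Cov}(P,\mathcal I)\setminus\mathrm{Cov}(C)|$ is maximum among all vertex-to-vertex $(\ell,4\Delta)$-pathlets, can be constructed in $O(n^2\,\ell\,\log^2 n)$ time using $O(n\,\ell\,\log n)$ cells of working memory, in addition to the read-only input and the two tables. More precisely, one fixed program on a real RAM (unit-cost comparisons, memory accesses and arithmetic, with square roots of reals but no rounding of reals to integers, and integers limited to $O(\log(n\ell))$ bits) does this for all such inputs; it outputs $P=S[i,j]$ by the indices $i,j$, and $\mathcal I$ as a list of intervals. The constants depend only on $d$ and on the constant in $|\mathcal U|=O(n^3)$.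 -/

import Mathlib

namespace Subtraj

noncomputable section

/- Polygonal curves and the Fréchet distance. -/

abbrev Point (d : ℕ) := EuclideanSpace ℝ (Fin d)

/-- A polygonal curve in `ℝ^d`, given by its (at least one) vertices. -/
structure Curve (d : ℕ) where
  card : ℕ
  card_pos : 0 < card
  vtx : Fin card → Point d

/-- The `k`-th vertex, counted from `1` (indices outside `[1, card]` are clamped). -/
def Curve.vertex {d : ℕ} (P : Curve d) (k : ℕ) : Point d :=
  P.vtx ⟨min k P.card - 1, by have := P.card_pos; omega⟩

/-- The piecewise-linear map `[1, card] → ℝ^d` with the `k`-th vertex at parameter `k`. -/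
def Curve.eval {d : ℕ} (P : Curve d) (x : ℝ) : Point d :=
  AffineMap.lineMap (P.vertex ⌊x⌋₊) (P.vertex (⌊x⌋₊ + 1)) (x - (⌊x⌋₊ : ℝ))

/-- The vertex subcurve `P[i, j]`, with vertices number `i, i + 1, …, j` of `P`. -/
def Curve.sub {d : ℕ} (P : Curve d) (i j : ℕ) (h : 1 ≤ i ∧ i ≤ j ∧ j ≤ P.card) : Curve d where
  card := j - i + 1
  card_pos := Nat.succ_pos _
  vtx k := P.vtx ⟨i - 1 + k, by have := k.isLt; omega⟩

/-- `f` restricts to a non-decreasing surjection `[0, 1] → [a, b]`. -/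
def IsReparam (f : ℝ → ℝ) (a b : ℝ) : Prop :=
  MonotoneOn f (Set.Icc 0 1) ∧ f '' Set.Icc 0 1 = Set.Icc a b

/-- The cost of the matching `(f, g)` between `p` and `q`. -/
def matchingCost {d : ℕ} (p q : ℝ → Point d) (f g : ℝ → ℝ) : ℝ :=
  sSup ((fun t => ‖p (f t) - q (g t)‖) '' Set.Icc 0 1)

/-- The Fréchet distance between `p` restricted to `[a, b]` and `q` restricted to `[a', b']`. -/
def frechetDist {d : ℕ} (p : ℝ → Point d) (a b : ℝ) (q : ℝ → Point d) (a' b' : ℝ) : ℝ :=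
  sInf {r | ∃ f g : ℝ → ℝ, IsReparam f a b ∧ IsReparam g a' b' ∧ r = matchingCost p q f g}

/- Pathlets and coverage. A closed interval `[a, b]` is represented by the pair `(a, b)`. -/

/-- A reference curve together with a set of intervals. -/
structure Pathlet (d : ℕ) where
  ref : Curve d
  ivs : Set (ℝ × ℝ)

/-- `p` is an `(ℓ, r)`-pathlet for the trajectory `T`. -/
def IsPathlet {d : ℕ} (T : Curve d) (ℓ : ℕ) (r : ℝ) (p : Pathlet d) : Prop :=
  p.ref.card ≤ ℓ ∧
  ∀ I ∈ p.ivs, 1 ≤ I.1 ∧ I.1 ≤ I.2 ∧ I.2 ≤ (T.card : ℝ) ∧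
    frechetDist p.ref.eval 1 p.ref.card T.eval I.1 I.2 ≤ r

/-- The reference curve of `p` is a vertex subcurve of `S`. -/
def IsVertexToVertex {d : ℕ} (S : Curve d) (p : Pathlet d) : Prop :=
  ∃ (i j : ℕ) (h : 1 ≤ i ∧ i ≤ j ∧ j ≤ S.card), p.ref = S.sub i j h

/-- The part of `[1, n]` covered by `p`. -/
def Pathlet.support {d : ℕ} (p : Pathlet d) : Set ℝ := ⋃ I ∈ p.ivs, Set.Icc I.1 I.2

/-- A universe: finitely many interior-disjoint closed intervals (of positive length)
that together cover `[1, n]`. -/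
def IsUniverse (n : ℕ) (U : Set (ℝ × ℝ)) : Prop :=
  U.Finite ∧ (∀ J ∈ U, J.1 < J.2) ∧
  (∀ I ∈ U, ∀ J ∈ U, I ≠ J → Disjoint (Set.Ioo I.1 I.2) (Set.Ioo J.1 J.2)) ∧
  (⋃ J ∈ U, Set.Icc J.1 J.2) = Set.Icc 1 (n : ℝ)

/-- The coverage of a pathlet over `U`. -/
def cov {d : ℕ} (U : Set (ℝ × ℝ)) (p : Pathlet d) : Set (ℝ × ℝ) :=
  {J ∈ U | Set.Icc J.1 J.2 ⊆ p.support}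

/-- The coverage of a set of pathlets over `U`. -/
def covSet {d : ℕ} (U : Set (ℝ × ℝ)) (C : Set (Pathlet d)) : Set (ℝ × ℝ) :=
  ⋃ p ∈ C, cov U p

/-- The number of intervals of `U` that `p` covers and `C` does not. -/
def uncovered {d : ℕ} (U : Set (ℝ × ℝ)) (C : Set (Pathlet d)) (p : Pathlet d) : ℕ :=
  (cov U p \ covSet U C).ncard

/-- `p` is an optimal vertex-to-vertex `(ℓ, r)`-pathlet with respect to `U` and `C`. -/
def IsOptimalVertexToVertex {d : ℕ} (T S : Curve d) (U : Set (ℝ × ℝ)) (C : Set (Pathlet d))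
    (ℓ : ℕ) (r : ℝ) (p : Pathlet d) : Prop :=
  (IsPathlet T ℓ r p ∧ IsVertexToVertex S p) ∧
  ∀ q : Pathlet d, IsPathlet T ℓ r q → IsVertexToVertex S q →
    uncovered U C q ≤ uncovered U C p

/- A real RAM: a structured program works on integer and real registers, on an integer and a
real working memory with indirect addressing, and on a read-only input. Arithmetic operations
(including square roots of reals), comparisons and memory accesses have unit cost. Integers have
to fit in a machine word, and reals cannot be rounded to integers. -/

/-- The read-only input (integers, and arrays of reals) and the resources of the machine:
each of the two working memories has cells `0, …, cells - 1`, and integers are at most `maxInt`. -/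
structure Machine where
  inN : List ℕ
  inR : List (List ℝ)
  cells : ℕ
  maxInt : ℕ

structure Store where
  nreg : ℕ → ℕ
  rreg : ℕ → ℝ
  nmem : ℕ → ℕ
  rmem : ℕ → ℝ

/-- The store at the start of a run. -/
def Store.zero : Store := ⟨fun _ => 0, fun _ => 0, fun _ => 0, fun _ => 0⟩

/-- Integer expressions; `inp k` is the `k`-th input integer, `mem` reads working memory. -/
inductive NExp where
  | const (k : ℕ)
  | reg (x : ℕ)
  | inp (k : ℕ)
  | mem (a : NExp)
  | add (a b : NExp)
  | sub (a b : NExp)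
  | mul (a b : NExp)
  | div (a b : NExp)

/-- Real expressions; `inp k a` is the entry number `a` of the `k`-th input array. -/
inductive RExp where
  | ofN (a : NExp)
  | reg (x : ℕ)
  | inp (k : ℕ) (a : NExp)
  | mem (a : NExp)
  | add (u v : RExp)
  | sub (u v : RExp)
  | mul (u v : RExp)
  | div (u v : RExp)
  | sqrt (u : RExp)

/-- Tests; `and` and `or` evaluate their second argument only where it is needed. -/
inductive BExp where
  | ltN (a b : NExp)
  | eqN (a b : NExp)
  | ltR (u v : RExp)
  | leR (u v : RExp)
  | not (p : BExp)
  | and (p q : BExp)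
  | or (p q : BExp)

inductive Cmd where
  | skip
  | setN (x : ℕ) (a : NExp)
  | setR (x : ℕ) (u : RExp)
  | storeN (a b : NExp)
  | storeR (a : NExp) (u : RExp)
  | seq (p q : Cmd)
  | ite (b : BExp) (p q : Cmd)
  | loop (b : BExp) (p : Cmd)

/-- The number of operations in an expression. -/
def NExp.size : NExp → ℕ
  | const _ => 1
  | reg _ => 1
  | inp _ => 1
  | mem a => a.size + 1
  | add a b => a.size + b.size + 1
  | sub a b => a.size + b.size + 1
  | mul a b => a.size + b.size + 1
  | div a b => a.size + b.size + 1

def RExp.size : RExp → ℕ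
  | ofN a => a.size + 1
  | reg _ => 1
  | inp _ a => a.size + 1
  | mem a => a.size + 1
  | add u v => u.size + v.size + 1
  | sub u v => u.size + v.size + 1
  | mul u v => u.size + v.size + 1
  | div u v => u.size + v.size + 1
  | sqrt u => u.size + 1

def BExp.size : BExp → ℕ
  | ltN a b => a.size + b.size + 1
  | eqN a b => a.size + b.size + 1
  | ltR u v => u.size + v.size + 1
  | leR u v => u.size + v.size + 1
  | not p => p.size + 1
  | and p q => p.size + q.size + 1
  | or p q => p.size + q.size + 1

/-- An integer that does not fit in a word is an error. -/
def Machine.word (m : Machine) (v : ℕ) : Option ℕ := if v ≤ m.maxInt then some v else none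

/-- The value of an integer expression. The result is `none` on an error: a word overflow, an
access outside the memory or the input, or a division by zero. Subtraction is cut off at zero
and division rounds down. -/
def NExp.eval (m : Machine) (s : Store) : NExp → Option ℕ
  | const k => m.word k
  | reg x => some (s.nreg x)
  | inp k => (m.inN[k]?).bind m.word
  | mem a => (a.eval m s).bind fun x => if x < m.cells then some (s.nmem x) else none
  | add a b => (a.eval m s).bind fun x => (b.eval m s).bind fun y => m.word (x + y)
  | sub a b => (a.eval m s).bind fun x => (b.eval m s).bind fun y => m.word (x - y)
  | mul a b => (a.eval m s).bind fun x => (b.eval m s).bind fun y => m.word (x * y)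
  | div a b => (a.eval m s).bind fun x => (b.eval m s).bind fun y =>
      if y = 0 then none else m.word (x / y)

/-- The value of a real expression; square roots of negative numbers are errors as well. -/
def RExp.eval (m : Machine) (s : Store) : RExp → Option ℝ
  | ofN a => (a.eval m s).map fun x => (x : ℝ)
  | reg x => some (s.rreg x)
  | inp k a => (a.eval m s).bind fun x => (m.inR[k]?).bind fun A => A[x]?
  | mem a => (a.eval m s).bind fun x => if x < m.cells then some (s.rmem x) else none
  | add u v => (u.eval m s).bind fun x => (v.eval m s).map fun y => x + y
  | sub u v => (u.eval m s).bind fun x => (v.eval m s).map fun y => x - y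
  | mul u v => (u.eval m s).bind fun x => (v.eval m s).map fun y => x * y
  | div u v => (u.eval m s).bind fun x => (v.eval m s).bind fun y =>
      if y = 0 then none else some (x / y)
  | sqrt u => (u.eval m s).bind fun x => if 0 ≤ x then some (Real.sqrt x) else none

def BExp.eval (m : Machine) (s : Store) : BExp → Option Bool
  | ltN a b => (a.eval m s).bind fun x => (b.eval m s).map fun y => decide (x < y)
  | eqN a b => (a.eval m s).bind fun x => (b.eval m s).map fun y => decide (x = y)
  | ltR u v => (u.eval m s).bind fun x => (v.eval m s).map fun y => decide (x < y)
  | leR u v => (u.eval m s).bind fun x => (v.eval m s).map fun y => decide (x ≤ y)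
  | not p => (p.eval m s).map fun x => !x
  | and p q => (p.eval m s).bind fun x => if x then q.eval m s else some false
  | or p q => (p.eval m s).bind fun x => if x then some true else q.eval m s

/-- `Exec m c s s' t`: started in the store `s`, the command `c` halts without an error on the
machine `m`, in the store `s'` and after exactly `t` steps. -/
inductive Exec (m : Machine) : Cmd → Store → Store → ℕ → Prop
  | skip (s : Store) : Exec m Cmd.skip s s 1
  | setN (s : Store) (x : ℕ) (a : NExp) (v : ℕ) (ha : a.eval m s = some v) :
      Exec m (Cmd.setN x a) s { s with nreg := Function.update s.nreg x v } (a.size + 1)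
  | setR (s : Store) (x : ℕ) (u : RExp) (v : ℝ) (hu : u.eval m s = some v) :
      Exec m (Cmd.setR x u) s { s with rreg := Function.update s.rreg x v } (u.size + 1)
  | storeN (s : Store) (a b : NExp) (x v : ℕ) (ha : a.eval m s = some x)
      (hx : x < m.cells) (hb : b.eval m s = some v) :
      Exec m (Cmd.storeN a b) s { s with nmem := Function.update s.nmem x v }
        (a.size + b.size + 1)
  | storeR (s : Store) (a : NExp) (u : RExp) (x : ℕ) (v : ℝ) (ha : a.eval m s = some x)
      (hx : x < m.cells) (hu : u.eval m s = some v) :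
      Exec m (Cmd.storeR a u) s { s with rmem := Function.update s.rmem x v }
        (a.size + u.size + 1)
  | seq (s₀ s₁ s₂ : Store) (p q : Cmd) (t₁ t₂ : ℕ) (hp : Exec m p s₀ s₁ t₁)
      (hq : Exec m q s₁ s₂ t₂) : Exec m (Cmd.seq p q) s₀ s₂ (t₁ + t₂)
  | iteTrue (s s' : Store) (b : BExp) (p q : Cmd) (t : ℕ) (hb : b.eval m s = some true)
      (hp : Exec m p s s' t) : Exec m (Cmd.ite b p q) s s' (b.size + 1 + t)
  | iteFalse (s s' : Store) (b : BExp) (p q : Cmd) (t : ℕ) (hb : b.eval m s = some false)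
      (hq : Exec m q s s' t) : Exec m (Cmd.ite b p q) s s' (b.size + 1 + t)
  | loopDone (s : Store) (b : BExp) (p : Cmd) (hb : b.eval m s = some false) :
      Exec m (Cmd.loop b p) s s (b.size + 1)
  | loopStep (s₀ s₁ s₂ : Store) (b : BExp) (p : Cmd) (t₁ t₂ : ℕ)
      (hb : b.eval m s₀ = some true) (hp : Exec m p s₀ s₁ t₁)
      (hl : Exec m (Cmd.loop b p) s₁ s₂ t₂) :
      Exec m (Cmd.loop b p) s₀ s₂ (b.size + 1 + t₁ + t₂)

/- Input and output of the machine. -/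

/-- The coordinates of the vertices of a curve, one vertex after the other. -/
def Curve.coords {d : ℕ} (P : Curve d) : List ℝ :=
  List.ofFn fun k : Fin (P.card * d) => P.vtx k.divNat k.modNat

/-- `L` lists the intervals in `A` without repetition, from left to right. (A sorted array is a
balanced search tree for the endpoints of interior-disjoint intervals; it can be searched for the
rank of a query point in logarithmic time.) -/
def IsSearchTable (L : List (ℝ × ℝ)) (A : Set (ℝ × ℝ)) : Prop :=
  L.Pairwise (fun I J => I.1 < J.1) ∧ ∀ J, J ∈ L ↔ J ∈ A

/-- The machine whose read-only input consists of `|T|`, `|S|`, `ℓ`, `Δ`, the vertices of `T`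
and `S`, and two tables of intervals, given by their sizes, left and right endpoints. -/
def inputMachine {d : ℕ} (T S : Curve d) (ℓ : ℕ) (Δ : ℝ) (tabU tabC : List (ℝ × ℝ))
    (cells maxInt : ℕ) : Machine where
  inN := [T.card, S.card, ℓ, tabU.length, tabC.length]
  inR := [[Δ], T.coords, S.coords, tabU.map Prod.fst, tabU.map Prod.snd,
    tabC.map Prod.fst, tabC.map Prod.snd]
  cells := cells
  maxInt := maxInt

/-- The store `s` contains the pathlet `p` as output: its reference curve is `S[i, j]` for the
integers `i`, `j` in registers `0` and `1`, and its intervals are stored, as consecutive pairs of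
endpoints, in the first `2 k` cells of the real memory, for the integer `k` in register `2`. -/
def Outputs {d : ℕ} (S : Curve d) (cells : ℕ) (s : Store) (p : Pathlet d) : Prop :=
  (∃ h : 1 ≤ s.nreg 0 ∧ s.nreg 0 ≤ s.nreg 1 ∧ s.nreg 1 ≤ S.card,
    p.ref = S.sub (s.nreg 0) (s.nreg 1) h) ∧
  2 * s.nreg 2 ≤ cells ∧
  p.ivs = {I | ∃ k < s.nreg 2, I = (s.rmem (2 * k), s.rmem (2 * k + 1))}

end

end Subtraj

open Subtraj

namespace Subtraj

open Filter Topology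

/-! ### Reparametrisations -/

/-! Fix a start vertex `i` of `S` and let `q` be the vertex sequence from `i` on, with the vertex
`i` repeated at index `0`. In the free space diagram of `q` and `T`, a cell is the product of an
edge of `q` and an edge of `T`. Its free part is convex, so two free points of a cell are joined by
a matching as soon as they are in the right order (`matched_cell`). It is therefore enough to know
which free points of the cell boundaries (the doors) can be reached from a start `a` on `T`; this is
the recursion `HReach`, `VReach`. By `frechetDist_sub_le_of_hReach` and
`hReach_of_frechetDist_sub_le`, the interval `[a, b]` matches the curve with `k` vertices exactly
when the point `b` of line `k` is reachable from `a`. All curves with the same start share one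
diagram, so a single upward pass per start treats all of them.

For a fixed curve, a column needs only one interval: the least start that reaches its top door also
reaches the right end of that door, and the interval between the two contains every other interval
ending in the column. So fewer than `n` intervals have the largest possible union, `reachCover`. As
`covSet U C` is contained in `U`, the value of the pathlet is a difference of two counts, of
intervals of `U` and of intervals of `covSet U C` inside this union. Merging the intervals from
right to left and searching the tables for the ends of each component gives both counts
(`wp_sweep`).

The least start for each point of a door is stored as a staircase of non-dominated pairs of a
position and a start, in a double-ended queue called a lane. On the way to the opposite door,
positions right of the new door die, positions left of it are lifted to its left end, and everything
entering through the perpendicular door may arrive anywhere, so only its least start matters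
(`Lane.step`). Each step pushes one entry, hence takes amortised constant time.

There are at most `n` starts, `ℓ` lines and `n` columns. A cell costs amortised `O(d)`, and the
counting costs `O(log n)` per buffered interval, so the time is even `O(n² ℓ log n)`. The lane of a
column gains at most one slot per line, so `O(n ℓ)` cells suffice. Correctness and running time of
the program are proved together in a weakest precondition calculus, whose loop invariants carry a
budget of steps (`wp_loop`). -/

theorem IsReparam.mem {f : ℝ → ℝ} {a b : ℝ} (h : IsReparam f a b) {t : ℝ}
    (ht : t ∈ Set.Icc (0 : ℝ) 1) : f t ∈ Set.Icc a b :=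
  h.2 ▸ Set.mem_image_of_mem f ht

theorem IsReparam.le {f : ℝ → ℝ} {a b : ℝ} (h : IsReparam f a b) : a ≤ b :=
  (h.mem (t := 0) (by simp)).1.trans (h.mem (t := 0) (by simp)).2

theorem IsReparam.map_zero {f : ℝ → ℝ} {a b : ℝ} (h : IsReparam f a b) : f 0 = a := by
  have ha : a ∈ f '' Set.Icc 0 1 := h.2 ▸ Set.left_mem_Icc.2 h.le
  obtain ⟨t, ht, hta⟩ := ha
  exact le_antisymm (hta ▸ h.1 (by simp) ht ht.1) (h.mem (by simp)).1

theorem IsReparam.map_one {f : ℝ → ℝ} {a b : ℝ} (h : IsReparam f a b) : f 1 = b := by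
  have hb : b ∈ f '' Set.Icc 0 1 := h.2 ▸ Set.right_mem_Icc.2 h.le
  obtain ⟨t, ht, htb⟩ := hb
  exact le_antisymm (h.mem (by simp)).2 (htb ▸ h.1 ht (by simp) ht.2)

/-- If the only known preimage of `v` comes after `t`, monotonicity squeezes `f t` to `v`. This
supplies the times at which a path crosses a given line or column. -/
theorem IsReparam.exists_le {f : ℝ → ℝ} {a b : ℝ} (h : IsReparam f a b) {t v : ℝ}
    (ht : t ∈ Set.Icc (0 : ℝ) 1) (hav : a ≤ v) (hv : v ≤ f t) :
    ∃ t' ∈ Set.Icc (0 : ℝ) 1, t' ≤ t ∧ f t' = v := by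
  have hb : v ∈ f '' Set.Icc 0 1 := h.2 ▸ ⟨hav, hv.trans (h.mem ht).2⟩
  obtain ⟨t', ht', htv⟩ := hb
  rcases le_total t' t with hle | hle
  · exact ⟨t', ht', hle, htv⟩
  · exact ⟨t, ht, le_rfl, le_antisymm (htv ▸ h.1 ht ht' hle) hv⟩

theorem isReparam_linear {a b : ℝ} (hab : a ≤ b) : IsReparam (fun t => a + t * (b - a)) a b := by
  refine ⟨fun s _ t _ hst => by nlinarith, Set.eq_of_subset_of_subset ?_ ?_⟩
  · rintro _ ⟨t, ⟨h0, h1⟩, rfl⟩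
    exact ⟨by nlinarith, by nlinarith⟩
  · rintro v ⟨h1, h2⟩
    rcases hab.eq_or_lt with rfl | hlt
    · exact ⟨0, by simp, by simpa using h1.antisymm h2⟩
    · refine ⟨(v - a) / (b - a), ⟨div_nonneg (by linarith) (by linarith), ?_⟩, ?_⟩
      · rw [div_le_one (by linarith)]; linarith
      · have : b - a ≠ 0 := by linarith
        field_simp; ring

theorem IsReparam.concat {f g : ℝ → ℝ} {a b c : ℝ} (hf : IsReparam f a b) (hg : IsReparam g b c) :
    IsReparam (fun t => if t ≤ 1 / 2 then f (2 * t) else g (2 * t - 1)) a c := by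
  have hac := hf.le
  have hbc := hg.le
  refine ⟨fun s hs t ht hst => ?_, Set.eq_of_subset_of_subset ?_ ?_⟩
  · obtain ⟨hs0, hs1⟩ := hs
    obtain ⟨ht0, ht1⟩ := ht
    dsimp only
    split_ifs with h1 h2 h2
    · exact hf.1 ⟨by linarith, by linarith⟩ ⟨by linarith, by linarith⟩ (by linarith)
    · exact (hf.mem ⟨by linarith, by linarith⟩).2.trans
        (hg.mem ⟨by linarith, by linarith⟩).1
    · linarith
    · exact hg.1 ⟨by linarith, by linarith⟩ ⟨by linarith, by linarith⟩ (by linarith)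
  · rintro _ ⟨t, ⟨h0, h1⟩, rfl⟩
    dsimp only
    split_ifs with h
    · have := hf.mem (t := 2 * t) ⟨by linarith, by linarith⟩
      exact ⟨this.1, this.2.trans hbc⟩
    · have := hg.mem (t := 2 * t - 1) ⟨by linarith, by linarith⟩
      exact ⟨hac.trans this.1, this.2⟩
  · rintro v ⟨h1, h2⟩
    rcases le_or_gt v b with hv | hv
    · have hb : v ∈ f '' Set.Icc 0 1 := hf.2 ▸ ⟨h1, hv⟩
      obtain ⟨t, ⟨h0, h1⟩, rfl⟩ := hb
      refine ⟨t / 2, ⟨by linarith, by linarith⟩, ?_⟩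
      dsimp only
      rw [if_pos (by linarith)]
      congr 1; ring
    · have hb : v ∈ g '' Set.Icc 0 1 := hg.2 ▸ ⟨hv.le, h2⟩
      obtain ⟨t, ⟨h0, h1⟩, rfl⟩ := hb
      -- At time `1 / 2` the concatenation still follows `f`, so the preimage under `g` must not be
      -- `0`.
      have ht : 0 < t := by
        rcases h0.eq_or_lt with rfl | h
        · rw [hg.map_zero] at hv; exact absurd hv (lt_irrefl _)
        · exact h
      refine ⟨(t + 1) / 2, ⟨by linarith, by linarith⟩, ?_⟩
      dsimp only
      rw [if_neg (by linarith)]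
      congr 1; ring

/-! ### Piecewise linear maps -/

variable {d : ℕ}

/-- The piecewise linear map with value `p k` at `k`. -/
noncomputable def plEval (p : ℕ → Point d) (x : ℝ) : Point d :=
  AffineMap.lineMap (p ⌊x⌋₊) (p (⌊x⌋₊ + 1)) (x - (⌊x⌋₊ : ℝ))

/-- The right end `c + 1` is included although its floor belongs to the next cell, because both
formulas give `p (c + 1)` there. Cells can thus be treated as closed. -/
theorem plEval_cell (p : ℕ → Point d) (c : ℕ) {x : ℝ} (h1 : (c : ℝ) ≤ x) (h2 : x ≤ c + 1) :
    plEval p x = AffineMap.lineMap (p c) (p (c + 1)) (x - c) := by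
  rcases h2.eq_or_lt with rfl | h2
  · have : ⌊(c : ℝ) + 1⌋₊ = c + 1 := by exact_mod_cast Nat.floor_natCast (R := ℝ) (c + 1)
    simp [plEval, this]
  · have : ⌊x⌋₊ = c := (Nat.floor_eq_iff (by linarith [Nat.cast_nonneg (α := ℝ) c])).2 ⟨h1, h2⟩
    simp [plEval, this]

theorem plEval_natCast (p : ℕ → Point d) (c : ℕ) : plEval p c = p c := by
  simp [plEval_cell p c le_rfl (by linarith)]

theorem plEval_congr {p q : ℕ → Point d} {m : ℕ} (h : ∀ k ≤ m, p k = q k) {x : ℝ} (h0 : 0 ≤ x)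
    (hx : x ≤ m) : plEval p x = plEval q x := by
  have hf := Nat.floor_le h0
  rcases (Nat.floor_le_of_le hx).eq_or_lt with h1 | h1
  · have : x = m := le_antisymm hx (h1 ▸ hf)
    rw [this, plEval_natCast, plEval_natCast, h m le_rfl]
  · simp only [plEval, h _ h1.le, h _ h1]

theorem plEval_max_one {q : ℕ → Point d} (hq : q 0 = q 1) {x : ℝ} (h0 : 0 ≤ x) :
    plEval q (max x 1) = plEval q x := by
  rcases le_total x 1 with h | h
  · have := plEval_natCast q 1
    rw [Nat.cast_one] at this
    rw [max_eq_right h, this, plEval_cell q 0 (by simpa using h0) (by simpa using h)]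
    simp [hq]
  · rw [max_eq_left h]

/-- The vertices of the curves `S[i, j]`, the first one being repeated at the index `0`. -/
noncomputable def Curve.from (S : Curve d) (i k : ℕ) : Point d := S.vertex (i + (k - 1))

theorem Curve.sub_vertex (S : Curve d) {i j : ℕ} (h : 1 ≤ i ∧ i ≤ j ∧ j ≤ S.card) {k : ℕ}
    (hk : k ≤ j - i + 1) : (S.sub i j h).vertex k = S.from i k := by
  simp only [Curve.vertex, Curve.sub, Curve.from]
  congr 1
  ext
  simp only
  omega

/-- Only boundedness matters: it keeps the supremum in `matchingCost` from being the default value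
`0`. -/
theorem Curve.norm_eval_le (P : Curve d) : ∃ B, ∀ x, 0 ≤ x → ‖P.eval x‖ ≤ B := by
  refine ⟨(∑ k, ‖P.vtx k‖) + ∑ k, ‖P.vtx k‖, fun x hx => ?_⟩
  have hv : ∀ k, ‖P.vertex k‖ ≤ ∑ k, ‖P.vtx k‖ := fun k =>
    Finset.single_le_sum (f := fun k => ‖P.vtx k‖) (fun _ _ => norm_nonneg _) (Finset.mem_univ _)
  have h1 := Nat.floor_le hx
  have h2 := Nat.lt_floor_add_one x
  rw [Curve.eval, AffineMap.lineMap_apply_module]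
  refine (norm_add_le _ _).trans (add_le_add ?_ ?_)
  · rw [norm_smul, Real.norm_of_nonneg (by linarith)]
    exact (mul_le_of_le_one_left (norm_nonneg _) (by linarith)).trans (hv _)
  · rw [norm_smul, Real.norm_of_nonneg (by linarith)]
    exact (mul_le_of_le_one_left (norm_nonneg _) (by linarith)).trans (hv _)

/-! ### Matchings of bounded cost -/

/-- There is a matching of cost at most `r` between `q` on `[y, z]` and `p` on `[a, b]`. -/
def Matched (q p : ℕ → Point d) (r y z a b : ℝ) : Prop :=
  ∃ f g : ℝ → ℝ, IsReparam f y z ∧ IsReparam g a b ∧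
    ∀ t ∈ Set.Icc (0 : ℝ) 1, ‖plEval q (f t) - plEval p (g t)‖ ≤ r

theorem Matched.trans {q p : ℕ → Point d} {r y₁ y₂ y₃ x₁ x₂ x₃ : ℝ}
    (h : Matched q p r y₁ y₂ x₁ x₂) (h' : Matched q p r y₂ y₃ x₂ x₃) :
    Matched q p r y₁ y₃ x₁ x₃ := by
  obtain ⟨f, g, hf, hg, hfg⟩ := h
  obtain ⟨f', g', hf', hg', hfg'⟩ := h'
  refine ⟨_, _, hf.concat hf', hg.concat hg', fun t ht => ?_⟩
  split_ifs with h
  · exact hfg _ ⟨by linarith [ht.1], by linarith⟩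
  · exact hfg' _ ⟨by linarith, by linarith [ht.2]⟩

/-- Inside a cell both curves are affine, so the difference vector along the straight path is affine
in time, and its norm is at most the larger of the norms at the two ends. -/
theorem matched_cell {q p : ℕ → Point d} {r : ℝ} (c m : ℕ) {x x' y y' : ℝ}
    (hx : c ≤ x) (hxx : x ≤ x') (hx' : x' ≤ c + 1) (hy : m ≤ y) (hyy : y ≤ y') (hy' : y' ≤ m + 1)
    (h : ‖plEval q y - plEval p x‖ ≤ r) (h' : ‖plEval q y' - plEval p x'‖ ≤ r) :
    Matched q p r y y' x x' := by
  refine ⟨_, _, isReparam_linear hyy, isReparam_linear hxx, fun t ht => ?_⟩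
  obtain ⟨h0, h1⟩ := ht
  rw [plEval_cell q m hy (by linarith), plEval_cell p c hx (by linarith)] at h
  rw [plEval_cell q m (by linarith) hy', plEval_cell p c (by linarith) hx'] at h'
  rw [plEval_cell q m (by nlinarith) (by nlinarith), plEval_cell p c (by nlinarith) (by nlinarith)]
  have key : AffineMap.lineMap (q m) (q (m + 1)) (y + t * (y' - y) - m) -
      AffineMap.lineMap (p c) (p (c + 1)) (x + t * (x' - x) - c) =
      (1 - t) • (AffineMap.lineMap (q m) (q (m + 1)) (y - m) -
        AffineMap.lineMap (p c) (p (c + 1)) (x - c)) +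
      t • (AffineMap.lineMap (q m) (q (m + 1)) (y' - m) -
        AffineMap.lineMap (p c) (p (c + 1)) (x' - c)) := by
    simp only [AffineMap.lineMap_apply_module]
    module
  rw [key]
  refine (norm_add_le _ _).trans ?_
  rw [norm_smul, norm_smul, Real.norm_of_nonneg h0, Real.norm_of_nonneg (by linarith : 0 ≤ 1 - t)]
  nlinarith

/-- On the degenerate edge `[0, 1]` the curve `q` is constant, so raising the parameter to at least
`1` leaves every distance unchanged. This removes the repeated first vertex from a matching found by
the recursion. -/
theorem Matched.of_zero {q p : ℕ → Point d} {r a b z : ℝ} (hq : q 0 = q 1) (hz : 1 ≤ z)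
    (h : Matched q p r 0 z a b) : Matched q p r 1 z a b := by
  obtain ⟨f, g, hf, hg, hfg⟩ := h
  refine ⟨fun t => max (f t) 1, g, ⟨fun s hs t ht hst => ?_, ?_⟩, hg, fun t ht => ?_⟩
  · exact max_le_max (hf.1 hs ht hst) le_rfl
  · refine Set.eq_of_subset_of_subset ?_ ?_
    · rintro _ ⟨t, ht, rfl⟩
      exact ⟨le_max_right _ _, max_le (hf.mem ht).2 hz⟩
    · rintro v ⟨h1, h2⟩
      have hv : v ∈ f '' Set.Icc 0 1 := hf.2 ▸ ⟨by linarith, h2⟩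
      obtain ⟨t, ht, rfl⟩ := hv
      exact ⟨t, ht, max_eq_left h1⟩
  · rw [plEval_max_one hq (hf.mem ht).1]
    exact hfg t ht

theorem frechetDist_le_of_matched {P T : Curve d} {r y z a b : ℝ} (hr : 0 ≤ r)
    (h : Matched P.vertex T.vertex r y z a b) : frechetDist P.eval y z T.eval a b ≤ r := by
  obtain ⟨f, g, hf, hg, hfg⟩ := h
  have hm : matchingCost P.eval T.eval f g ∈ {r | ∃ f g : ℝ → ℝ, IsReparam f y z ∧
    IsReparam g a b ∧ r = matchingCost P.eval T.eval f g} := ⟨f, g, hf, hg, rfl⟩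
  refine (csInf_le ⟨0, ?_⟩ hm).trans ?_
  · rintro _ ⟨f, g, -, -, rfl⟩
    refine Real.sSup_nonneg ?_
    rintro _ ⟨t, -, rfl⟩
    exact norm_nonneg _
  · refine Real.sSup_le ?_ hr
    rintro _ ⟨t, ht, rfl⟩
    exact hfg t ht

theorem matched_of_frechetDist_lt {P T : Curve d} {r y z a b : ℝ} (hy : 0 ≤ y) (hyz : y ≤ z)
    (ha : 0 ≤ a) (hab : a ≤ b) (h : frechetDist P.eval y z T.eval a b < r) :
    Matched P.vertex T.vertex r y z a b := by
  obtain ⟨_, ⟨f, g, hf, hg, rfl⟩, hlt⟩ := exists_lt_of_csInf_lt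
    (by exact ⟨_, _, _, isReparam_linear hyz, isReparam_linear hab, rfl⟩) h
  -- A cost below `r` bounds the individual distances only if their supremum is a true one.
  suffices hbdd : BddAbove ((fun t => ‖P.eval (f t) - T.eval (g t)‖) '' Set.Icc 0 1) from
    ⟨f, g, hf, hg, fun t ht => (le_csSup hbdd ⟨t, ht, rfl⟩).trans hlt.le⟩
  obtain ⟨B, hB⟩ := P.norm_eval_le
  obtain ⟨B', hB'⟩ := T.norm_eval_le
  refine ⟨B + B', ?_⟩
  rintro _ ⟨t, ht, rfl⟩
  exact (norm_sub_le _ _).trans (add_le_add (hB _ (hy.trans (hf.mem ht).1))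
    (hB' _ (ha.trans (hg.mem ht).1)))

/-! ### Reachability in the free space diagram -/

/-- The point `x` of the `c`-th edge of `p` is close to the vertex `m` of `q`. -/
def HDoor (q p : ℕ → Point d) (r : ℝ) (m c : ℕ) (x : ℝ) : Prop :=
  1 ≤ c ∧ x ∈ Set.Icc (0 : ℝ) 1 ∧ ‖AffineMap.lineMap (p c) (p (c + 1)) x - q m‖ ≤ r

/-- The point `y` of the `m`-th edge of `q` is close to the vertex `c` of `p`. -/
def VDoor (q p : ℕ → Point d) (r : ℝ) (m c : ℕ) (y : ℝ) : Prop :=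
  y ∈ Set.Icc (0 : ℝ) 1 ∧ ‖AffineMap.lineMap (q m) (q (m + 1)) y - p c‖ ≤ r

/-- The points of the `m`-th edge of `q` at the vertex `c` of `p` that can be reached from the
set `H` of points at the vertex `m` of `q`. -/
def VReach (q p : ℕ → Point d) (r : ℝ) (m : ℕ) (H : ℕ → ℝ → Prop) : ℕ → ℝ → Prop
  | 0 => fun _ => False
  | c + 1 => fun y => VDoor q p r m (c + 1) y ∧
      ((∃ y' ≤ y, VReach q p r m H c y') ∨ ∃ x, H c x)

/-- The points of the `c`-th edge of `p` at the vertex `m` of `q` that can be reached from the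
point `a` of `p` at the vertex `0` of `q`. -/
def HReach (q p : ℕ → Point d) (r a : ℝ) : ℕ → ℕ → ℝ → Prop
  | 0 => fun c x => HDoor q p r 0 c x ∧ (c : ℝ) + x = a
  | m + 1 => fun c x => HDoor q p r (m + 1) c x ∧
      ((∃ x' ≤ x, HReach q p r a m c x') ∨ ∃ y, VReach q p r m (HReach q p r a m) c y)

theorem HReach.door {q p : ℕ → Point d} {r a : ℝ} {m c : ℕ} {x : ℝ} (h : HReach q p r a m c x) :
    HDoor q p r m c x := by
  cases m <;> exact h.1

theorem VReach.door {q p : ℕ → Point d} {r : ℝ} {m c : ℕ} {H : ℕ → ℝ → Prop} {y : ℝ}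
    (h : VReach q p r m H c y) : VDoor q p r m c y := by
  cases c with
  | zero => exact h.elim
  | succ c => exact h.1

/-- False at line `0`, where the position determines the start. From line `1` on, a path may end
further right in the same door. -/
theorem HReach.mono {q p : ℕ → Point d} {r a : ℝ} {m c : ℕ} {x x' : ℝ}
    (h : HReach q p r a (m + 1) c x) (hx : x ≤ x') (h' : HDoor q p r (m + 1) c x') :
    HReach q p r a (m + 1) c x' := by
  obtain ⟨-, ⟨z, hz, hH⟩ | h⟩ := h
  · exact ⟨h', .inl ⟨z, hz.trans hx, hH⟩⟩
  · exact ⟨h', .inr h⟩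

theorem HDoor.norm_le {q p : ℕ → Point d} {r : ℝ} {m c : ℕ} {x : ℝ} (h : HDoor q p r m c x) :
    ‖plEval q m - plEval p (c + x)‖ ≤ r := by
  obtain ⟨-, ⟨h0, h1⟩, h⟩ := h
  rw [plEval_natCast, plEval_cell p c (by linarith) (by linarith), norm_sub_rev]
  simpa using h

theorem VDoor.norm_le {q p : ℕ → Point d} {r : ℝ} {m c : ℕ} {y : ℝ} (h : VDoor q p r m c y) :
    ‖plEval q (m + y) - plEval p c‖ ≤ r := by
  obtain ⟨⟨h0, h1⟩, h⟩ := h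
  rw [plEval_natCast, plEval_cell q m (by linarith) (by linarith)]
  simpa using h

/-- The hypothesis `hH` is the claim of `HReach.matched` at line `m`: the induction on columns runs
inside the induction on lines. -/
theorem VReach.matched {q p : ℕ → Point d} {r a : ℝ} {m : ℕ}
    (hH : ∀ c x, HReach q p r a m c x → 1 ≤ a ∧ a ≤ c + x ∧ Matched q p r 0 m a (c + x))
    (c : ℕ) : ∀ y, VReach q p r m (HReach q p r a m) c y →
      1 ≤ a ∧ a ≤ c ∧ Matched q p r 0 (m + y) a c := by
  induction c with
  | zero => exact fun y h => h.elim
  | succ c ih =>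
    rintro y ⟨hd, ⟨y', hy, h⟩ | ⟨x, h⟩⟩
    · obtain ⟨h1, h2, h3⟩ := ih y' h
      refine ⟨h1, by push_cast; linarith, h3.trans ?_⟩
      have hd' := h.door
      exact matched_cell c m le_rfl (by push_cast; linarith) (by push_cast; linarith)
        (by linarith [hd'.1.1]) (by linarith) (by linarith [hd.1.2]) hd'.norm_le hd.norm_le
    · obtain ⟨h1, h2, h3⟩ := hH c x h
      have hd' := h.door
      have := hd'.2.1.2
      refine ⟨h1, by push_cast; linarith, h3.trans ?_⟩
      exact matched_cell c m (by linarith [hd'.2.1.1]) (by push_cast; linarith)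
        (by push_cast; linarith) (by linarith) (by linarith [hd.1.1]) (by linarith [hd.1.2])
        hd'.norm_le hd.norm_le

theorem HReach.matched {q p : ℕ → Point d} {r a : ℝ} (m : ℕ) : ∀ (c : ℕ) (x : ℝ),
    HReach q p r a m c x → 1 ≤ a ∧ a ≤ c + x ∧ Matched q p r 0 m a (c + x) := by
  induction m with
  | zero =>
    rintro c x ⟨h, rfl⟩
    have h1 : (1 : ℝ) ≤ c := by exact_mod_cast h.1
    have h2 := h.2.1
    refine ⟨by linarith [h2.1], le_rfl, ?_⟩
    exact matched_cell c 0 (by linarith [h2.1]) le_rfl (by linarith [h2.2]) (by simp) (by simp)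
      (by simp) (by simpa using h.norm_le) (by simpa using h.norm_le)
  | succ m ih =>
    rintro c x ⟨hd, ⟨x', hx, h⟩ | ⟨y, h⟩⟩
    · obtain ⟨h1, h2, h3⟩ := ih c x' h
      have hd' := h.door
      refine ⟨h1, by linarith, h3.trans ?_⟩
      exact matched_cell c m (by linarith [hd'.2.1.1]) (by linarith)
        (by linarith [hd.2.1.2]) le_rfl (by push_cast; linarith) (by push_cast; linarith)
        hd'.norm_le hd.norm_le
    · obtain ⟨h1, h2, h3⟩ := VReach.matched ih c y h
      have hd' := h.door
      refine ⟨h1, by linarith [hd.2.1.1], h3.trans ?_⟩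
      exact matched_cell c m le_rfl (by linarith [hd.2.1.1])
        (by linarith [hd.2.1.2]) (by linarith [hd'.1.1]) (by push_cast; linarith [hd'.1.2])
        (by push_cast; linarith) hd'.norm_le hd.norm_le

/-! ### Completeness: every matching is found by the recursion -/

section Path

variable {q p : ℕ → Point d} {r a b z : ℝ} {f g : ℝ → ℝ}

/-- Look back from the time `t` to the times at which the path met the bottom line and the left
border of the cell; the later of the two is where it entered. In row `0` the path waits at the
repeated vertex. If it starts in this column, its entry is placed on line `0` at `a` itself, which
is free because `q 0 = q 1`. -/
theorem reach_entry (hq : q 0 = q 1) (hf : IsReparam f 1 z) (hg : IsReparam g a b)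
    (hfg : ∀ t ∈ Set.Icc (0 : ℝ) 1, ‖plEval q (f t) - plEval p (g t)‖ ≤ r) (m c : ℕ)
    (hc : 1 ≤ c)
    (hH : ∀ t ∈ Set.Icc (0 : ℝ) 1, f t = m → c ≤ g t → g t ≤ c + 1 →
      HReach q p r a m c (g t - c))
    (hV : ∀ t ∈ Set.Icc (0 : ℝ) 1, g t = c → a < c → m ≤ f t → f t ≤ m + 1 →
      VReach q p r m (HReach q p r a m) c (f t - m))
    {t : ℝ} (ht : t ∈ Set.Icc (0 : ℝ) 1) (h1 : c ≤ g t) (h2 : g t ≤ c + 1) (h3 : m ≤ f t)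
    (h4 : f t ≤ m + 1) :
    (∃ x ≤ g t - c, HReach q p r a m c x) ∨
      ∃ y ≤ f t - m, VReach q p r m (HReach q p r a m) c y := by
  have hat := (hg.mem ht).1
  rcases Nat.eq_zero_or_pos m with rfl | hm
  · rcases le_or_gt (c : ℝ) a with hca | hca
    · refine .inl ⟨a - c, by linarith, ⟨hc, ⟨by linarith, by linarith⟩, ?_⟩, by ring⟩
      have := hfg 0 (by simp)
      rw [hf.map_zero, hg.map_zero, plEval_cell p c hca (by linarith), norm_sub_rev] at this
      have h1 := plEval_natCast q 1
      rw [Nat.cast_one] at h1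
      rwa [h1, ← hq] at this
    · obtain ⟨t', ht', htt, hgt⟩ := hg.exists_le ht hca.le h1
      have hft := hf.1 ht' ht htt
      refine .inr ⟨f t' - (0 : ℕ), by linarith, hV t' ht' hgt hca ?_ (by linarith)⟩
      have := (hf.mem ht').1
      push_cast; linarith
  · obtain ⟨t₂, ht₂, htt₂, hft₂⟩ := hf.exists_le ht (by exact_mod_cast hm) h3
    rcases le_or_gt (c : ℝ) a with hca | hca
    · have := (hg.mem ht₂).1
      have := hg.1 ht₂ ht htt₂
      exact .inl ⟨_, by linarith, hH t₂ ht₂ hft₂ (by linarith) (by linarith)⟩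
    · obtain ⟨t₁, ht₁, htt₁, hgt₁⟩ := hg.exists_le ht hca.le h1
      rcases le_total t₁ t₂ with h | h
      · have := hg.1 ht₁ ht₂ h
        have := hg.1 ht₂ ht htt₂
        exact .inl ⟨_, by linarith, hH t₂ ht₂ hft₂ (by linarith) (by linarith)⟩
      · have := hf.1 ht₂ ht₁ h
        have := hf.1 ht₁ ht htt₁
        exact .inr ⟨_, by linarith, hV t₁ ht₁ hgt₁ hca (by linarith) (by linarith)⟩

/-- The strict inequality `a < c` is needed: a path that starts at the vertex `c` itself is recorded
as a start in the column `c`, not as a crossing of its left border. -/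
theorem vReach_of_path (hq : q 0 = q 1) (ha : 1 ≤ a) (hf : IsReparam f 1 z)
    (hg : IsReparam g a b)
    (hfg : ∀ t ∈ Set.Icc (0 : ℝ) 1, ‖plEval q (f t) - plEval p (g t)‖ ≤ r) (m : ℕ)
    (hH : ∀ c : ℕ, 1 ≤ c → ∀ t ∈ Set.Icc (0 : ℝ) 1, f t = m → c ≤ g t → g t ≤ c + 1 →
      HReach q p r a m c (g t - c)) (c : ℕ) :
    ∀ t ∈ Set.Icc (0 : ℝ) 1, g t = c → a < c → m ≤ f t → f t ≤ m + 1 →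
      VReach q p r m (HReach q p r a m) c (f t - m) := by
  induction c with
  | zero =>
    intro t _ _ h
    rw [Nat.cast_zero] at h
    linarith
  | succ c ih =>
    intro t ht hgt hac h1 h2
    have hc : 1 ≤ c := by
      have : (1 : ℝ) < (c + 1 : ℕ) := by linarith
      have : 1 < c + 1 := by exact_mod_cast this
      omega
    push_cast at hgt
    refine ⟨⟨⟨by linarith, by linarith⟩, ?_⟩, ?_⟩
    · have := hfg t ht
      rwa [plEval_cell q m h1 h2, hgt, ← Nat.cast_add_one, plEval_natCast] at this
    · rcases reach_entry hq hf hg hfg m c hc (hH c hc) ih ht (by linarith) (by linarith) h1 h2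
        with ⟨x, -, h⟩ | h
      · exact .inr ⟨x, h⟩
      · exact .inl h

/-- Line `0` is vacuous, since `f` takes values in `[1, z]`; the actual start of the induction is
hidden in the row `0` case of `reach_entry`. -/
theorem hReach_of_path (hq : q 0 = q 1) (ha : 1 ≤ a) (hf : IsReparam f 1 z)
    (hg : IsReparam g a b)
    (hfg : ∀ t ∈ Set.Icc (0 : ℝ) 1, ‖plEval q (f t) - plEval p (g t)‖ ≤ r) (m : ℕ) :
    ∀ c : ℕ, 1 ≤ c → ∀ t ∈ Set.Icc (0 : ℝ) 1, f t = m → c ≤ g t → g t ≤ c + 1 →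
      HReach q p r a m c (g t - c) := by
  induction m with
  | zero =>
    intro c _ t ht h
    have := (hf.mem ht).1
    rw [h, Nat.cast_zero] at this
    linarith
  | succ m ih =>
    intro c hc t ht hft h1 h2
    refine ⟨⟨hc, ⟨by linarith, by linarith⟩, ?_⟩, ?_⟩
    · have := hfg t ht
      rwa [plEval_cell p c h1 h2, hft, plEval_natCast, norm_sub_rev] at this
    · push_cast at hft
      rcases reach_entry hq hf hg hfg m c hc (ih c hc)
        (vReach_of_path hq ha hf hg hfg m ih c) ht h1 h2 (by linarith) (by linarith) with h |
            ⟨y, -, h⟩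
      · exact .inl h
      · exact .inr ⟨y, h⟩

theorem hReach_of_matched {m c : ℕ} (hq : q 0 = q 1) (ha : 1 ≤ a) (hc : 1 ≤ c) (hcb : c ≤ b)
    (hbc : b ≤ c + 1) (h : Matched q p r 1 m a b) : HReach q p r a m c (b - c) := by
  obtain ⟨f, g, hf, hg, hfg⟩ := h
  have := hReach_of_path hq ha hf hg hfg m c hc 1 (by simp) hf.map_one
  rw [hg.map_one] at this
  exact this hcb hbc

end Path

/-! ### Closedness of reachability under limits of the radius -/

section Limit

variable {ι : Type*} {𝒰 : Ultrafilter ι} {ρ : ι → ℝ} {q p : ℕ → Point d} {r a : ℝ}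

theorem exists_tendsto_of_eventually_mem_Icc {x : ι → ℝ}
    (h : ∀ᶠ e in (𝒰 : Filter ι), x e ∈ Set.Icc (0 : ℝ) 1) :
    ∃ x₀, Tendsto x 𝒰 (𝓝 x₀) := by
  obtain ⟨x₀, -, hx⟩ := (isCompact_Icc (a := (0 : ℝ)) (b := 1)).ultrafilter_le_nhds (𝒰.map x)
    (le_principal_iff.2 h)
  exact ⟨x₀, hx⟩

theorem door_limit {x : ι → ℝ} {x₀ : ℝ} {u v w : Point d} (hρ : Tendsto ρ 𝒰 (𝓝 r))
    (hx : Tendsto x 𝒰 (𝓝 x₀))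
    (h : ∀ᶠ e in (𝒰 : Filter ι), x e ∈ Set.Icc (0 : ℝ) 1 ∧ ‖AffineMap.lineMap u v
        (x e) - w‖ ≤ ρ e) :
    x₀ ∈ Set.Icc (0 : ℝ) 1 ∧ ‖AffineMap.lineMap u v x₀ - w‖ ≤ r := by
  refine ⟨isClosed_Icc.mem_of_tendsto hx (h.mono fun e he => he.1), ?_⟩
  refine le_of_tendsto_of_tendsto ?_ hρ (h.mono fun e he => he.2)
  have : Continuous fun x : ℝ => ‖AffineMap.lineMap u v x - w‖ := by
    simp only [AffineMap.lineMap_apply_module]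
    fun_prop
  exact (this.tendsto x₀).comp hx

/-- Along an ultrafilter one of the two alternatives of the recursion holds eventually, and the
chosen intermediate points converge because doors lie in the compact interval `[0, 1]`. So no
subsequences have to be extracted at each level of the recursion. -/
theorem vReach_limit (hρ : Tendsto ρ 𝒰 (𝓝 r)) (m : ℕ)
    (hH : ∀ (c : ℕ) (x : ι → ℝ) (x₀ : ℝ),
      (∀ᶠ e in (𝒰 : Filter ι), HReach q p (ρ e) a m c (x e)) → Tendsto x 𝒰 (𝓝 x₀) →
      HReach q p r a m c x₀) (c : ℕ) :
    ∀ (y : ι → ℝ) (y₀ : ℝ),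
      (∀ᶠ e in (𝒰 : Filter ι), VReach q p (ρ e) m (HReach q p (ρ e) a m) c (y e)) →
      Tendsto y 𝒰 (𝓝 y₀) → VReach q p r m (HReach q p r a m) c y₀ := by
  induction c with
  | zero => exact fun y y₀ h _ => h.exists.elim fun _ h => h
  | succ c ih =>
    intro y y₀ h hy
    refine ⟨door_limit hρ hy (h.mono fun e he => he.1), ?_⟩
    rcases Ultrafilter.eventually_or.1 (h.mono fun e he => he.2) with h | h
    · obtain ⟨y', hy'⟩ := h.choice
      obtain ⟨y₁, h₁⟩ := exists_tendsto_of_eventually_mem_Icc (hy'.mono fun e he => he.2.door.1)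
      exact .inl ⟨y₁, le_of_tendsto_of_tendsto h₁ hy (hy'.mono fun e he => he.1),
        ih y' y₁ (hy'.mono fun e he => he.2) h₁⟩
    · obtain ⟨x, hx⟩ := h.choice
      obtain ⟨x₁, h₁⟩ := exists_tendsto_of_eventually_mem_Icc (hx.mono fun e he => he.door.2.1)
      exact .inr ⟨x₁, hH c x x₁ hx h₁⟩

theorem hReach_limit (hρ : Tendsto ρ 𝒰 (𝓝 r)) (m : ℕ) : ∀ (c : ℕ) (x : ι → ℝ) (x₀ : ℝ),
    (∀ᶠ e in (𝒰 : Filter ι), HReach q p (ρ e) a m c (x e)) → Tendsto x 𝒰 (𝓝 x₀) →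
      HReach q p r a m c x₀ := by
  induction m with
  | zero =>
    intro c x x₀ h hx
    obtain ⟨e, he⟩ := h.exists
    refine ⟨⟨he.1.1, door_limit hρ hx (h.mono fun e he => he.1.2)⟩, ?_⟩
    exact tendsto_nhds_unique ((hx.const_add (c : ℝ))) (tendsto_const_nhds.congr'
      (h.mono fun e he => he.2.symm))
  | succ m ih =>
    intro c x x₀ h hx
    obtain ⟨e, he⟩ := h.exists
    refine ⟨⟨he.1.1, door_limit hρ hx (h.mono fun e he => he.1.2)⟩, ?_⟩
    rcases Ultrafilter.eventually_or.1 (h.mono fun e he => he.2) with h | h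
    · obtain ⟨x', hx'⟩ := h.choice
      obtain ⟨x₁, h₁⟩ := exists_tendsto_of_eventually_mem_Icc (hx'.mono fun e he => he.2.door.2.1)
      exact .inl ⟨x₁, le_of_tendsto_of_tendsto h₁ hx (hx'.mono fun e he => he.1),
        ih c x' x₁ (hx'.mono fun e he => he.2) h₁⟩
    · obtain ⟨y, hy⟩ := h.choice
      obtain ⟨y₁, h₁⟩ := exists_tendsto_of_eventually_mem_Icc (hy.mono fun e he => he.door.1)
      exact .inr ⟨y₁, vReach_limit hρ m ih c y y₁ hy h₁⟩

end Limit

/-! ### Reachability and the Fréchet distance of vertex subcurves -/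

theorem Matched.congr {q q' p p' : ℕ → Point d} {r a b : ℝ} {m n : ℕ}
    (hq : ∀ k ≤ m, q k = q' k) (ha : 1 ≤ a) (hb : b ≤ n) (hp : ∀ k ≤ n, p k = p' k)
    (h : Matched q p r 1 m a b) : Matched q' p' r 1 m a b := by
  obtain ⟨f, g, hf, hg, hfg⟩ := h
  refine ⟨f, g, hf, hg, fun t ht => ?_⟩
  have h1 := hf.mem ht
  have h2 := hg.mem ht
  rw [← plEval_congr hq (by linarith [h1.1]) h1.2,
    ← plEval_congr hp (by linarith [h2.1]) (by linarith [h2.2])]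
  exact hfg t ht

theorem frechetDist_sub_le_of_hReach {S T : Curve d} {i j : ℕ} (h : 1 ≤ i ∧ i ≤ j ∧ j ≤ S.card)
    {r a x : ℝ} (hr : 0 ≤ r) {c : ℕ} (hc : c < T.card)
    (hR : HReach (S.from i) T.vertex r a (j - i + 1) c x) :
    1 ≤ a ∧ a ≤ c + x ∧ c + x ≤ T.card ∧
      frechetDist (S.sub i j h).eval 1 (S.sub i j h).card T.eval a (c + x) ≤ r := by
  obtain ⟨h1, h2, h3⟩ := hR.matched
  have h4 : (c : ℝ) + 1 ≤ T.card := by exact_mod_cast hc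
  have h5 := hR.door.2.1.2
  refine ⟨h1, h2, by linarith, frechetDist_le_of_matched hr ?_⟩
  refine Matched.congr (n := T.card) (fun k hk => (S.sub_vertex h hk).symm) h1 (by linarith)
    (fun _ _ => rfl) (h3.of_zero (by simp [Curve.from]) (by simp [Curve.sub]))

/-- The infimum in the Fréchet distance is not known to be attained, so matchings are available only
for radii `e > r`. Each gives reachability at `e`, and `hReach_limit` lets `e` tend to `r`. -/
theorem hReach_of_frechetDist_sub_le {S T : Curve d} {i j : ℕ} (h : 1 ≤ i ∧ i ≤ j ∧ j ≤ S.card)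
    {r a b : ℝ} (ha : 1 ≤ a) (hab : a ≤ b) (hb : b ≤ T.card) {c : ℕ} (hc : 1 ≤ c) (hcb : c ≤ b)
    (hbc : b ≤ c + 1)
    (hd : frechetDist (S.sub i j h).eval 1 (S.sub i j h).card T.eval a b ≤ r) :
    HReach (S.from i) T.vertex r a (j - i + 1) c (b - c) := by
  let 𝒰 : Ultrafilter ℝ := Ultrafilter.of (𝓝[>] r)
  have h𝒰 : (𝒰 : Filter ℝ) ≤ 𝓝[>] r := Ultrafilter.of_le _
  refine hReach_limit (𝒰 := 𝒰) (ρ := id) (h𝒰.trans nhdsWithin_le_nhds) _ c _ _ ?_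
    tendsto_const_nhds
  have hev : ∀ᶠ e in (𝒰 : Filter ℝ), r < e := h𝒰 self_mem_nhdsWithin
  filter_upwards [hev] with e he
  have hm := matched_of_frechetDist_lt (by norm_num) (by simp [Curve.sub]) (by linarith) hab
    (lt_of_le_of_lt hd he)
  exact hReach_of_matched (by simp [Curve.from]) ha hc hcb hbc
    (Matched.congr (n := T.card) (fun k hk => S.sub_vertex h hk) ha hb (fun _ _ => rfl) hm)

/-! ### Weakest preconditions for the real RAM -/

infixr:60 " ;; " => Cmd.seq

/-- The value of an error-free integer expression. -/
@[simp] def NExp.val (m : Machine) (s : Store) : NExp → ℕ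
  | const k => k
  | reg x => s.nreg x
  | inp k => m.inN.getD k 0
  | mem a => s.nmem (a.val m s)
  | add a b => a.val m s + b.val m s
  | sub a b => a.val m s - b.val m s
  | mul a b => a.val m s * b.val m s
  | div a b => a.val m s / b.val m s

/-- The evaluation of an integer expression is free of errors. -/
@[simp] def NExp.Ok (m : Machine) (s : Store) : NExp → Prop
  | const k => k ≤ m.maxInt
  | reg _ => True
  | inp k => k < m.inN.length ∧ m.inN.getD k 0 ≤ m.maxInt
  | mem a => a.Ok m s ∧ a.val m s < m.cells
  | add a b => a.Ok m s ∧ b.Ok m s ∧ a.val m s + b.val m s ≤ m.maxInt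
  | sub a b => a.Ok m s ∧ b.Ok m s ∧ a.val m s - b.val m s ≤ m.maxInt
  | mul a b => a.Ok m s ∧ b.Ok m s ∧ a.val m s * b.val m s ≤ m.maxInt
  | div a b => a.Ok m s ∧ b.Ok m s ∧ b.val m s ≠ 0 ∧ a.val m s / b.val m s ≤ m.maxInt

/-- The value of an error-free real expression. -/
@[simp] noncomputable def RExp.val (m : Machine) (s : Store) : RExp → ℝ
  | ofN a => a.val m s
  | reg x => s.rreg x
  | inp k a => (m.inR.getD k []).getD (a.val m s) 0
  | mem a => s.rmem (a.val m s)
  | add u v => u.val m s + v.val m s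
  | sub u v => u.val m s - v.val m s
  | mul u v => u.val m s * v.val m s
  | div u v => u.val m s / v.val m s
  | sqrt u => Real.sqrt (u.val m s)

/-- The evaluation of a real expression is free of errors. -/
@[simp] def RExp.Ok (m : Machine) (s : Store) : RExp → Prop
  | ofN a => a.Ok m s
  | reg _ => True
  | inp k a => a.Ok m s ∧ a.val m s < (m.inR.getD k []).length
  | mem a => a.Ok m s ∧ a.val m s < m.cells
  | add u v => u.Ok m s ∧ v.Ok m s
  | sub u v => u.Ok m s ∧ v.Ok m s
  | mul u v => u.Ok m s ∧ v.Ok m s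
  | div u v => u.Ok m s ∧ v.Ok m s ∧ v.val m s ≠ 0
  | sqrt u => u.Ok m s ∧ 0 ≤ u.val m s

/-- The truth value of an error-free test. -/
@[simp] def BExp.val (m : Machine) (s : Store) : BExp → Prop
  | ltN a b => a.val m s < b.val m s
  | eqN a b => a.val m s = b.val m s
  | ltR u v => u.val m s < v.val m s
  | leR u v => u.val m s ≤ v.val m s
  | not p => ¬ p.val m s
  | and p q => p.val m s ∧ q.val m s
  | or p q => p.val m s ∨ q.val m s

/-- The evaluation of a test is free of errors. -/
@[simp] def BExp.Ok (m : Machine) (s : Store) : BExp → Prop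
  | ltN a b => a.Ok m s ∧ b.Ok m s
  | eqN a b => a.Ok m s ∧ b.Ok m s
  | ltR u v => u.Ok m s ∧ v.Ok m s
  | leR u v => u.Ok m s ∧ v.Ok m s
  | not p => p.Ok m s
  | and p q => p.Ok m s ∧ (p.val m s → q.Ok m s)
  | or p q => p.Ok m s ∧ (¬ p.val m s → q.Ok m s)

attribute [simp] NExp.size RExp.size BExp.size

theorem NExp.eval_eq {m : Machine} {s : Store} (a : NExp) (h : a.Ok m s) :
    a.eval m s = some (a.val m s) := by
  induction a with
  | const k => simpa [NExp.eval, Machine.word] using h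
  | reg x => rfl
  | inp k =>
    obtain ⟨h1, h2⟩ := h
    simp only [List.getD_eq_getElem _ _ h1] at h2
    simp [NExp.eval, Machine.word, h1, h2]
  | mem a iha => simp [NExp.eval, iha h.1, h.2]
  | add a b iha ihb => simpa [NExp.eval, iha h.1, ihb h.2.1, Machine.word] using h.2.2
  | sub a b iha ihb => simpa [NExp.eval, iha h.1, ihb h.2.1, Machine.word] using h.2.2
  | mul a b iha ihb => simpa [NExp.eval, iha h.1, ihb h.2.1, Machine.word] using h.2.2
  | div a b iha ihb =>
    simpa [NExp.eval, iha h.1, ihb h.2.1, Machine.word, h.2.2.1] using h.2.2.2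

theorem RExp.eval_eq {m : Machine} {s : Store} (u : RExp) (h : u.Ok m s) :
    u.eval m s = some (u.val m s) := by
  induction u with
  | ofN a => simp [RExp.eval, a.eval_eq h]
  | reg x => rfl
  | inp k a =>
    obtain ⟨h1, h2⟩ := h
    have hk : k < m.inR.length := by
      by_contra hk
      rw [List.getD_eq_default _ _ (not_lt.1 hk)] at h2
      simp at h2
    rw [List.getD_eq_getElem _ _ hk] at h2
    simp [RExp.eval, a.eval_eq h1, hk, h2]
  | mem a => simp [RExp.eval, a.eval_eq h.1, h.2]
  | add u v ihu ihv => simp [RExp.eval, ihu h.1, ihv h.2]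
  | sub u v ihu ihv => simp [RExp.eval, ihu h.1, ihv h.2]
  | mul u v ihu ihv => simp [RExp.eval, ihu h.1, ihv h.2]
  | div u v ihu ihv => simp [RExp.eval, ihu h.1, ihv h.2.1, h.2.2]
  | sqrt u ihu => simp [RExp.eval, ihu h.1, h.2]

theorem BExp.exists_eval_eq {m : Machine} {s : Store} (b : BExp) (h : b.Ok m s) :
    ∃ v : Bool, b.eval m s = some v ∧ (v = true ↔ b.val m s) := by
  induction b with
  | ltN a b => simp [BExp.eval, a.eval_eq h.1, b.eval_eq h.2]
  | eqN a b => simp [BExp.eval, a.eval_eq h.1, b.eval_eq h.2]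
  | ltR a b => simp [BExp.eval, a.eval_eq h.1, b.eval_eq h.2]
  | leR a b => simp [BExp.eval, a.eval_eq h.1, b.eval_eq h.2]
  | not p ih =>
    obtain ⟨v, hv, hp⟩ := ih h
    exact ⟨!v, by simp [BExp.eval, hv], by simp [← hp]⟩
  | and p q ihp ihq =>
    obtain ⟨v, hv, hp⟩ := ihp h.1
    cases v
    · exact ⟨false, by simp [BExp.eval, hv], by simp [← hp]⟩
    · obtain ⟨w, hw, hq⟩ := ihq (h.2 (hp.1 rfl))
      exact ⟨w, by simp [BExp.eval, hv, hw], by simp [← hp, ← hq]⟩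
  | or p q ihp ihq =>
    obtain ⟨v, hv, hp⟩ := ihp h.1
    cases v
    · obtain ⟨w, hw, hq⟩ := ihq (h.2 fun h => by simpa using hp.2 h)
      exact ⟨w, by simp [BExp.eval, hv, hw], by simp [← hp, ← hq]⟩
    · exact ⟨true, by simp [BExp.eval, hv], by simp [← hp]⟩

theorem BExp.eval_of_val {m : Machine} {s : Store} {b : BExp} (h : b.Ok m s) (hv : b.val m s) :
    b.eval m s = some true := by
  obtain ⟨v, he, h⟩ := b.exists_eval_eq h
  rw [he, h.2 hv]

theorem BExp.eval_of_not_val {m : Machine} {s : Store} {b : BExp} (h : b.Ok m s)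
    (hv : ¬ b.val m s) : b.eval m s = some false := by
  obtain ⟨v, he, h⟩ := b.exists_eval_eq h
  cases v
  · exact he
  · exact absurd (h.1 rfl) hv

/-- Weakest preconditions: `wp m c s Q` says that `c`, started in `s`, halts without an error and
that `Q` holds for the final store and the number of steps. -/
@[simp] def wp (m : Machine) : Cmd → Store → (Store → ℕ → Prop) → Prop
  | .skip, s, Q => Q s 1
  | .setN x a, s, Q =>
    a.Ok m s ∧ Q { s with nreg := Function.update s.nreg x (a.val m s) } (a.size + 1)
  | .setR x u, s, Q =>
    u.Ok m s ∧ Q { s with rreg := Function.update s.rreg x (u.val m s) } (u.size + 1)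
  | .storeN a b, s, Q => (a.Ok m s ∧ a.val m s < m.cells ∧ b.Ok m s) ∧
    Q { s with nmem := Function.update s.nmem (a.val m s) (b.val m s) } (a.size + b.size + 1)
  | .storeR a u, s, Q => (a.Ok m s ∧ a.val m s < m.cells ∧ u.Ok m s) ∧
    Q { s with rmem := Function.update s.rmem (a.val m s) (u.val m s) } (a.size + u.size + 1)
  | .seq p q, s, Q => wp m p s fun s₁ t₁ => wp m q s₁ fun s₂ t₂ => Q s₂ (t₁ + t₂)
  | .ite b p q, s, Q => b.Ok m s ∧ (b.val m s → wp m p s fun s' t => Q s' (b.size + 1 + t)) ∧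
    (¬ b.val m s → wp m q s fun s' t => Q s' (b.size + 1 + t))
  | .loop b p, s, Q => ∃ s' t, Exec m (.loop b p) s s' t ∧ Q s' t

/-- Soundness of the calculus. For loops there is nothing to prove, as their precondition is an
execution by definition; the work is done by `wp_loop`. -/
theorem wp.exec {m : Machine} {c : Cmd} {s : Store} {Q : Store → ℕ → Prop} (h : wp m c s Q) :
    ∃ s' t, Exec m c s s' t ∧ Q s' t := by
  induction c generalizing s Q with
  | skip => exact ⟨s, 1, .skip s, h⟩
  | setN x a => exact ⟨_, _, .setN s x a _ (a.eval_eq h.1), h.2⟩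
  | setR x u => exact ⟨_, _, .setR s x u _ (u.eval_eq h.1), h.2⟩
  | storeN a b => exact ⟨_, _, .storeN s a b _ _ (a.eval_eq h.1.1) h.1.2.1 (b.eval_eq h.1.2.2), h.2⟩
  | storeR a u => exact ⟨_, _, .storeR s a u _ _ (a.eval_eq h.1.1) h.1.2.1 (u.eval_eq h.1.2.2), h.2⟩
  | seq p q ihp ihq =>
    obtain ⟨s₁, t₁, h₁, h⟩ := ihp h
    obtain ⟨s₂, t₂, h₂, h⟩ := ihq h
    exact ⟨s₂, _, .seq _ _ _ _ _ _ _ h₁ h₂, h⟩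
  | ite b p q ihp ihq =>
    obtain ⟨hb, h₁, h₂⟩ := h
    by_cases hv : b.val m s
    · obtain ⟨s', t, h, hQ⟩ := ihp (h₁ hv)
      exact ⟨s', _, .iteTrue _ _ _ _ _ _ (BExp.eval_of_val hb hv) h, hQ⟩
    · obtain ⟨s', t, h, hQ⟩ := ihq (h₂ hv)
      exact ⟨s', _, .iteFalse _ _ _ _ _ _ (BExp.eval_of_not_val hb hv) h, hQ⟩
  | loop b p _ => exact h

theorem wp.mono {m : Machine} {c : Cmd} {s : Store} {Q Q' : Store → ℕ → Prop} (h : wp m c s Q)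
    (hQ : ∀ s' t, Q s' t → Q' s' t) : wp m c s Q' := by
  induction c generalizing s Q Q' with
  | skip => exact hQ _ _ h
  | setN x a => exact ⟨h.1, hQ _ _ h.2⟩
  | setR x u => exact ⟨h.1, hQ _ _ h.2⟩
  | storeN a b => exact ⟨h.1, hQ _ _ h.2⟩
  | storeR a u => exact ⟨h.1, hQ _ _ h.2⟩
  | seq p q ihp ihq => exact ihp h fun s₁ t₁ h₁ => ihq h₁ fun s₂ t₂ h₂ => hQ _ _ h₂
  | ite b p q ihp ihq =>
    exact ⟨h.1, fun hb => ihp (h.2.1 hb) fun _ _ => hQ _ _,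
      fun hb => ihq (h.2.2 hb) fun _ _ => hQ _ _⟩
  | loop b p _ =>
    obtain ⟨s', t, h, hq⟩ := h
    exact ⟨s', t, h, hQ _ _ hq⟩

/-- The invariant `I` of a loop holds after `t` more steps, and the iteration so far, which took
`k` steps before, and the remaining iterations take at most `u` steps. -/
def Within (I : Store → ℕ → Prop) (k u : ℕ) (s : Store) (t : ℕ) : Prop :=
  ∃ u', I s u' ∧ k + t + u' ≤ u

theorem Within.intro {I : Store → ℕ → Prop} {k u t : ℕ} {s : Store} (u' : ℕ) (h : I s u')
    (hu : k + t + u' ≤ u) : Within I k u s t :=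
  ⟨u', h, hu⟩

/-- A loop with invariant `I`, where `I s u` entails that `u` steps suffice for the remaining
iterations. -/
theorem wp_loop {m : Machine} {b : BExp} {p : Cmd} (I : Store → ℕ → Prop)
    (hok : ∀ s u, I s u → b.Ok m s)
    (hstep : ∀ s u, I s u → b.val m s →
      wp m p s (Within I (b.size + 1) u))
    {s : Store} {u : ℕ} (h : I s u) {Q : Store → ℕ → Prop}
    (hQ : ∀ s' t u', I s' u' → ¬ b.val m s' → t + u' ≤ u + (b.size + 1) → Q s' t) :
    wp m (.loop b p) s Q := by
  suffices h : wp m (.loop b p) s fun s' t => ∃ u', I s' u' ∧ ¬ b.val m s' ∧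
      t + u' ≤ u + (b.size + 1) from
    h.mono fun s' t ⟨u', h1, h2, h3⟩ => hQ s' t u' h1 h2 h3
  clear hQ
  induction u using Nat.strong_induction_on generalizing s with
  | _ u ih =>
    have hb := hok s u h
    by_cases hv : b.val m s
    · obtain ⟨s₁, t₁, h₁, u₁, hI, hu⟩ := (hstep s u h hv).exec
      -- Evaluating the guard takes at least one step, so the budget drops strictly and termination
      -- needs no separate argument.
      obtain ⟨s₂, t₂, h₂, u₂, hI₂, hn, ht⟩ := ih u₁ (by omega) hI
      exact ⟨s₂, _, .loopStep _ _ _ _ _ _ _ (BExp.eval_of_val hb hv) h₁ h₂, u₂, hI₂, hn, by omega⟩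
    · exact ⟨s, _, .loopDone _ _ _ (BExp.eval_of_not_val hb hv), u, h, hv, by omega⟩

/-- The stores `s` and `s'` agree outside the given sets of integer registers, real registers,
integer cells and real cells. -/
structure Keeps (A B C D : Set ℕ) (s s' : Store) : Prop where
  nreg : ∀ x, x ∉ A → s'.nreg x = s.nreg x
  rreg : ∀ x, x ∉ B → s'.rreg x = s.rreg x
  nmem : ∀ x, x ∉ C → s'.nmem x = s.nmem x
  rmem : ∀ x, x ∉ D → s'.rmem x = s.rmem x

theorem Keeps.refl (A B C D : Set ℕ) (s : Store) : Keeps A B C D s s :=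
  ⟨fun _ _ => rfl, fun _ _ => rfl, fun _ _ => rfl, fun _ _ => rfl⟩

theorem Keeps.trans {A B C D : Set ℕ} {s s' s'' : Store} (h : Keeps A B C D s s')
    (h' : Keeps A B C D s' s'') : Keeps A B C D s s'' :=
  ⟨fun x hx => (h'.nreg x hx).trans (h.nreg x hx), fun x hx => (h'.rreg x hx).trans (h.rreg x hx),
    fun x hx => (h'.nmem x hx).trans (h.nmem x hx), fun x hx => (h'.rmem x hx).trans (h.rmem x hx)⟩

theorem Keeps.mono {A B C D A' B' C' D' : Set ℕ} {s s' : Store} (h : Keeps A B C D s s')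
    (hA : A ⊆ A') (hB : B ⊆ B') (hC : C ⊆ C') (hD : D ⊆ D') : Keeps A' B' C' D' s s' :=
  ⟨fun x hx => h.nreg x (mt (@hA x) hx), fun x hx => h.rreg x (mt (@hB x) hx),
    fun x hx => h.nmem x (mt (@hC x) hx), fun x hx => h.rmem x (mt (@hD x) hx)⟩

/-! ### Lanes: monotone double-ended queues -/

/-- The address expression of the position of the entry `i` of the current lane. -/
abbrev laneXExp (i : NExp) : RExp := .mem (.add (.reg 10) (.mul (.const 2) i))

/-- The address expression of the value of the entry `i` of the current lane. -/
abbrev laneVExp (i : NExp) : RExp := .mem (.add (.add (.reg 10) (.mul (.const 2) i)) (.const 1))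

/-- Remove the newest entries that the new entry at position `rreg 0` with value `rreg 2` makes
obsolete; the new entry takes over the smallest value of those that are not to its right. -/
def popNew : Cmd :=
  .loop (.and (.ltN (.reg 12) (.reg 13))
      (.or (.leR (laneXExp (.sub (.reg 13) (.const 1))) (.reg 0))
        (.leR (.reg 2) (laneVExp (.sub (.reg 13) (.const 1))))))
    (.ite (.ltR (laneVExp (.sub (.reg 13) (.const 1))) (.reg 2))
        (.setR 2 (laneVExp (.sub (.reg 13) (.const 1)))) .skip ;;
      .setN 13 (.sub (.reg 13) (.const 1)))

/-- Remove the oldest entries to the right of `rreg 1`. -/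
def popOld : Cmd :=
  .loop (.and (.ltN (.add (.reg 12) (.const 1)) (.reg 13))
      (.ltR (.reg 1) (laneXExp (.reg 12))))
    (.setN 12 (.add (.reg 12) (.const 1)))

/-- The value `v'` is the minimum of `v` and the popped values. It differs from `v` only if it comes
from an entry at or left of `lo`, whose start really reaches `lo`. The term `100 * top'` in the time
bound lets each removal pay for itself. -/
theorem wp_popNew {m : Machine} (hm : m.cells ≤ m.maxInt) {s : Store} {b bot top : ℕ}
    {lo v : ℝ} (hb : s.nreg 10 = b) (hbot : s.nreg 12 = bot) (htop : s.nreg 13 = top)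
    (hlo : s.rreg 0 = lo) (hv : s.rreg 2 = v) (hcap : b + 2 * top + 2 ≤ m.cells)
    (hle : bot ≤ top) {Q : Store → ℕ → Prop}
    (hQ : ∀ (top' : ℕ) (v' : ℝ) (t : ℕ), bot ≤ top' → top' ≤ top → v' ≤ v →
      (∀ i, top' ≤ i → i < top → v' ≤ s.rmem (b + 2 * i + 1)) →
      (v' = v ∨ ∃ i, top' ≤ i ∧ i < top ∧ v' = s.rmem (b + 2 * i + 1) ∧
        s.rmem (b + 2 * i) ≤ lo) →
      (bot < top' → lo < s.rmem (b + 2 * (top' - 1)) ∧ s.rmem (b + 2 * (top' - 1) + 1) < v') →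
      t + 100 * top' ≤ 100 * top + 100 →
      Q { s with nreg := Function.update s.nreg 13 top', rreg := Function.update s.rreg 2 v' } t) :
    wp m popNew s Q := by
  refine wp_loop (I := fun s' u => ∃ top' v',
      s' = { s with nreg := Function.update s.nreg 13 top', rreg := Function.update s.rreg 2 v' } ∧
      bot ≤ top' ∧ top' ≤ top ∧ v' ≤ v ∧
      (∀ i, top' ≤ i → i < top → v' ≤ s.rmem (b + 2 * i + 1)) ∧
      (v' = v ∨ ∃ i, top' ≤ i ∧ i < top ∧ v' = s.rmem (b + 2 * i + 1) ∧
        s.rmem (b + 2 * i) ≤ lo) ∧ u = 100 * (top' - bot)) ?_ ?_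
    (u := 100 * (top - bot)) ?_ ?_
  · rintro _ u ⟨top', v', rfl, h1, h2, -⟩
    simp [hb, hbot]
    omega
  · rintro _ u ⟨top', v', rfl, h1, h2, h3, h4, h5, rfl⟩ hc
    simp [hb, hbot, hlo] at hc
    obtain ⟨hc1, hc2⟩ := hc
    have key : ∀ v'' : ℝ, v'' ≤ v' → v'' ≤ s.rmem (b + 2 * (top' - 1) + 1) →
        (v'' = v' ∨ v'' = s.rmem (b + 2 * (top' - 1) + 1) ∧ s.rmem (b + 2 * (top' - 1)) ≤ lo) →
        v'' ≤ v ∧ (∀ i, top' - 1 ≤ i → i < top → v'' ≤ s.rmem (b + 2 * i + 1)) ∧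
      (v'' = v ∨ ∃ i, top' - 1 ≤ i ∧ i < top ∧ v'' = s.rmem (b + 2 * i + 1) ∧
        s.rmem (b + 2 * i) ≤ lo) := by
      intro v'' k1 k2 k3
      refine ⟨k1.trans h3, fun i hi hit => ?_, ?_⟩
      · rcases hi.eq_or_lt with rfl | hi
        · exact k2
        · exact k1.trans (h4 i (by omega) hit)
      · rcases k3 with rfl | ⟨k3, k4⟩
        · exact h5.imp id fun ⟨i, hi, h⟩ => ⟨i, by omega, h⟩
        · exact .inr ⟨top' - 1, le_rfl, by omega, k3, k4⟩
    simp [hb]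
    refine ⟨by omega, fun hlt => ⟨by omega, by omega, .intro (100 * (top' - 1 - bot)) ?_
        (by omega)⟩,
      fun hge => ⟨by omega, .intro (100 * (top' - 1 - bot)) ?_ (by omega)⟩⟩
    · obtain ⟨k1, k2, k3⟩ := key _ hlt.le le_rfl
        (.inr ⟨rfl, hc2.resolve_right (not_le.2 hlt)⟩)
      exact ⟨top' - 1, _, rfl, by omega, by omega, k1, k2, k3, rfl⟩
    · obtain ⟨k1, k2, k3⟩ := key _ le_rfl hge (.inl rfl)
      exact ⟨top' - 1, _, rfl, by omega, by omega, k1, k2, k3, rfl⟩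
  · exact ⟨top, v, by simp [← htop, ← hv], hle, le_rfl, le_rfl, fun i h1 h2 => by omega,
      .inl rfl, rfl⟩
  · rintro _ t u ⟨top', v', rfl, h1, h2, h3, h4, h5, rfl⟩ hn ht
    simp [hb, hbot, hlo] at hn ht
    refine hQ top' v' t h1 h2 h3 h4 h5 (fun h => hn h) (by omega)

/-- The guard `bot + 1 < top` spares the last entry, which was just placed at `lo`; a lane never
becomes empty. -/
theorem wp_popOld {m : Machine} (hm : m.cells ≤ m.maxInt) {s : Store} {b bot top : ℕ}
    {hi : ℝ} (hb : s.nreg 10 = b) (hbot : s.nreg 12 = bot) (htop : s.nreg 13 = top)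
    (hhi : s.rreg 1 = hi) (hcap : b + 2 * top ≤ m.cells)
    (hle : bot < top) {Q : Store → ℕ → Prop}
    (hQ : ∀ (bot' : ℕ) (t : ℕ), bot ≤ bot' → bot' < top →
      (∀ i, bot ≤ i → i < bot' → hi < s.rmem (b + 2 * i)) →
      (bot' + 1 < top → s.rmem (b + 2 * bot') ≤ hi) →
      t + 100 * bot ≤ 100 * bot' + 100 →
      Q { s with nreg := Function.update s.nreg 12 bot' } t) :
    wp m popOld s Q := by
  refine wp_loop (I := fun s' u => ∃ bot',
      s' = { s with nreg := Function.update s.nreg 12 bot' } ∧ bot ≤ bot' ∧ bot' < top ∧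
      (∀ i, bot ≤ i → i < bot' → hi < s.rmem (b + 2 * i)) ∧ u = 100 * (top - bot' - 1)) ?_ ?_
    (u := 100 * (top - bot - 1)) ?_ ?_
  · rintro _ u ⟨bot', rfl, h1, h2, -⟩
    simp [hb, htop]
    omega
  · rintro _ u ⟨bot', rfl, h1, h2, h3, rfl⟩ hc
    simp [hb, htop, hhi] at hc
    simp
    refine ⟨by omega, .intro (100 * (top - (bot' + 1) - 1))
      ⟨bot' + 1, rfl, by omega, by omega, fun i h4 h5 => ?_, rfl⟩ (by omega)⟩
    rcases (Nat.lt_succ_iff.1 h5).eq_or_lt with rfl | h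
    · exact hc.2
    · exact h3 i h4 h
  · exact ⟨bot, by simp [← hbot], le_rfl, hle, fun i h1 h2 => by omega, rfl⟩
  · rintro _ t u ⟨bot', rfl, h1, h2, h3, rfl⟩ hn ht
    simp [hb, htop, hhi] at hn ht
    exact hQ bot' t h1 h2 h3 hn (by omega)

/-- The entries `(X i, V i)` for `bot ≤ i < top` represent the up-closed set `R` of pairs of a
position and a value; values above `N` are void. -/
structure Lane (N : ℝ) (bot top : ℕ) (X V : ℕ → ℝ) (R : Set (ℝ × ℝ)) : Prop where
  lt : bot < top
  sorted : ∀ i j, bot ≤ i → i < j → j < top → X j ≤ X i ∧ V i ≤ V j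
  sound : ∀ i, bot ≤ i → i < top → V i ≤ N → (X i, V i) ∈ R
  complete : ∀ x a, (x, a) ∈ R → ∃ i, bot ≤ i ∧ i < top ∧ X i ≤ x ∧ V i ≤ a

/-- The pairs at the door `[lo, hi]` that arise from those in `R` at the door before and from
entrants with values in `E`. -/
def laneNext (lo hi : ℝ) (R : Set (ℝ × ℝ)) (E : Set ℝ) : Set (ℝ × ℝ) :=
  {z | (lo ≤ z.1 ∧ z.1 ≤ hi) ∧ ((∃ x ≤ z.1, (x, z.2) ∈ R) ∨ z.2 ∈ E)}

/-- `v` is the least element of `E`, or void if there is none. -/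
def IsBest (N : ℝ) (E : Set ℝ) (v : ℝ) : Prop := (v ≤ N → v ∈ E) ∧ ∀ a ∈ E, v ≤ a

theorem Lane.single {N x v : ℝ} {X V : ℕ → ℝ} {R : Set (ℝ × ℝ)} (hX : X 0 = x) (hV : V 0 = v)
    (hs : v ≤ N → (x, v) ∈ R) (hc : ∀ x' a, (x', a) ∈ R → x ≤ x' ∧ v ≤ a) : Lane N 0 1 X V R := by
  refine ⟨one_pos, fun i j _ h1 h2 => by omega, fun i _ hi => ?_, fun x' a h => ?_⟩
  · obtain rfl : i = 0 := by omega
    rwa [hX, hV]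
  · exact ⟨0, le_rfl, one_pos, by rw [hX, hV]; exact hc x' a h⟩

/-- Values increase from the oldest to the newest entry, so the front of the queue is the minimum.
-/
theorem Lane.isBest {N : ℝ} {bot top : ℕ} {X V : ℕ → ℝ} {R : Set (ℝ × ℝ)}
    (h : Lane N bot top X V R) : IsBest N {a | ∃ x, (x, a) ∈ R} (V bot) := by
  refine ⟨fun hN => ⟨_, h.sound bot le_rfl h.lt hN⟩, ?_⟩
  rintro a ⟨x, hx⟩
  obtain ⟨i, h1, h2, -, h3⟩ := h.complete x a hx
  rcases h1.eq_or_lt with rfl | h1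
  · exact h3
  · exact (h.sorted bot i le_rfl h1 h2).2.trans h3

theorem Lane.congr {N : ℝ} {bot top : ℕ} {X V X' V' : ℕ → ℝ} {R : Set (ℝ × ℝ)}
    (h : Lane N bot top X V R) (hX : ∀ i < top, X' i = X i) (hV : ∀ i < top, V' i = V i) :
    Lane N bot top X' V' R := by
  refine ⟨h.lt, fun i j h1 h2 h3 => ?_, fun i h1 h2 => ?_, fun x a hx => ?_⟩
  · rw [hX i (h2.trans h3), hV i (h2.trans h3), hX j h3, hV j h3]
    exact h.sorted i j h1 h2 h3
  · rw [hX i h2, hV i h2]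
    exact h.sound i h1 h2
  · obtain ⟨i, h1, h2, h3⟩ := h.complete x a hx
    exact ⟨i, h1, h2, by rwa [hX i h2, hV i h2]⟩

/-- Positions decrease and values increase along the queue. Hence the entries lost beyond `hi` form
a block at the old end, and those that are lifted to `lo` or dominated there are removed from the
new end. The entry `(lo, v')` replaces the latter together with all entrants. The remaining entries
lie inside the door and keep their order. -/
theorem Lane.step {N lo hi v v' : ℝ} {bot top bot' top' : ℕ} {X V X' V' : ℕ → ℝ}
    {R : Set (ℝ × ℝ)} {E : Set ℝ} (h : Lane N bot top X V R) (hE : IsBest N E v)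
    (hlh : lo ≤ hi) (h1 : bot ≤ top') (h2 : top' ≤ top) (hv : v' ≤ v)
    (hpop : ∀ i, top' ≤ i → i < top → v' ≤ V i)
    (hv' : v' = v ∨ ∃ i, top' ≤ i ∧ i < top ∧ v' = V i ∧ X i ≤ lo)
    (hlast : bot < top' → lo < X (top' - 1) ∧ V (top' - 1) < v')
    (hX : ∀ i < top', X' i = X i) (hV : ∀ i < top', V' i = V i) (hX' : X' top' = lo)
    (hV' : V' top' = v') (h3 : bot ≤ bot') (h4 : bot' < top' + 1)
    (hpop' : ∀ i, bot ≤ i → i < bot' → hi < X' i)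
    (hfirst : bot' + 1 < top' + 1 → X' bot' ≤ hi) :
    Lane N bot' (top' + 1) X' V' (laneNext lo hi R E) := by
  -- By sortedness, what the stopping test says of the last survivor holds for all earlier ones.
  have hold : ∀ i, bot ≤ i → i < top' → lo < X i ∧ V i < v' := by
    intro i hi1 hi2
    obtain ⟨k1, k2⟩ := hlast (by omega)
    rcases (Nat.le_sub_one_of_lt hi2).eq_or_lt with rfl | hlt
    · exact ⟨k1, k2⟩
    · obtain ⟨k3, k4⟩ := h.sorted i (top' - 1) hi1 hlt (by omega)
      exact ⟨k1.trans_le k3, k4.trans_lt k2⟩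
  refine ⟨h4, fun i j hi1 hij hj => ?_, fun i hi1 hi2 hN => ?_, ?_⟩
  · rw [hX i (by omega), hV i (by omega)]
    rcases (Nat.lt_succ_iff.1 hj).eq_or_lt with rfl | hj
    · rw [hX', hV']
      exact (hold i (by omega) hij).imp le_of_lt le_of_lt
    · rw [hX j hj, hV j hj]
      exact h.sorted i j (by omega) hij (by omega)
  · rcases (Nat.lt_succ_iff.1 hi2).eq_or_lt with rfl | hi2
    · rw [hV'] at hN
      rw [hX', hV']
      refine ⟨⟨le_rfl, hlh⟩, ?_⟩
      rcases hv' with rfl | ⟨i, k1, k2, rfl, k3⟩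
      · exact .inr (hE.1 hN)
      · exact .inl ⟨_, k3, h.sound i (by omega) k2 hN⟩
    · rw [hX i hi2, hV i hi2] at *
      refine ⟨⟨(hold i (by omega) hi2).1.le, ?_⟩,
        .inl ⟨_, le_rfl, h.sound i (by omega) (by omega) hN⟩⟩
      have := hfirst (by omega)
      rw [hX bot' (by omega)] at this
      rcases hi1.eq_or_lt with rfl | hi1
      · exact this
      · exact (h.sorted bot' i (by omega) hi1 (by omega)).1.trans this
  · rintro x a ⟨⟨hx1, hx2⟩, ⟨x', hx', hR⟩ | ha⟩
    · obtain ⟨i, k1, k2, k3, k4⟩ := h.complete x' a hR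
      rcases le_or_gt top' i with hi | hi
      · exact ⟨top', by omega, by omega, by rwa [hX'], by rw [hV']; exact (hpop i hi k2).trans k4⟩
      · refine ⟨i, ?_, by omega, by rw [hX i hi]; exact k3.trans hx', by rwa [hV i hi]⟩
        -- An entry dropped at the old end lies right of `hi`, so it cannot account for a point of
        -- the door.
        by_contra hlt
        have := hpop' i k1 (not_le.1 hlt)
        rw [hX i hi] at this
        linarith [show x' ≤ x from hx', show x ≤ _ from hx2]
    · exact ⟨top', by omega, by omega, by rwa [hX'], by rw [hV']; exact hv.trans (hE.2 a ha)⟩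

/-- The lane with entries from the real address `b` and with bounds at the integer addresses `a`
and `a + 1`. -/
def LaneAt (N : ℝ) (s : Store) (b a cap : ℕ) (R : Set (ℝ × ℝ)) : Prop :=
  s.nmem (a + 1) ≤ cap ∧ Lane N (s.nmem a) (s.nmem (a + 1)) (fun i => s.rmem (b + 2 * i))
    (fun i => s.rmem (b + 2 * i + 1)) R

theorem LaneAt.congr {N : ℝ} {s s' : Store} {b a cap : ℕ} {R : Set (ℝ × ℝ)}
    (h : LaneAt N s b a cap R) (h0 : s'.nmem a = s.nmem a) (h1 : s'.nmem (a + 1) = s.nmem (a + 1))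
    (hr : ∀ k < 2 * cap, s'.rmem (b + k) = s.rmem (b + k)) : LaneAt N s' b a cap R := by
  obtain ⟨hc, h⟩ := h
  refine ⟨by rwa [h1], ?_⟩
  rw [h0, h1]
  exact h.congr (fun i hi => hr (2 * i) (by omega)) (fun i hi => hr (2 * i + 1) (by omega))

/-- Make `(x, v)` the only entry of the current lane. -/
def laneReset (x v : RExp) : Cmd :=
  .storeR (.reg 10) x ;; .storeR (.add (.reg 10) (.const 1)) v ;;
  .storeN (.reg 11) (.const 0) ;; .storeN (.add (.reg 11) (.const 1)) (.const 1)

/-- Move the current lane to its next door `[rreg 0, rreg 1]`, with an entrant of value `rreg 2`.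
The void value is in `rreg 11`. -/
def laneStep : Cmd :=
  .ite (.ltR (.reg 1) (.reg 0)) (laneReset (.ofN (.const 0)) (.reg 11))
    (.setN 12 (.mem (.reg 11)) ;; .setN 13 (.mem (.add (.reg 11) (.const 1))) ;; popNew ;;
      .storeR (.add (.reg 10) (.mul (.const 2) (.reg 13))) (.reg 0) ;;
      .storeR (.add (.add (.reg 10) (.mul (.const 2) (.reg 13))) (.const 1)) (.reg 2) ;;
      .setN 13 (.add (.reg 13) (.const 1)) ;; popOld ;;
      .storeN (.reg 11) (.reg 12) ;; .storeN (.add (.reg 11) (.const 1)) (.reg 13))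

/-- The number of entries of a lane. -/
def laneSize (s : Store) (a : ℕ) : ℕ := s.nmem (a + 1) - s.nmem a

theorem wp_laneReset {m : Machine} (hm : m.cells ≤ m.maxInt) {s : Store} {b a cap : ℕ} {N : ℝ}
    {R : Set (ℝ × ℝ)} {x v : RExp} (hb : s.nreg 10 = b) (ha : s.nreg 11 = a)
    (hbc : b + 2 ≤ m.cells) (hac : a + 2 ≤ m.cells) (hcap : 1 ≤ cap) (hx : x.Ok m s)
    (hv : ∀ s', s'.nreg = s.nreg → s'.rreg = s.rreg → v.Ok m s' ∧ v.val m s' = v.val m s)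
    (hsound : v.val m s ≤ N → (x.val m s, v.val m s) ∈ R)
    (hcomplete : ∀ x' a, (x', a) ∈ R → x.val m s ≤ x' ∧ v.val m s ≤ a)
    {Q : Store → ℕ → Prop}
    (hQ : ∀ s' t, LaneAt N s' b a cap R → Keeps ∅ ∅ {a, a + 1} {b, b + 1} s s' →
      laneSize s' a = 1 → t = x.size + v.size + 14 → Q s' t) :
    wp m (laneReset x v) s Q := by
  obtain ⟨hv1, hv2⟩ := hv { s with rmem := Function.update s.rmem b (x.val m s) } rfl rfl
  simp only [laneReset, wp, NExp.Ok, NExp.val, hb, ha, hv2, true_and]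
  refine ⟨⟨by omega, hx⟩, ⟨by omega, by omega, hv1⟩, ⟨by omega, by omega⟩,
    ⟨by omega, by omega, by omega⟩, ?_⟩
  refine hQ _ _ ⟨by simpa, ?_⟩ ?_ (by simp [laneSize]) (by simp; omega)
  · simp only [Function.update_self, ne_eq, Nat.left_eq_add, one_ne_zero, not_false_eq_true,
      Function.update_of_ne]
    exact Lane.single (by simp) (by simp) hsound hcomplete
  · refine ⟨fun _ _ => rfl, fun _ _ => rfl, fun k hk => ?_, fun k hk => ?_⟩ <;>
    · simp only [Set.mem_insert_iff, Set.mem_singleton_iff, not_or] at hk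
      simp [hk]

/-- Amortised constant time, with `100 * laneSize` as the potential: one entry is pushed, and each
removal is paid by the drop in size. The upper index grows by at most one per step, so the queue
never has to wrap around and the capacity `cap + 1` is enough. An empty door resets the lane to one
void entry. -/
theorem wp_laneStep {m : Machine} (hm : m.cells ≤ m.maxInt) {s : Store} {b a cap : ℕ}
    {N lo hi : ℝ} {R : Set (ℝ × ℝ)} {E : Set ℝ} (hb : s.nreg 10 = b) (ha : s.nreg 11 = a)
    (hbc : b + 2 * (cap + 1) ≤ m.cells) (hac : a + 2 ≤ m.cells) (hN : N < s.rreg 11)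
    (hlane : LaneAt N s b a cap R) (hlo : s.rreg 0 = lo) (hhi : s.rreg 1 = hi)
    (hE : IsBest N E (s.rreg 2)) {Q : Store → ℕ → Prop}
    (hQ : ∀ s' t, LaneAt N s' b a (cap + 1) (laneNext lo hi R E) →
      Keeps {12, 13} {2} {a, a + 1} (Set.Ico b (b + 2 * (cap + 1))) s s' →
      t + 100 * laneSize s' a ≤ 100 * laneSize s a + 1000 → Q s' t) :
    wp m laneStep s Q := by
  have hlane' := hlane
  obtain ⟨hcap, hL⟩ := hlane
  have hlt := hL.lt
  simp only [laneStep, wp, BExp.Ok, RExp.Ok, BExp.val, RExp.val, hlo, hhi]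
  refine ⟨by simp, fun hempty => ?_, fun hne => ?_⟩
  · refine wp_laneReset (N := N) (cap := cap + 1) (R := laneNext lo hi R E) hm hb ha (by omega)
      hac (by omega) (by simp [RExp.Ok])
      (fun s' _ h => by simp [h]) (fun h => absurd hN (not_lt.2 (by simpa using h))) ?_ ?_
    · rintro x y ⟨⟨h1, h2⟩, -⟩
      exact absurd (h1.trans h2) (not_le.2 hempty)
    · intro s' t h1 h2 h3 ht
      refine hQ s' _ h1 (h2.mono (by simp) (by simp) le_rfl ?_) ?_
      · rintro x (rfl | rfl) <;> constructor <;> omega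
      · simp [laneSize] at h3 ht ⊢
        omega
  · simp only [not_lt] at hne
    simp only [NExp.Ok, NExp.val, NExp.size, ha, Function.update_of_ne, ne_eq, Nat.reduceEqDiff,
      not_false_eq_true, true_and]
    refine ⟨by omega, ⟨by omega, by omega⟩, ?_⟩
    refine wp_popNew hm (b := b) (bot := s.nmem a) (top := s.nmem (a + 1)) (lo := lo)
      (v := s.rreg 2) (by simp [hb]) (by simp) (by simp) (by simp [hlo]) (by simp)
          (by omega) hlt.le ?_
    intro top' v' t h1 h2 h3 h4 h5 h6 ht
    simp [hb, hlo]
    refine ⟨by omega, by omega, by omega, ?_⟩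
    refine wp_popOld hm (b := b) (bot := s.nmem a) (top := top' + 1) (hi := hi) (by simp [hb])
      (by simp) (by simp) (by simp [hhi]) (by omega) (by omega) ?_
    intro bot' t' h7 h8 h9 h10 ht'
    simp [ha]
    refine ⟨by omega, by omega, hQ _ _ ⟨?_, ?_⟩ ?_ ?_⟩
    · simp; omega
    · simp
      refine hL.step hE hne h1 h2 h3 h4 h5 h6 ?_ ?_ ?_ ?_ h7 h8 h9 h10
      · intro i hi
        rw [Function.update_of_ne (by omega), Function.update_of_ne (by omega)]
      · intro i hi
        rw [Function.update_of_ne (by omega), Function.update_of_ne (by omega)]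
      · simp
      · simp
    · refine ⟨fun k hk => ?_, fun k hk => ?_, fun k hk => ?_, fun k hk => ?_⟩
      · simp at hk; simp [hk]
      · simp at hk; simp [hk]
      · simp at hk; simp [hk]
      · simp only [Set.mem_Ico, not_and_or, not_le, not_lt] at hk
        simp only
        rw [Function.update_of_ne (by omega), Function.update_of_ne (by omega)]
    · simp [laneSize]
      omega

/-! ### Doors: the intersection of a segment and a ball -/

theorem norm_lineMap_sub_le_iff {d : ℕ} (u v w : Point d) {r : ℝ} (hr : 0 ≤ r) (x : ℝ) :
    ‖AffineMap.lineMap u v x - w‖ ≤ r ↔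
      (∑ j, (v j - u j) * (v j - u j)) * (x * x) + 2 * (∑ j, (v j - u j) * (u j - w j)) * x +
        ((∑ j, (u j - w j) * (u j - w j)) - r * r) ≤ 0 := by
  rw [← sq_le_sq₀ (norm_nonneg _) hr, EuclideanSpace.real_norm_sq_eq]
  have : ∑ j, (AffineMap.lineMap u v x - w : Point d) j ^ 2 =
      (∑ j, (v j - u j) * (v j - u j)) * (x * x) + 2 * (∑ j, (v j - u j) * (u j - w j)) * x +
        ∑ j, (u j - w j) * (u j - w j) := by
    simp only [Finset.sum_mul, Finset.mul_sum, ← Finset.sum_add_distrib]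
    refine Finset.sum_congr rfl fun j _ => ?_
    simp [AffineMap.lineMap_apply_module]
    ring
  rw [this]
  constructor <;> intro h <;> nlinarith

theorem quadratic_nonpos_iff {a b c x : ℝ} (ha : 0 < a) (hd : 0 ≤ b * b - a * c) :
    a * (x * x) + 2 * b * x + c ≤ 0 ↔
      (0 - b - √(b * b - a * c)) / a ≤ x ∧ x ≤ (√(b * b - a * c) - b) / a := by
  rw [div_le_iff₀ ha, le_div_iff₀ ha]
  have h1 : a * (x * x) + 2 * b * x + c ≤ 0 ↔ (a * x + b) ^ 2 ≤ b * b - a * c := by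
    constructor <;> intro h <;> nlinarith
  rw [h1, Real.sq_le hd]
  constructor <;> rintro ⟨h1, h2⟩ <;> constructor <;> linarith

/-- The sum of `f 0, …, f (d - 1)`. -/
def sumExp (f : ℕ → RExp) : ℕ → RExp
  | 0 => .ofN (.const 0)
  | d + 1 => .add (sumExp f d) (f d)

theorem sumExp_ok {m : Machine} {s : Store} {f : ℕ → RExp} {d : ℕ} (h : ∀ j < d, (f j).Ok m s) :
    (sumExp f d).Ok m s := by
  induction d with
  | zero => simp [sumExp]
  | succ d ih => exact ⟨ih fun j hj => h j (by omega), h d (by omega)⟩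

theorem sumExp_val {m : Machine} {s : Store} {f : ℕ → RExp} {d : ℕ} {g : Fin d → ℝ}
    (h : ∀ j : Fin d, (f j).val m s = g j) : (sumExp f d).val m s = ∑ j, g j := by
  have : ∀ d, (sumExp f d).val m s = ∑ j ∈ Finset.range d, (f j).val m s := by
    intro d
    induction d with
    | zero => simp [sumExp]
    | succ d ih => simp [sumExp, ih, Finset.sum_range_succ]
  rw [this, Finset.sum_range]
  exact Finset.sum_congr rfl fun j _ => h j

theorem sumExp_size {f : ℕ → RExp} {k : ℕ} (h : ∀ j, (f j).size = k) (d : ℕ) :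
    (sumExp f d).size = (k + 1) * d + 2 := by
  induction d with
  | zero => simp [sumExp]
  | succ d ih =>
    simp only [sumExp, RExp.size, ih, h]
    ring

/-- The point `v` has its coordinates from position `o` of the input array `k`. -/
def PointAt {d : ℕ} (m : Machine) (k o : ℕ) (v : Point d) : Prop :=
  o + d ≤ (m.inR.getD k []).length ∧ ∀ j : Fin d, (m.inR.getD k []).getD (o + j) 0 = v j

/-- The difference of the coordinates `j` of points in the arrays `k` and `l` at the offsets in
the registers `x` and `y`. -/
def diffExp (k x l y j : ℕ) : RExp :=
  .sub (.inp k (.add (.reg x) (.const j))) (.inp l (.add (.reg y) (.const j)))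

/-- Compute the part `[rreg 0, rreg 1]` of the segment in the array `l` with offsets in the
registers `15`, `16` in the ball of radius `rreg 12` at the point in the array `k` with offset in
the register `14`. -/
def door (d k l : ℕ) : Cmd :=
  .setR 3 (sumExp (fun j => .mul (diffExp l 16 l 15 j) (diffExp l 16 l 15 j)) d) ;;
  .setR 4 (sumExp (fun j => .mul (diffExp l 16 l 15 j) (diffExp l 15 k 14 j)) d) ;;
  .setR 5 (.sub (sumExp (fun j => .mul (diffExp l 15 k 14 j) (diffExp l 15 k 14 j)) d)
    (.mul (.reg 12) (.reg 12))) ;;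
  -- The default `[1, 0]` is the empty door. It survives if the segment is a single point outside
  -- the ball, or if the quadratic has no real root.
  .setR 0 (.ofN (.const 1)) ;; .setR 1 (.ofN (.const 0)) ;;
  .ite (.leR (.reg 3) (.ofN (.const 0)))
    (.ite (.leR (.reg 5) (.ofN (.const 0)))
      (.setR 0 (.ofN (.const 0)) ;; .setR 1 (.ofN (.const 1))) .skip)
    (.setR 6 (.sub (.mul (.reg 4) (.reg 4)) (.mul (.reg 3) (.reg 5))) ;;
      .ite (.leR (.ofN (.const 0)) (.reg 6))
        (.setR 0 (.div (.sub (.sub (.ofN (.const 0)) (.reg 4)) (.sqrt (.reg 6))) (.reg 3)) ;;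
          .setR 1 (.div (.sub (.sqrt (.reg 6)) (.reg 4)) (.reg 3)) ;;
          .ite (.ltR (.reg 0) (.ofN (.const 0))) (.setR 0 (.ofN (.const 0))) .skip ;;
          .ite (.ltR (.ofN (.const 1)) (.reg 1)) (.setR 1 (.ofN (.const 1))) .skip)
        .skip)

theorem diffExp_ok {d : ℕ} {m : Machine} {s : Store} {k l x y j : ℕ} {u v : Point d}
    (hu : PointAt m k (s.nreg x) u) (hv : PointAt m l (s.nreg y) v) (hj : j < d)
    (hx : s.nreg x + d ≤ m.maxInt) (hy : s.nreg y + d ≤ m.maxInt) : (diffExp k x l y j).Ok m s := by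
  have := hu.1
  have := hv.1
  simp only [diffExp, RExp.Ok, NExp.Ok, NExp.val, true_and]
  omega

theorem diffExp_val {d : ℕ} {m : Machine} {s : Store} {k l x y : ℕ} {u v : Point d}
    (hu : PointAt m k (s.nreg x) u) (hv : PointAt m l (s.nreg y) v) (j : Fin d) :
    (diffExp k x l y j).val m s = u j - v j := by
  simp [diffExp, ← hu.2, ← hv.2]

theorem wp_door {d : ℕ} {m : Machine} {s : Store} {k l : ℕ} {u v w : Point d} {r : ℝ}
    (hr : 0 ≤ r) (h12 : s.rreg 12 = r) (hm : 1 ≤ m.maxInt) (hw : PointAt m k (s.nreg 14) w)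
    (hu : PointAt m l (s.nreg 15) u) (hv : PointAt m l (s.nreg 16) v)
    (h14 : s.nreg 14 + d ≤ m.maxInt) (h15 : s.nreg 15 + d ≤ m.maxInt)
    (h16 : s.nreg 16 + d ≤ m.maxInt) {Q : Store → ℕ → Prop}
    (hQ : ∀ s' t, Keeps ∅ {0, 1, 3, 4, 5, 6} ∅ ∅ s s' →
      (∀ x, (x ∈ Set.Icc (0 : ℝ) 1 ∧ ‖AffineMap.lineMap u v x - w‖ ≤ r) ↔
        s'.rreg 0 ≤ x ∧ x ≤ s'.rreg 1) → t ≤ 100 * (d + 1) → Q s' t) :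
    wp m (door d k l) s Q := by
  -- Each summand is a product of two differences of size 9, that is 19 operations, plus one for the
  -- addition.
  have hsq : ∀ f g : ℕ → RExp, (∀ j, (f j).size = 9) → (∀ j, (g j).size = 9) →
      (sumExp (fun j => .mul (f j) (g j)) d).size = 20 * d + 2 := fun f g hf hg =>
    sumExp_size (k := 19) (fun j => by simp [hf, hg]) d
  have hsz : ∀ k x l y j, (diffExp k x l y j).size = 9 := fun k x l y j => by
    simp [diffExp]
  have hiff := norm_lineMap_sub_le_iff u v w hr
  set A := ∑ j, (v j - u j) * (v j - u j) with hA
  set B := ∑ j, (v j - u j) * (u j - w j)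
  set C := ∑ j, (u j - w j) * (u j - w j)
  have eA : ∀ s' : Store, s'.nreg = s.nreg →
      (sumExp (fun j => .mul (diffExp l 16 l 15 j) (diffExp l 16 l 15 j)) d).val m s' = A :=
    fun s' hs => sumExp_val fun j => by
      rw [RExp.val, diffExp_val (u := v) (v := u) (by rwa [hs]) (by rwa [hs])]
  have eB : ∀ s' : Store, s'.nreg = s.nreg →
      (sumExp (fun j => .mul (diffExp l 16 l 15 j) (diffExp l 15 k 14 j)) d).val m s' = B :=
    fun s' hs => sumExp_val fun j => by
      rw [RExp.val, diffExp_val (u := v) (v := u) (by rwa [hs]) (by rwa [hs]),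
        diffExp_val (u := u) (v := w) (by rwa [hs]) (by rwa [hs])]
  have eC : ∀ s' : Store, s'.nreg = s.nreg →
      (sumExp (fun j => .mul (diffExp l 15 k 14 j) (diffExp l 15 k 14 j)) d).val m s' = C :=
    fun s' hs => sumExp_val fun j => by
      rw [RExp.val, diffExp_val (u := u) (v := w) (by rwa [hs]) (by rwa [hs])]
  simp only [door, wp, RExp.Ok, RExp.size, NExp.size, BExp.size, BExp.Ok, BExp.val,
    hsq _ _ (hsz _ _ _ _) (hsz _ _ _ _), RExp.val, eA, eB, eC]
  refine ⟨sumExp_ok fun j hj => ⟨diffExp_ok hv hu hj h16 h15, diffExp_ok hv hu hj h16 h15⟩,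
    sumExp_ok fun j hj => ⟨diffExp_ok hv hu hj h16 h15, diffExp_ok hu hw hj h15 h14⟩,
    ⟨sumExp_ok fun j hj => ⟨diffExp_ok hu hw hj h15 h14, diffExp_ok hu hw hj h15 h14⟩, by simp⟩, ?_⟩
  have hkeep : ∀ f : ℕ → ℝ, (∀ x, x ∉ ({0, 1, 3, 4, 5, 6} : Set ℕ) → f x = s.rreg x) →
      Keeps ∅ {0, 1, 3, 4, 5, 6} ∅ ∅ s { s with rreg := f } := fun f hf =>
    ⟨fun _ _ => rfl, hf, fun _ _ => rfl, fun _ _ => rfl⟩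
  simp [h12, hm]
  refine ⟨fun hA0 => ?_, fun hA0 => ?_⟩
  -- The segment is a single point here, so the door is all of `[0, 1]` or empty, according to the
  -- sign of the constant term.
  · have hA' : ∀ j, v j - u j = 0 := by
      have h0 : A = 0 := le_antisymm hA0 (Finset.sum_nonneg fun j _ => mul_self_nonneg _)
      intro j
      have := (Finset.sum_eq_zero_iff_of_nonneg fun j _ => mul_self_nonneg (v j - u j)).1 h0 j
        (Finset.mem_univ j)
      simpa using this
    have hB : B = 0 := Finset.sum_eq_zero fun j _ => by simp [hA']
    have hA : A = 0 := Finset.sum_eq_zero fun j _ => by simp [hA']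
    simp only [hA, hB] at hiff
    refine ⟨fun hC => hQ _ _ (hkeep _ ?_) ?_ (by omega), fun hC => hQ _ _ (hkeep _ ?_) ?_
        (by omega)⟩
    · intro x hx
      simp at hx
      simp [hx]
    · intro x
      rw [hiff]
      simp
      intro _ _
      linarith
    · intro x hx
      simp at hx
      simp [hx]
    · intro x
      rw [hiff]
      simp
      refine ⟨fun h => by linarith [h.2], fun h => by linarith [h.1, h.2]⟩
  · refine ⟨fun hD => ⟨⟨hD, hA0.ne'⟩, ?_⟩, fun hD => ?_⟩
    · have hq := fun x => quadratic_nonpos_iff (x := x) hA0 (sub_nonneg.2 hD)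
      simp only [zero_sub] at hq
      refine ⟨fun h1 => ⟨fun h2 => ?_, fun h2 => ?_⟩, fun h1 => ⟨fun h2 => ?_, fun h2 => ?_⟩⟩ <;>
      · refine hQ _ _ (hkeep _ ?_) ?_ (by omega)
        · intro x hx
          simp at hx
          simp [hx]
        · intro x
          rw [hiff, hq]
          simp
          grind
    · refine hQ _ _ (hkeep _ ?_) ?_ (by omega)
      · intro x hx
        simp at hx
        simp [hx]
      · intro x
        rw [hiff]
        simp
        refine ⟨fun h => ?_, fun h => by linarith [h.1, h.2]⟩
        -- Multiplied by `A > 0`, the quadratic is `(A x + B) ^ 2` minus a negative discriminant, so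
        -- it is never nonpositive.
        nlinarith [mul_self_nonneg (A * x + B)]

/-! ### Binary search and counting -/

/-- Compute in the register `18` how many entries of the input array `k`, whose length is the
input integer `li`, pass the test against the key. -/
def search (test : RExp → RExp → BExp) (k li : ℕ) (key : RExp) : Cmd :=
  .setN 18 (.const 0) ;; .setN 19 (.inp li) ;;
  .loop (.ltN (.reg 18) (.reg 19))
    (.setN 20 (.div (.add (.reg 18) (.reg 19)) (.const 2)) ;;
      .ite (test (.inp k (.reg 20)) key) (.setN 18 (.add (.reg 20) (.const 1)))
        (.setN 19 (.reg 20)))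

/-- The entries that pass the test form an initial segment by `hp`, and the search window, of length
below `2 ^ e'`, is halved in each round. The test is a parameter because left endpoints are compared
by `<` and right endpoints by `≤`. -/
theorem wp_search {m : Machine} {s : Store} {test : RExp → RExp → BExp} {p : ℝ → ℝ → Prop}
    {k li x e len : ℕ} (hm : 2 ≤ m.maxInt)
    (hval : ∀ s u v, (test u v).val m s ↔ p (u.val m s) (v.val m s))
    (hok : ∀ s u v, u.Ok m s → v.Ok m s → (test u v).Ok m s)
    (hsize : ∀ u v, (test u v).size = u.size + v.size + 1)
    (hli : li < m.inN.length) (hlen : m.inN.getD li 0 = len) (hlk : (m.inR.getD k []).length = len)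
    (hmax : 2 * len ≤ m.maxInt) (he : len < 2 ^ e)
    (hp : ∀ i j, i < j → j < len → p ((m.inR.getD k []).getD j 0) (s.rreg x) →
      p ((m.inR.getD k []).getD i 0) (s.rreg x))
    {Q : Store → ℕ → Prop}
    (hQ : ∀ s' t, Keeps {18, 19, 20} ∅ ∅ ∅ s s' → s'.nreg 18 ≤ len →
      (∀ i < len, p ((m.inR.getD k []).getD i 0) (s.rreg x) ↔ i < s'.nreg 18) →
      t ≤ 100 * (e + 1) → Q s' t) :
    wp m (search test k li (.reg x)) s Q := by
  simp only [search, wp, NExp.Ok, NExp.val, NExp.size, hlen]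
  refine ⟨by omega, ⟨hli, by omega⟩, ?_⟩
  refine wp_loop (I := fun s' u => Keeps {18, 19, 20} ∅ ∅ ∅ s s' ∧ ∃ e',
      s'.nreg 19 - s'.nreg 18 < 2 ^ e' ∧ s'.nreg 18 ≤ s'.nreg 19 ∧ s'.nreg 19 ≤ len ∧
      (∀ i < s'.nreg 18, p ((m.inR.getD k []).getD i 0) (s.rreg x)) ∧
      (∀ i, s'.nreg 19 ≤ i → i < len → ¬ p ((m.inR.getD k []).getD i 0) (s.rreg x)) ∧
      u = 60 * e') ?_ ?_ (u := 60 * e) ?_ ?_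
  · intro s' u _
    simp
  · rintro s' u ⟨hk, e', h1, h2, h3, h4, h5, rfl⟩ hlt
    have hx : s'.rreg x = s.rreg x := hk.rreg x (by simp)
    simp only [BExp.val, NExp.val] at hlt
    obtain ⟨e', rfl⟩ : ∃ e'', e' = e'' + 1 :=
      Nat.exists_eq_succ_of_ne_zero (by rintro rfl; simp at h1; omega)
    rw [pow_succ] at h1
    set mid := (s'.nreg 18 + s'.nreg 19) / 2 with hmid
    have hk' : ∀ f : ℕ → ℕ, (∀ x, x ∉ ({18, 19, 20} : Set ℕ) → f x = s'.nreg x) →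
        Keeps {18, 19, 20} ∅ ∅ ∅ s { s' with nreg := f } := fun f hf =>
      hk.trans ⟨hf, fun _ _ => rfl, fun _ _ => rfl, fun _ _ => rfl⟩
    simp only [wp, NExp.Ok, NExp.val, NExp.size, BExp.size, hval, RExp.val, hsize, RExp.size, hx,
      ← hmid, Function.update_self, true_and]
    refine ⟨by omega, hok _ _ _ ?_ trivial, fun ht => ⟨by omega, .intro (60 * e')
      ⟨hk' _ ?_, e', ?_⟩ (by omega)⟩, fun ht => .intro (60 * e') ⟨hk' _ ?_, e', ?_⟩ (by omega)⟩
    · simp only [RExp.Ok, NExp.Ok, NExp.val, Function.update_self, hlk, true_and]; omega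
    · intro x hx
      simp at hx
      simp [hx]
    · simp
      refine ⟨by omega, by omega, h3, fun i hi => ?_, h5⟩
      rcases hi.eq_or_lt with rfl | hi
      · exact ht
      · exact hp i mid hi (by omega) ht
    · intro x hx
      simp at hx
      simp [hx]
    · simp
      refine ⟨by omega, by omega, by omega, h4, fun i hi hil => ?_⟩
      rcases hi.eq_or_lt with rfl | hi
      · exact ht
      · exact fun h => ht (hp mid i hi hil h)
  · refine ⟨⟨?_, fun _ _ => rfl, fun _ _ => rfl, fun _ _ => rfl⟩, e, ?_⟩
    · intro x hx
      simp at hx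
      simp [hx]
    · simp
      exact ⟨he, fun i h1 h2 => by omega⟩
  · rintro s' t u ⟨hk, e', -, h2, h3, h4, h5, -⟩ hn ht
    simp only [BExp.val, NExp.val, not_lt] at hn
    refine hQ s' _ hk (by omega) (fun i hi => ⟨fun h => ?_, h4 i⟩) ?_
    · by_contra hlt
      exact h5 i (by omega) hi h
    · simp at ht
      omega

/-- The input arrays `kl` and `kr` of length `len`, which is the input integer `li`, contain the
left and right endpoints of interior-disjoint intervals from left to right. -/
structure IsTable (m : Machine) (kl kr li len : ℕ) : Prop where
  lt_length : li < m.inN.length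
  inN_eq : m.inN.getD li 0 = len
  length_left : (m.inR.getD kl []).length = len
  length_right : (m.inR.getD kr []).length = len
  lt : ∀ i < len, (m.inR.getD kl []).getD i 0 < (m.inR.getD kr []).getD i 0
  le : ∀ i j, i < j → j < len → (m.inR.getD kr []).getD i 0 ≤ (m.inR.getD kl []).getD j 0

/-- The `i`-th interval of a table. -/
def tableIcc (m : Machine) (kl kr i : ℕ) : Set ℝ :=
  Set.Icc ((m.inR.getD kl []).getD i 0) ((m.inR.getD kr []).getD i 0)

open Classical in
/-- The number of intervals of a table that are contained in `W`. -/
noncomputable def countIn (m : Machine) (kl kr len : ℕ) (W : Set ℝ) : ℕ :=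
  ((Finset.range len).filter fun i => tableIcc m kl kr i ⊆ W).card

theorem countIn_le (m : Machine) (kl kr len : ℕ) (W : Set ℝ) : countIn m kl kr len W ≤ len := by
  classical
  exact (Finset.card_filter_le _ _).trans (Finset.card_range len).le

theorem countIn_empty {m : Machine} {kl kr li len : ℕ} (h : IsTable m kl kr li len) :
    countIn m kl kr len ∅ = 0 := by
  classical
  refine Finset.card_eq_zero.2 (Finset.filter_eq_empty_iff.2 fun i hi hs => ?_)
  exact hs (Set.left_mem_Icc.2 (h.lt i (Finset.mem_range.1 hi)).le)

/-- A nondegenerate interval lies in `[A, B]` iff its left end is not among the first `p` and its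
right end is among the first `q`. Truncated subtraction gives `0` when `[A, B]` contains none, even
if `B < A`. -/
theorem countIn_Icc {m : Machine} {kl kr li len : ℕ} (h : IsTable m kl kr li len) {A B : ℝ}
    {p q : ℕ} (hp : ∀ i < len, (m.inR.getD kl []).getD i 0 < A ↔ i < p)
    (hq : ∀ i < len, (m.inR.getD kr []).getD i 0 ≤ B ↔ i < q) (hq' : q ≤ len) :
    countIn m kl kr len (Set.Icc A B) = q - p := by
  classical
  rw [← Nat.card_Ico, countIn]
  refine congrArg Finset.card (Finset.ext fun i => ?_)
  rw [Finset.mem_filter, Finset.mem_range, Finset.mem_Ico, tableIcc]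
  constructor
  · rintro ⟨hi, hs⟩
    rw [Set.Icc_subset_Icc_iff (h.lt i hi).le] at hs
    exact ⟨not_lt.1 ((hp i hi).not.1 (not_lt.2 hs.1)), (hq i hi).1 hs.2⟩
  · rintro ⟨h1, h2⟩
    have hi : i < len := by omega
    exact ⟨hi, Set.Icc_subset_Icc (not_lt.1 ((hp i hi).not.2 (not_lt.2 h1))) ((hq i hi).2 h2)⟩

/-- An interval is connected, so it cannot lie in the union of two disjoint closed sets without
lying in one of them; being nonempty, it does not lie in both. The components of a union can thus be
counted separately. -/
theorem countIn_union {m : Machine} {kl kr li len : ℕ} (h : IsTable m kl kr li len) {A B : ℝ}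
    {Z : Set ℝ} (hZ : IsClosed Z) (hZB : ∀ z ∈ Z, B < z) :
    countIn m kl kr len (Z ∪ Set.Icc A B) =
      countIn m kl kr len Z + countIn m kl kr len (Set.Icc A B) := by
  classical
  rw [countIn, countIn, countIn, ← Finset.card_union_of_disjoint, ← Finset.filter_or]
  · refine congrArg Finset.card (Finset.filter_congr fun i _ => ⟨fun hs => ?_, ?_⟩)
    · by_contra hn
      rw [not_or, Set.not_subset, Set.not_subset] at hn
      obtain ⟨⟨x, hx, hxZ⟩, y, hy, hyI⟩ := hn
      obtain ⟨z, -, hz, hz'⟩ := isPreconnected_closed_iff.1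
        (isPreconnected_Icc : IsPreconnected (tableIcc m kl kr i)) Z (Set.Icc A B) hZ
        isClosed_Icc hs ⟨y, hy, (hs hy).resolve_right hyI⟩ ⟨x, hx, (hs hx).resolve_left hxZ⟩
      exact absurd (hZB z hz) (not_lt.2 hz'.2)
    · exact fun hs => hs.elim (fun hs => hs.trans Set.subset_union_left)
        fun hs => hs.trans Set.subset_union_right
  · refine Finset.disjoint_filter.2 fun i hi h1 h2 => ?_
    have := Set.left_mem_Icc.2 (h.lt i (Finset.mem_range.1 hi)).le
    exact absurd (hZB _ (h1 this)) (not_lt.2 (h2 this).2)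

/-- Add to the register `8` the number of intervals of the table in `[rreg 8, rreg 9]`. -/
def flush (kl kr li : ℕ) : Cmd :=
  search .ltR kl li (.reg 8) ;; .setN 21 (.reg 18) ;; search .leR kr li (.reg 9) ;;
  .setN 8 (.add (.reg 8) (.sub (.reg 18) (.reg 21)))

/-- The hypothesis `hle` keeps the running count within the length of the table, hence within a
machine word. -/
theorem wp_flush {m : Machine} {s : Store} {kl kr li e len : ℕ} (hm : 2 ≤ m.maxInt)
    (h : IsTable m kl kr li len) (hmax : 2 * len ≤ m.maxInt) (he : len < 2 ^ e)
    (hle : s.nreg 8 + countIn m kl kr len (Set.Icc (s.rreg 8) (s.rreg 9)) ≤ len)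
    {Q : Store → ℕ → Prop}
    (hQ : ∀ s' t, Keeps {8, 18, 19, 20, 21} ∅ ∅ ∅ s s' →
      s'.nreg 8 = s.nreg 8 + countIn m kl kr len (Set.Icc (s.rreg 8) (s.rreg 9)) →
      t ≤ 300 * (e + 1) → Q s' t) : wp m (flush kl kr li) s Q := by
  have hmono : ∀ i j, i < j → j < len →
      (m.inR.getD kl []).getD i 0 < (m.inR.getD kl []).getD j 0 ∧
      (m.inR.getD kr []).getD i 0 < (m.inR.getD kr []).getD j 0 := fun i j hij hj =>
    ⟨(h.lt i (hij.trans hj)).trans_le (h.le i j hij hj), (h.le i j hij hj).trans_lt (h.lt j hj)⟩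
  simp only [flush, wp]
  refine wp_search (p := (· < ·)) hm (fun _ _ _ => Iff.rfl) (fun _ _ _ => And.intro)
    (fun _ _ => rfl) h.lt_length h.inN_eq h.length_left hmax he
    (fun i j hij hj hlt => (hmono i j hij hj).1.trans hlt) ?_
  intro s₁ t₁ hk₁ hle₁ hp ht₁
  refine ⟨trivial, ?_⟩
  refine wp_search (p := (· ≤ ·)) hm (fun _ _ _ => Iff.rfl) (fun _ _ _ => And.intro)
    (fun _ _ => rfl) h.lt_length h.inN_eq h.length_right hmax he
    (fun i j hij hj hlt => (hmono i j hij hj).2.le.trans hlt) ?_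
  intro s₂ t₂ hk₂ hle₂ hq ht₂
  simp only [hk₁.rreg 9 (by simp)] at hq
  rw [countIn_Icc h hp hq hle₂] at hle hQ
  have h8 : s₂.nreg 8 = s.nreg 8 := by
    rw [hk₂.nreg 8 (by simp)]
    simp [hk₁.nreg 8 (by simp)]
  have h21 : s₂.nreg 21 = s₁.nreg 18 := by
    rw [hk₂.nreg 21 (by simp)]
    simp
  simp only [NExp.Ok, NExp.val, NExp.size, h8, h21, true_and]
  refine ⟨by omega, hQ _ _ ⟨fun x hx => ?_, fun x _ => ?_, fun x _ => ?_, fun x _ => ?_⟩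
    (by simp) (by omega)⟩
  · simp at hx
    simp only
    rw [Function.update_of_ne hx.1, hk₂.nreg x (by simp [hx])]
    simp only
    rw [Function.update_of_ne hx.2.2.2.2, hk₁.nreg x (by simp [hx])]
  · exact (hk₂.rreg x (by simp)).trans (hk₁.rreg x (by simp))
  · exact (hk₂.nmem x (by simp)).trans (hk₁.nmem x (by simp))
  · exact (hk₂.rmem x (by simp)).trans (hk₁.rmem x (by simp))

/-- Count in the register `8` the intervals of the table in the union of the intervals in the
buffer, which starts at the real address `2 * inN 0` and contains as many intervals as the
register `6` says, sorted by their right endpoints. -/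
def sweep (kl kr li : ℕ) : Cmd :=
  .setN 8 (.const 0) ;; .setR 8 (.reg 11) ;; .setR 9 (.ofN (.const 0)) ;; .setN 17 (.reg 6) ;;
  .loop (.ltN (.const 0) (.reg 17))
    (.setN 17 (.sub (.reg 17) (.const 1)) ;;
      .setR 10 (.mem (.add (.mul (.const 2) (.inp 0)) (.mul (.const 2) (.reg 17)))) ;;
      .setR 7 (.mem (.add (.add (.mul (.const 2) (.inp 0)) (.mul (.const 2) (.reg 17)))
        (.const 1))) ;;
      .ite (.ltR (.reg 7) (.reg 8))
        (flush kl kr li ;; .setR 8 (.reg 10) ;; .setR 9 (.reg 7))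
        (.ite (.ltR (.reg 10) (.reg 8)) (.setR 8 (.reg 10)) .skip)) ;;
  flush kl kr li

/-- The buffer is read from the largest right end down. `[rreg 8, rreg 9]` is the component under
construction and `Z` the union of the finished ones, all to its right. A next interval that ends
left of `rreg 8` starts a new component; otherwise it ends within the current one and can only
extend it to the left. -/
theorem wp_sweep {m : Machine} {s : Store} {kl kr li e len n : ℕ} (hm : m.cells ≤ m.maxInt)
    (hc : 2 ≤ m.cells) (h : IsTable m kl kr li len) (hmax : 2 * len ≤ m.maxInt) (he : len < 2 ^ e)
    (hn : m.inN.getD 0 0 = n) (hN : 0 < m.inN.length) (hcap : 2 * n + 2 * s.nreg 6 ≤ m.cells)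
    (hinf : 0 < s.rreg 11)
    (hab : ∀ k < s.nreg 6, s.rmem (2 * n + 2 * k) ≤ s.rmem (2 * n + 2 * k + 1))
    (hb : ∀ k < s.nreg 6, s.rmem (2 * n + 2 * k + 1) < s.rreg 11)
    (hbb : ∀ k k', k < k' → k' < s.nreg 6 →
      s.rmem (2 * n + 2 * k + 1) ≤ s.rmem (2 * n + 2 * k' + 1))
    {Q : Store → ℕ → Prop}
    (hQ : ∀ s' t, Keeps {8, 17, 18, 19, 20, 21} {7, 8, 9, 10} ∅ ∅ s s' →
      s'.nreg 8 = countIn m kl kr len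
        {x | ∃ k < s.nreg 6, x ∈ Set.Icc (s.rmem (2 * n + 2 * k)) (s.rmem (2 * n + 2 * k + 1))} →
      t ≤ 500 * (e + 1) * (s.nreg 6 + 1) → Q s' t) : wp m (sweep kl kr li) s Q := by
  simp only [sweep, wp, NExp.Ok, RExp.Ok, NExp.size, RExp.size, NExp.val, RExp.val]
  refine ⟨by omega, trivial, by omega, trivial, ?_⟩
  refine wp_loop (I := fun s' u => Keeps {8, 17, 18, 19, 20, 21} {7, 8, 9, 10} ∅ ∅ s s' ∧
      s'.nreg 17 ≤ s.nreg 6 ∧ (∃ Z : Set ℝ, IsClosed Z ∧ (∀ z ∈ Z, s'.rreg 9 < z) ∧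
      (∀ z ∈ Z, s'.rreg 8 < z) ∧
        s'.nreg 8 = countIn m kl kr len Z ∧
        {x | ∃ k, s'.nreg 17 ≤ k ∧ k < s.nreg 6 ∧
          x ∈ Set.Icc (s.rmem (2 * n + 2 * k)) (s.rmem (2 * n + 2 * k + 1))} =
          Z ∪ Set.Icc (s'.rreg 8) (s'.rreg 9)) ∧
      (∀ k < s'.nreg 17, s'.rreg 8 ≤ s.rmem (2 * n + 2 * k + 1) →
        s.rmem (2 * n + 2 * k + 1) ≤ s'.rreg 9) ∧ u = 400 * (e + 1) * s'.nreg 17)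
      ?_ ?_ (u := 400 * (e + 1) * s.nreg 6) ?_ ?_
  · intro s' u _
    simp
  · rintro s' u ⟨hk, hk17, ⟨Z, hZ, hZ9, hZ8, h8, hW⟩, hmerge, rfl⟩ hpos
    simp only [BExp.val, NExp.val] at hpos
    obtain ⟨k, hk'⟩ : ∃ k, s'.nreg 17 = k + 1 := Nat.exists_eq_succ_of_ne_zero hpos.ne'
    have hkk : k < s.nreg 6 := by omega
    rw [hk'] at hW hmerge
    have hu : 400 * (e + 1) * (k + 1) = 400 * (e + 1) * k + 400 * e + 400 := by ring
    set a := s.rmem (2 * n + 2 * k) with ha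
    set b := s.rmem (2 * n + 2 * k + 1) with hbk
    have hW' : {x | ∃ i, k ≤ i ∧ i < s.nreg 6 ∧
        x ∈ Set.Icc (s.rmem (2 * n + 2 * i)) (s.rmem (2 * n + 2 * i + 1))} =
        (Z ∪ Set.Icc (s'.rreg 8) (s'.rreg 9)) ∪ Set.Icc a b := by
      rw [← hW]
      ext x
      constructor
      · rintro ⟨i, h1, h2, h3⟩
        rcases h1.eq_or_lt with rfl | h1
        · exact .inr h3
        · exact .inl ⟨i, h1, h2, h3⟩
      · rintro (⟨i, h1, h2, h3⟩ | h3)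
        · exact ⟨i, by omega, h2, h3⟩
        · exact ⟨k, le_rfl, hkk, h3⟩
    have hrm : s'.rmem = s.rmem := funext fun x => hk.rmem x (by simp)
    have hkeep : ∀ (f : ℕ → ℕ) (g : ℕ → ℝ),
        (∀ x, x ∉ ({8, 17, 18, 19, 20, 21} : Set ℕ) → f x = s'.nreg x) →
        (∀ x, x ∉ ({7, 8, 9, 10} : Set ℕ) → g x = s'.rreg x) →
        Keeps {8, 17, 18, 19, 20, 21} {7, 8, 9, 10} ∅ ∅ s ⟨f, g, s'.nmem, s.rmem⟩ :=
      fun f g hf hg => hk.trans ⟨hf, hg, fun _ _ => rfl, fun x _ => by rw [hrm]⟩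
    simp only [wp, NExp.Ok, RExp.Ok, NExp.size, RExp.size, NExp.val, RExp.val, BExp.Ok, BExp.val,
      BExp.size, hn, hk', Nat.add_sub_cancel, Function.update_self, hrm, ← ha, ← hbk,
      ne_eq, Nat.reduceEqDiff, not_false_eq_true, Function.update_of_ne, true_and, and_true]
    refine ⟨by omega, by omega, by omega, fun hflush => ?_, fun hmerge' => ⟨fun hlt => ?_,
      fun hge => ?_⟩⟩
    -- A gap has been found: the current component is complete, so it is counted and joins `Z`.
    · have hle := countIn_le m kl kr len (Z ∪ Set.Icc (s'.rreg 8) (s'.rreg 9))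
      rw [countIn_union h hZ hZ9, ← h8] at hle
      refine wp_flush (by omega) h hmax he (by simpa using hle) ?_
      intro s₁ t₁ hk₁ h₁ ht₁
      refine .intro (400 * (e + 1) * k) ⟨?_, ?_, ⟨Z ∪ Set.Icc (s'.rreg 8) (s'.rreg 9),
        hZ.union isClosed_Icc, ?_, ?_, ?_, ?_⟩, ?_, ?_⟩ (by rw [hu]; omega)
      · refine hk.trans ⟨fun x hx => ?_, fun x hx => ?_, fun x _ => ?_, fun x _ => ?_⟩
        · simp at hx
          simp [hk₁.nreg x (by simp [hx]), hx]
        · simp at hx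
          simp [hk₁.rreg x (by simp), hx]
        · exact hk₁.nmem x (by simp)
        · rw [hrm]; exact hk₁.rmem x (by simp)
      · simp [hk₁.nreg 17 (by simp)]
        omega
      · simp [hk₁.rreg 7 (by simp)]
        rintro z (hz | hz)
        · exact hflush.trans (hZ8 z hz)
        · exact hflush.trans_le hz.1
      · simp [hk₁.rreg 10 (by simp)]
        rintro z (hz | hz)
        · exact (hab k hkk).trans_lt (hflush.trans (hZ8 z hz))
        · exact (hab k hkk).trans_lt (hflush.trans_le hz.1)
      · simp at h₁
        simp [h₁, countIn_union h hZ hZ9, h8]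
      · simp [hk₁.nreg 17 (by simp), hk₁.rreg 7 (by simp), hk₁.rreg 10 (by simp)]
        exact hW'
      · simp [hk₁.nreg 17 (by simp), hk₁.rreg 7 (by simp), hk₁.rreg 10 (by simp)]
        intro i hi _
        exact hbb i k hi hkk
      · simp [hk₁.nreg 17 (by simp)]
    · refine .intro (400 * (e + 1) * k) ⟨hkeep _ _ ?_ ?_, ?_⟩ (by rw [hu]; omega)
      · intro x hx
        simp at hx
        simp [hx]
      · intro x hx
        simp at hx
        simp [hx]
      · simp
        refine ⟨by omega, ⟨Z, hZ, hZ9, fun z hz => hlt.trans (hZ8 z hz), h8, hW'.trans ?_⟩,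
          fun i hi h1 => ?_⟩
        · have hb9 := hmerge k (by omega) (not_lt.1 hmerge')
          ext x
          simp only [Set.mem_union, Set.mem_Icc]
          grind
        · exact (hbb i k hi hkk).trans (hmerge k (by omega) (not_lt.1 hmerge'))
    · refine .intro (400 * (e + 1) * k) ⟨hkeep _ _ ?_ ?_, ?_⟩ (by rw [hu]; omega)
      · intro x hx
        simp at hx
        simp [hx]
      · intro x hx
        simp at hx
        simp [hx]
      · simp
        refine ⟨by omega, ⟨Z, hZ, hZ9, hZ8, h8, hW'.trans ?_⟩, fun i hi h1 => hmerge i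
            (by omega) h1⟩
        have hb9 := hmerge k (by omega) (not_lt.1 hmerge')
        ext x
        simp only [Set.mem_union, Set.mem_Icc]
        grind
  · refine ⟨⟨fun x hx => ?_, fun x hx => ?_, fun _ _ => rfl, fun _ _ => rfl⟩, ?_⟩
    · simp at hx
      simp [hx]
    · simp at hx
      simp [hx]
    · simp
      refine ⟨⟨∅, isClosed_empty, by simp, by simp, (countIn_empty h).symm, ?_⟩, fun k hk hle => ?_⟩
      -- The initial component `[n + 1, 0]` is empty, and every right end lies below `n + 1`. So the
      -- first interval flushes it, which counts nothing.
      · rw [Set.Icc_eq_empty (not_le.2 hinf), Set.union_empty]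
        ext x
        simp
        intro k h1 h2
        omega
      · exact absurd (hb k hk) (not_lt.2 hle)
  · rintro s' t u ⟨hk, -, ⟨Z, hZ, hZ9, hZ8, h8, hW⟩, -, rfl⟩ hneg ht
    simp only [BExp.val, NExp.val, not_lt, Nat.le_zero] at hneg
    have hle := countIn_le m kl kr len (Z ∪ Set.Icc (s'.rreg 8) (s'.rreg 9))
    rw [countIn_union h hZ hZ9, ← h8] at hle
    refine wp_flush (by omega) h hmax he hle ?_
    intro s₁ t₁ hk₁ h₁ ht₁
    refine hQ _ _ (hk.trans (hk₁.mono ?_ (by simp) (by simp) (by simp))) ?_ ?_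
    · intro x
      simp
      grind
    · rw [h₁, h8, ← countIn_union h hZ hZ9, ← hW]
      simp [hneg]
    · simp [NExp.size, BExp.size] at ht
      have : 500 * (e + 1) * (s.nreg 6 + 1) =
        400 * (e + 1) * s.nreg 6 + 100 * (e + 1) * s.nreg 6 + 500 * e + 500 := by ring
      rw [this]
      omega

/-! ### Processing a cell of the free space diagram -/

theorem Keeps.setN {A B C D : Set ℕ} {s s' : Store} (h : Keeps A B C D s s') {x : ℕ} (hx : x ∈ A)
    (v : ℕ) : Keeps A B C D s { s' with nreg := Function.update s'.nreg x v } :=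
  ⟨fun y hy => (Function.update_of_ne (ne_of_mem_of_not_mem hx hy).symm _ _).trans
      (h.nreg y hy), h.rreg,
    h.nmem, h.rmem⟩

theorem Keeps.setR {A B C D : Set ℕ} {s s' : Store} (h : Keeps A B C D s s') {x : ℕ} (hx : x ∈ B)
    (v : ℝ) : Keeps A B C D s { s' with rreg := Function.update s'.rreg x v } :=
  ⟨h.nreg, fun y hy => (Function.update_of_ne (ne_of_mem_of_not_mem hx hy).symm _ _).trans
      (h.rreg y hy),
    h.nmem, h.rmem⟩

theorem Keeps.storeR {A B C D : Set ℕ} {s s' : Store} (h : Keeps A B C D s s') {x : ℕ}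
    (hx : x ∈ D) (v : ℝ) : Keeps A B C D s { s' with rmem := Function.update s'.rmem x v } :=
  ⟨h.nreg, h.rreg, h.nmem,
    fun y hy => (Function.update_of_ne (ne_of_mem_of_not_mem hx hy).symm _ _).trans (h.rmem y hy)⟩

/-- The machine contains the input, and is large enough. -/
structure Setup {d : ℕ} (T S : Curve d) (ℓ : ℕ) (r : ℝ) (m : Machine) : Prop where
  two_le : 2 ≤ T.card
  card_le : S.card ≤ T.card
  nonneg : 0 ≤ r
  length : 5 ≤ m.inN.length
  inN_zero : m.inN.getD 0 0 = T.card
  inN_one : m.inN.getD 1 0 = S.card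
  inN_two : m.inN.getD 2 0 = ℓ
  pointT : ∀ c, 1 ≤ c → c ≤ T.card → PointAt m 1 ((c - 1) * d) (T.vertex c)
  pointS : ∀ c, 1 ≤ c → c ≤ S.card → PointAt m 2 ((c - 1) * d) (S.vertex c)
  -- Layout of the real memory, with `n = T.card`: output in `[0, 2n)`, buffer in `[2n, 4n)`, row
  -- lane in `[4n, 6n)`, then `n` column lanes with `ℓ + 1` entries of two cells each.
  le_cells : 6 * T.card + T.card * (2 * (ℓ + 1)) ≤ m.cells
  cells_le : m.cells ≤ m.maxInt
  le_maxInt : T.card * d + d ≤ m.maxInt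

section Cell

variable {d : ℕ} {T S : Curve d} {ℓ : ℕ} {r : ℝ} {m : Machine}

theorem Setup.bounds (h : Setup T S ℓ r m) : 4 * T.card + 2 * ℓ + 8 ≤ m.cells := by
  have h1 := h.two_le
  have h2 := h.le_cells
  have : 2 * (2 * (ℓ + 1)) ≤ T.card * (2 * (ℓ + 1)) := Nat.mul_le_mul_right _ h1
  omega

theorem offset_le {k : ℕ} (h1 : 1 ≤ k) (hk : k ≤ T.card) :
    (k - 1) * d + d ≤ T.card * d := by
  obtain ⟨k, rfl⟩ := Nat.exists_eq_add_of_le' h1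
  calc (k + 1 - 1) * d + d = (k + 1) * d := by rw [Nat.add_sub_cancel]; ring
    _ ≤ _ := Nat.mul_le_mul_right d hk

/-- The number of the vertex of `S` at line `k` for the start `nreg 3`. -/
abbrev lineExp (k : NExp) : NExp := .sub (.add (.reg 3) (.sub k (.const 1))) (.const 1)

/-- Compute the top door `[rreg 0, rreg 1]` of the current cell. -/
def hdoor (d : ℕ) : Cmd :=
  .setN 14 (.mul (lineExp (.reg 4)) (.const d)) ;;
  .setN 15 (.mul (.sub (.reg 5) (.const 1)) (.const d)) ;;
  .setN 16 (.mul (.reg 5) (.const d)) ;; door d 2 1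

/-- Compute the right door `[rreg 0, rreg 1]` of the current cell. -/
def vdoor (d : ℕ) : Cmd :=
  .setN 14 (.mul (.reg 5) (.const d)) ;;
  .setN 15 (.mul (lineExp (.sub (.reg 4) (.const 1))) (.const d)) ;;
  .setN 16 (.mul (lineExp (.reg 4)) (.const d)) ;; door d 1 2

theorem wp_hdoor (h : Setup T S ℓ r m) {s : Store} {i k c : ℕ} (h3 : s.nreg 3 = i)
    (h4 : s.nreg 4 = k) (h5 : s.nreg 5 = c) (h12 : s.rreg 12 = r) (hi : 1 ≤ i)
    (hik : i + (k - 1) ≤ S.card) (hkl : k ≤ ℓ) (hc : 1 ≤ c) (hcn : c < T.card)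
    {Q : Store → ℕ → Prop}
    (hQ : ∀ s' t, Keeps {14, 15, 16} {0, 1, 3, 4, 5, 6} ∅ ∅ s s' →
      (∀ x, HDoor (S.from i) T.vertex r k c x ↔ s'.rreg 0 ≤ x ∧ x ≤ s'.rreg 1) →
      t ≤ 100 * (d + 1) + 50 → Q s' t) : wp m (hdoor d) s Q := by
  have hb := h.bounds
  have hcm := h.cells_le
  have hmd := h.le_maxInt
  have hST := h.card_le
  have o1 := offset_le (T := T) (d := d) (k := i + (k - 1)) (by omega) (by omega)
  have o2 := offset_le (T := T) (d := d) (k := c) hc hcn.le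
  have o3 := offset_le (T := T) (d := d) (k := c + 1) (by omega) hcn
  rw [Nat.add_sub_cancel] at o3
  have p1 := h.pointS (i + (k - 1)) (by omega) hik
  have p2 := h.pointT c hc hcn.le
  have p3 := h.pointT (c + 1) (by omega) hcn
  rw [Nat.add_sub_cancel] at p3
  simp [hdoor, h3, h4, h5]
  refine ⟨by omega, by omega, by omega, ?_⟩
  refine wp_door h.nonneg (by simpa using h12) (by omega) (w := S.from i k) (u := T.vertex c)
    (v := T.vertex (c + 1)) (by simpa [Curve.from] using p1) (by simpa using p2)
        (by simpa using p3) (by simp; omega)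
    (by simp; omega) (by simp; omega) ?_
  intro s' t hk hx ht
  refine hQ _ _ ⟨fun x hx => ?_, hk.rreg, hk.nmem, hk.rmem⟩ (fun x => ?_) (by omega)
  · simp at hx
    simp [hk.nreg x (by simp), hx]
  · rw [← hx]
    exact ⟨fun h => h.2, fun h => ⟨hc, h⟩⟩

theorem wp_vdoor (h : Setup T S ℓ r m) {s : Store} {i k c : ℕ} (h3 : s.nreg 3 = i)
    (h4 : s.nreg 4 = k + 1) (h5 : s.nreg 5 = c) (h12 : s.rreg 12 = r) (hi : 1 ≤ i)
    (hik : i + k ≤ S.card) (hkl : k + 1 ≤ ℓ) (hc : 1 ≤ c) (hcn : c < T.card)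
    {Q : Store → ℕ → Prop}
    (hQ : ∀ s' t, Keeps {14, 15, 16} {0, 1, 3, 4, 5, 6} ∅ ∅ s s' →
      (∀ x, VDoor (S.from i) T.vertex r k (c + 1) x ↔ s'.rreg 0 ≤ x ∧ x ≤ s'.rreg 1) →
      t ≤ 100 * (d + 1) + 50 → Q s' t) : wp m (vdoor d) s Q := by
  have hb := h.bounds
  have hcm := h.cells_le
  have hmd := h.le_maxInt
  have hST := h.card_le
  have o1 := offset_le (T := T) (d := d) (k := i + (k - 1)) (by omega) (by omega)
  have o2 := offset_le (T := T) (d := d) (k := i + k) (by omega) (by omega)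
  have o3 := offset_le (T := T) (d := d) (k := c + 1) (by omega) hcn
  rw [Nat.add_sub_cancel] at o3
  have p1 := h.pointS (i + (k - 1)) (by omega) (by omega)
  have p2 := h.pointS (i + k) (by omega) hik
  have p3 := h.pointT (c + 1) (by omega) hcn
  rw [Nat.add_sub_cancel] at p3
  simp [vdoor, h3, h4, h5]
  refine ⟨by omega, by omega, by omega, ?_⟩
  refine wp_door h.nonneg (by simpa using h12) (by omega) (w := T.vertex (c + 1))
    (u := S.from i k) (v := S.from i (k + 1)) (by simpa using p3) (by simpa [Curve.from] using p1)
    (by simpa [Curve.from] using p2) (by simp; omega) (by simp; omega) (by simp; omega) ?_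
  intro s' t hk hx ht
  refine hQ _ _ ⟨fun x hx => ?_, hk.rreg, hk.nmem, hk.rmem⟩ hx (by omega)
  · simp at hx
    simp [hk.nreg x (by simp), hx]

/-- The address of the entries of the lane of the column `c`. -/
def colBase (n ℓ c : ℕ) : ℕ := 6 * n + c * (2 * (ℓ + 1))

theorem colBase_add_le {n ℓ c c' : ℕ} (h : c < c') :
    colBase n ℓ c + 2 * (ℓ + 1) ≤ colBase n ℓ c' := by
  have : (c + 1) * (2 * (ℓ + 1)) ≤ c' * (2 * (ℓ + 1)) := Nat.mul_le_mul_right _ h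
  rw [colBase, colBase]
  linarith

theorem Setup.colBase_le (h : Setup T S ℓ r m) {c : ℕ} (hc : c < T.card) :
    colBase T.card ℓ c + 2 * (ℓ + 1) ≤ m.cells :=
  (colBase_add_le hc).trans h.le_cells

/-- Select the lane of the current column. -/
def selectCol : Cmd :=
  .setN 10 (.add (.mul (.const 6) (.inp 0))
    (.mul (.reg 5) (.mul (.const 2) (.add (.inp 2) (.const 1))))) ;;
  .setN 11 (.mul (.const 2) (.reg 5))

/-- Select the lane of the current row. -/
def selectRow : Cmd := .setN 10 (.mul (.const 4) (.inp 0)) ;; .setN 11 (.const 0)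

/-- Load the best value of the current lane. -/
def laneOut (x : ℕ) : Cmd :=
  .setR x (.mem (.add (.add (.reg 10) (.mul (.const 2) (.mem (.reg 11)))) (.const 1)))

theorem wp_selectCol (h : Setup T S ℓ r m) {s : Store} {c : ℕ} (h5 : s.nreg 5 = c)
    (hcn : c < T.card) {Q : Store → ℕ → Prop}
    (hQ : Q { s with
      nreg := Function.update (Function.update s.nreg 10 (colBase T.card ℓ c)) 11 (2 * c) } 16) :
          wp m selectCol s Q := by
  have hb := h.bounds
  have hcm := h.cells_le
  have hmd := h.le_maxInt
  have hc := h.colBase_le hcn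
  have hl := h.length
  rw [colBase] at hc hQ
  simp only [selectCol, wp, NExp.Ok, NExp.val, NExp.size, h5, h.inN_zero, h.inN_two, ne_eq,
    Nat.reduceEqDiff, not_false_eq_true, Function.update_of_ne, true_and]
  exact ⟨by omega, by omega, hQ⟩

theorem wp_selectRow (h : Setup T S ℓ r m) {s : Store} {Q : Store → ℕ → Prop}
    (hQ : Q { s with nreg := Function.update (Function.update s.nreg 10 (4 * T.card)) 11 0 } 6) :
    wp m selectRow s Q := by
  have hb := h.bounds
  have hcm := h.cells_le
  have hl := h.length
  simp only [selectRow, wp, NExp.Ok, NExp.val, NExp.size, h.inN_zero]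
  exact ⟨by omega, by omega, hQ⟩

theorem wp_laneOut (hm : m.cells ≤ m.maxInt) {s : Store} {N : ℝ} {b a cap x : ℕ}
    {R : Set (ℝ × ℝ)} (h10 : s.nreg 10 = b) (h11 : s.nreg 11 = a) (hl : LaneAt N s b a cap R)
    (hb : b + 2 * cap ≤ m.cells) (ha : a < m.cells) {Q : Store → ℕ → Prop}
    (hQ : ∀ v, IsBest N {a | ∃ x, (x, a) ∈ R} v →
      Q { s with rreg := Function.update s.rreg x v } 10) : wp m (laneOut x) s Q := by
  have h1 := hl.1
  have h2 := hl.2.lt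
  simp only [laneOut, wp, RExp.Ok, RExp.val, NExp.Ok, NExp.val, NExp.size, RExp.size, h10, h11,
    true_and]
  exact ⟨by omega, hQ _ hl.2.isBest⟩

/-- Append the interval that ends at the right end of the top door to the buffer. -/
def record : Cmd :=
  .ite (.leR (.reg 10) (.ofN (.inp 0)))
    (.storeR (.add (.mul (.const 2) (.inp 0)) (.mul (.const 2) (.reg 6))) (.reg 10) ;;
      .storeR (.add (.add (.mul (.const 2) (.inp 0)) (.mul (.const 2) (.reg 6))) (.const 1))
        (.add (.ofN (.reg 5)) (.reg 1)) ;;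
      .setN 6 (.add (.reg 6) (.const 1)))
    .skip

theorem wp_record (h : Setup T S ℓ r m) {s : Store} {c k : ℕ} {v hi : ℝ} (h5 : s.nreg 5 = c)
    (h6 : s.nreg 6 = k) (h10 : s.rreg 10 = v) (h1 : s.rreg 1 = hi) (hk : k < T.card)
    {Q : Store → ℕ → Prop}
    (hgood : v ≤ T.card → Q { s with
      nreg := Function.update s.nreg 6 (k + 1)
      rmem := Function.update (Function.update s.rmem (2 * T.card + 2 * k) v)
        (2 * T.card + 2 * k + 1) (c + hi) } 32)
    (hvoid : T.card < v → Q s 6) : wp m record s Q := by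
  have hb := h.bounds
  have hcm := h.cells_le
  have hl := h.length
  simp only [record, wp, NExp.Ok, NExp.val, NExp.size, RExp.Ok, RExp.val, RExp.size, BExp.Ok,
    BExp.val, BExp.size, h.inN_zero, h5, h6, h10, h1, true_and, and_true]
  exact ⟨by omega, fun hv => ⟨by omega, by omega, by omega, hgood hv⟩,
    fun hv => hvoid (not_le.1 hv)⟩

/-- The pairs `(x, a)` such that the point `x` of the top door of the cell `c` below line `k`
can be reached from `a`. -/
def colReach (q p : ℕ → Point d) (r : ℝ) (k c : ℕ) : Set (ℝ × ℝ) :=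
  {z | HReach q p r z.2 k c z.1}

/-- The pairs `(y, a)` such that the point `y` of the right door before the cell `c` above line
`k` can be reached from `a`. -/
def rowReach (q p : ℕ → Point d) (r : ℝ) (k c : ℕ) : Set (ℝ × ℝ) :=
  {z | VReach q p r k (HReach q p r z.2 k) c z.1}

/-- The recursion for reachability is literally the lane recursion. A path that comes through the
left door may leave at any point of the top door, so of these entrants only the starts matter. -/
theorem colReach_succ {q p : ℕ → Point d} {r lo hi : ℝ} {k c : ℕ}
    (h : ∀ x, HDoor q p r (k + 1) c x ↔ lo ≤ x ∧ x ≤ hi) :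
    colReach q p r (k + 1) c =
      laneNext lo hi (colReach q p r k c) {a | ∃ y, (y, a) ∈ rowReach q p r k c} := by
  ext ⟨x, a⟩
  simp only [colReach, laneNext, rowReach, Set.mem_ofPred_eq, ← h]
  rfl

theorem rowReach_succ {q p : ℕ → Point d} {r lo hi : ℝ} {k c : ℕ}
    (h : ∀ x, VDoor q p r k (c + 1) x ↔ lo ≤ x ∧ x ≤ hi) :
    rowReach q p r k (c + 1) =
      laneNext lo hi (rowReach q p r k c) {a | ∃ x, (x, a) ∈ colReach q p r k c} := by
  ext ⟨x, a⟩
  simp only [colReach, laneNext, rowReach, Set.mem_ofPred_eq, ← h]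
  rfl

theorem rowReach_one {q p : ℕ → Point d} {r : ℝ} {k : ℕ} : rowReach q p r k 1 = ∅ := by
  ext ⟨y, a⟩
  simp only [rowReach, Set.mem_ofPred_eq, Set.mem_empty_iff_false, iff_false]
  rintro ⟨-, ⟨y', -, h⟩ | ⟨x, h⟩⟩
  · exact h
  · exact absurd h.door.1 (by norm_num)

/-- The entries of the buffer at address `b` are intervals that are best possible for line `k`
in the columns before `c`. -/
structure IsBuffer (q p : ℕ → Point d) (r : ℝ) (k c : ℕ) (b len : ℕ) (f : ℕ → ℝ) : Prop where
  sound : ∀ j < len, ∃ c' x, 1 ≤ c' ∧ c' < c ∧ (x, f (b + 2 * j)) ∈ colReach q p r k c' ∧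
    f (b + 2 * j + 1) = c' + x
  complete : ∀ c' < c, ∀ x a, (x, a) ∈ colReach q p r k c' →
    ∃ j < len, f (b + 2 * j) ≤ a ∧ c' + x ≤ f (b + 2 * j + 1)
  sorted : ∀ j j', j < j' → j' < len → f (b + 2 * j + 1) ≤ f (b + 2 * j' + 1)

theorem IsBuffer.congr {q p : ℕ → Point d} {r : ℝ} {k c b b' len : ℕ} {f g : ℕ → ℝ}
    (h : IsBuffer q p r k c b len f) (hg : ∀ j < 2 * len, g (b' + j) = f (b + j)) :
    IsBuffer q p r k c b' len g := by
  have h0 : ∀ j < len, g (b' + 2 * j) = f (b + 2 * j) := fun j hj => hg _ (by omega)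
  have h1 : ∀ j < len, g (b' + 2 * j + 1) = f (b + 2 * j + 1) := fun j hj =>
    hg (2 * j + 1) (by omega)
  refine ⟨fun j hj => ?_, fun c' hc' x a hx => ?_, fun j j' hj hj' => ?_⟩
  · rw [h0 j hj, h1 j hj]
    exact h.sound j hj
  · obtain ⟨j, hj, h'⟩ := h.complete c' hc' x a hx
    exact ⟨j, hj, by rwa [h0 j hj, h1 j hj]⟩
  · rw [h1 j (hj.trans hj'), h1 j' hj']
    exact h.sorted j j' hj hj'

theorem IsBuffer.empty (q p : ℕ → Point d) (r : ℝ) (k b : ℕ) (f : ℕ → ℝ) :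
    IsBuffer q p r k 1 b 0 f := by
  refine ⟨fun j hj => by omega, fun c' hc' x a hx => ?_, fun j j' _ hj' => by omega⟩
  have : 1 ≤ c' := hx.door.1
  omega

/-- With `v` the least start in the column and `hi` the right end of its door, `[v, c + hi]`
contains every interval ending in this column. -/
theorem IsBuffer.push {q p : ℕ → Point d} {r : ℝ} {k c b len : ℕ} {f g : ℕ → ℝ}
    (h : IsBuffer q p r k c b len f) (hg : ∀ j < 2 * len, g (b + j) = f (b + j)) {v hi : ℝ}
    (hv : g (b + 2 * len) = v) (hh : g (b + 2 * len + 1) = c + hi) (hc : 1 ≤ c)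
    (hs : (hi, v) ∈ colReach q p r k c)
    (hb : ∀ x a, (x, a) ∈ colReach q p r k c → v ≤ a ∧ x ≤ hi) :
    IsBuffer q p r k (c + 1) b (len + 1) g := by
  replace h := h.congr hg
  refine ⟨fun j hj => ?_, fun c' hc' x a hx => ?_, fun j j' hj hj' => ?_⟩
  · rcases (Nat.lt_succ_iff.1 hj).eq_or_lt with rfl | hj
    · exact ⟨c, hi, hc, by omega, by rwa [hv], hh⟩
    · obtain ⟨c', x, h1, h2, h3⟩ := h.sound j hj
      exact ⟨c', x, h1, by omega, h3⟩
  · rcases (Nat.lt_succ_iff.1 hc').eq_or_lt with rfl | hc'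
    · obtain ⟨h1, h2⟩ := hb x a hx
      exact ⟨len, by omega, by rwa [hv], by rw [hh]; linarith⟩
    · obtain ⟨j, hj, h'⟩ := h.complete c' hc' x a hx
      exact ⟨j, by omega, h'⟩
  · rcases (Nat.lt_succ_iff.1 hj').eq_or_lt with rfl | hj'
    -- Intervals of earlier columns end at or before the vertex `c`, so appending column by column
    -- keeps the buffer sorted by right ends.
    · obtain ⟨c', x, h1, h2, h3, h4⟩ := h.sound j hj
      have h5 := h3.door.2.1.2
      have h6 := hs.door.2.1.1
      have : (c' : ℝ) + 1 ≤ c := by exact_mod_cast h2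
      rw [hh, h4]
      dsimp only at h5 h6
      linarith
    · exact h.sorted j j' hj hj'

theorem IsBuffer.skip {q p : ℕ → Point d} {r : ℝ} {k c b len : ℕ} {f g : ℕ → ℝ}
    (h : IsBuffer q p r k c b len f) (hg : ∀ j < 2 * len, g (b + j) = f (b + j))
    (hb : ∀ x a, (x, a) ∉ colReach q p r k c) : IsBuffer q p r k (c + 1) b len g := by
  replace h := h.congr hg
  refine ⟨fun j hj => ?_, fun c' hc' x a hx => ?_, h.sorted⟩
  · obtain ⟨c', x, h1, h2, h3⟩ := h.sound j hj
    exact ⟨c', x, h1, by omega, h3⟩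
  · rcases (Nat.lt_succ_iff.1 hc').eq_or_lt with rfl | hc'
    · exact absurd hx (hb x a)
    · exact h.complete c' hc' x a hx

/-- Process the current cell. -/
def cell (d : ℕ) : Cmd :=
  hdoor d ;; selectRow ;; laneOut 2 ;; selectCol ;; laneOut 13 ;; laneStep ;; laneOut 10 ;;
  record ;; vdoor d ;; .setR 2 (.reg 13) ;; selectRow ;; laneStep

/-- The real cells that are changed by processing the column `c`. -/
def cellArea (n ℓ c : ℕ) : Set ℕ :=
  {x | 2 * n ≤ x ∧ (x < 6 * n ∨ colBase n ℓ c ≤ x ∧ x < colBase n ℓ c + 2 * (ℓ + 1))}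

/-- The new column lane depends on the old row lane and conversely. Both best values are therefore
loaded, into `rreg 2` and `rreg 13`, before either lane moves. The interval is recorded from the new
column lane, while `hi` of the top door is still in `rreg 1`. -/
theorem wp_cell (h : Setup T S ℓ r m) {s : Store} {i k c : ℕ} (h3 : s.nreg 3 = i)
    (h4 : s.nreg 4 = k + 1) (h5 : s.nreg 5 = c) (h12 : s.rreg 12 = r)
    (h11 : s.rreg 11 = T.card + 1) (hi : 1 ≤ i) (hik : i + k ≤ S.card) (hkl : k + 1 ≤ ℓ)
    (hc : 1 ≤ c) (hcn : c < T.card) (h6 : s.nreg 6 < c)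
    (hrow : LaneAt T.card s (4 * T.card) 0 c (rowReach (S.from i) T.vertex r k c))
    (hcol : LaneAt T.card s (colBase T.card ℓ c) (2 * c) (k + 1)
      (colReach (S.from i) T.vertex r k c))
    (hbuf : IsBuffer (S.from i) T.vertex r (k + 1) c (2 * T.card) (s.nreg 6) s.rmem)
    {Q : Store → ℕ → Prop}
    (hQ : ∀ s' t, Keeps {6, 10, 11, 12, 13, 14, 15, 16} {0, 1, 2, 3, 4, 5, 6, 10, 13}
        {0, 1, 2 * c, 2 * c + 1} (cellArea T.card ℓ c) s s' →
      LaneAt T.card s' (4 * T.card) 0 (c + 1) (rowReach (S.from i) T.vertex r k (c + 1)) →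
      LaneAt T.card s' (colBase T.card ℓ c) (2 * c) (k + 2)
        (colReach (S.from i) T.vertex r (k + 1) c) →
      IsBuffer (S.from i) T.vertex r (k + 1) (c + 1) (2 * T.card) (s'.nreg 6) s'.rmem →
      s'.nreg 6 < c + 1 →
      t + 100 * (laneSize s' (2 * c) + laneSize s' 0) ≤
        100 * (laneSize s (2 * c) + laneSize s 0) + (200 * (d + 1) + 3000) → Q s' t) :
    wp m (cell d) s Q := by
  have hb := h.bounds
  have hcm := h.cells_le
  have hcb := h.colBase_le hcn
  have h6n : 6 * T.card + 2 * (ℓ + 1) ≤ colBase T.card ℓ c := by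
    have := colBase_add_le (n := T.card) (ℓ := ℓ) (c := 0) hc
    simpa [colBase] using this
  unfold cell
  simp only [wp.eq_6]
  refine wp_hdoor h h3 h4 h5 h12 hi (by simpa using hik) hkl hc hcn ?_
  intro s₁ t₁ k₁ hd₁ ht₁
  refine wp_selectRow h ?_
  have row₁ : LaneAt T.card s₁ (4 * T.card) 0 c (rowReach (S.from i) T.vertex r k c) :=
    hrow.congr (k₁.nmem _ (by simp)) (k₁.nmem _ (by simp)) fun _ _ => k₁.rmem _ (by simp)
  have col₁ : LaneAt T.card s₁ (colBase T.card ℓ c) (2 * c) (k + 1)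
      (colReach (S.from i) T.vertex r k c) :=
    hcol.congr (k₁.nmem _ (by simp)) (k₁.nmem _ (by simp)) fun _ _ => k₁.rmem _ (by simp)
  refine wp_laneOut (N := T.card) hcm (b := 4 * T.card) (a := 0) (by simp) (by simp) (by exact row₁)
    (by omega) (by omega) ?_
  intro v hv
  refine wp_selectCol h (c := c) (by simp [k₁.nreg 5 (by simp), h5]) hcn ?_
  refine wp_laneOut (N := T.card) hcm (b := colBase T.card ℓ c) (a := 2 * c) (by simp) (by simp)
    (by exact col₁) (by omega) (by omega) ?_
  intro v' hv'
  refine wp_laneStep (N := T.card) (b := colBase T.card ℓ c) (a := 2 * c) (cap := k + 1)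
    (lo := s₁.rreg 0) (hi := s₁.rreg 1) hcm (by simp) (by simp) (by omega) (by omega)
    (by simp [k₁.rreg 11 (by simp), h11]) (by exact col₁) (by simp) (by simp) (by simpa using hv) ?_
  rw [← colReach_succ hd₁]
  intro s₂ t₂ col₂ k₂ ht₂
  have K₂ : Keeps {6, 10, 11, 12, 13, 14, 15, 16} {0, 1, 2, 3, 4, 5, 6, 10, 13}
      {0, 1, 2 * c, 2 * c + 1} (cellArea T.card ℓ c) s s₂ := by
    refine ((((((k₁.mono ?_ ?_ ?_ ?_).setN ?_ _).setN ?_ _).setR ?_ _).setN ?_ _).setN ?_ _).setR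
      ?_ _ |>.trans (k₂.mono ?_ ?_ ?_ ?_) <;> try grind
    rintro x ⟨hx1, hx2⟩
    exact ⟨by omega, .inr ⟨hx1, by omega⟩⟩
  have row₂ : LaneAt T.card s₂ (4 * T.card) 0 c (rowReach (S.from i) T.vertex r k c) :=
    row₁.congr (k₂.nmem _ (by simp; omega)) (k₂.nmem _ (by simp; omega)) fun x hx =>
      k₂.rmem _ (by simp; omega)
  have e6 : s₂.nreg 6 = s.nreg 6 := by
    rw [k₂.nreg 6 (by simp)]
    simp [k₁.nreg 6 (by simp)]
  have buf₂ : ∀ j < 2 * s.nreg 6, s₂.rmem (2 * T.card + j) = s.rmem (2 * T.card + j) := by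
    intro j hj
    rw [k₂.rmem _ (by simp; omega)]
    exact k₁.rmem _ (by simp)
  have hi₂ : s₂.rreg 1 = s₁.rreg 1 := by simp [k₂.rreg 1 (by simp)]
  refine wp_laneOut (N := T.card) hcm (b := colBase T.card ℓ c) (a := 2 * c)
    (by simp [k₂.nreg 10 (by simp)]) (by simp [k₂.nreg 11 (by simp)]) (by exact col₂)
    (by omega) (by omega) ?_
  intro v'' hv''
  -- The rest of the program, shared by the branches of `record` with and without a new interval.
  have finish : ∀ s₃ t₃, t₃ ≤ 32 →
      Keeps {6, 10, 11, 12, 13, 14, 15, 16} {0, 1, 2, 3, 4, 5, 6, 10, 13}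
        {0, 1, 2 * c, 2 * c + 1} (cellArea T.card ℓ c) s s₃ →
      Keeps {6} {10} ∅ (Set.Ico (2 * T.card) (4 * T.card)) s₂ s₃ →
      IsBuffer (S.from i) T.vertex r (k + 1) (c + 1) (2 * T.card) (s₃.nreg 6) s₃.rmem →
      s₃.nreg 6 < c + 1 → wp m (vdoor d ;; .setR 2 (.reg 13) ;; selectRow ;; laneStep) s₃
        fun s' t => Q s' (t₁ + (6 + (10 + (16 + (10 + (t₂ + (10 + (t₃ + t)))))))) := by
    intro s₃ t₃ ht₃ K₃ k₃ buf₃ hlt₃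
    simp only [wp.eq_6]
    refine wp_vdoor h (i := i) (k := k) (c := c) (by rw [K₃.nreg 3 (by simp), h3])
      (by rw [K₃.nreg 4 (by simp), h4]) (by rw [K₃.nreg 5 (by simp), h5])
      (by rw [K₃.rreg 12 (by simp), h12]) hi hik hkl hc hcn ?_
    intro s₄ t₄ k₄ hd₄ ht₄
    simp only [wp.eq_3]
    refine ⟨trivial, ?_⟩
    refine wp_selectRow h ?_
    have row₄ : LaneAt T.card s₄ (4 * T.card) 0 c (rowReach (S.from i) T.vertex r k c) :=
      (row₂.congr (k₃.nmem _ (by simp)) (k₃.nmem _ (by simp)) fun x hx =>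
        k₃.rmem _ (by simp)).congr (k₄.nmem _ (by simp)) (k₄.nmem _ (by simp)) fun x hx =>
        k₄.rmem _ (by simp)
    have h13 : s₄.rreg 13 = v' := by
      rw [k₄.rreg 13 (by simp), k₃.rreg 13 (by simp), k₂.rreg 13 (by simp)]
      simp
    refine wp_laneStep (N := T.card) (b := 4 * T.card) (a := 0) (cap := c)
      (lo := s₄.rreg 0) (hi := s₄.rreg 1) (E := {a | ∃ x, (x, a) ∈ colReach
          (S.from i) T.vertex r k c})
      hcm (by simp) (by simp) (by omega) (by omega)
      (by simp [k₄.rreg 11 (by simp), K₃.rreg 11 (by simp), h11]) (by exact row₄) (by simp)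
          (by simp)
      (by simpa [h13] using hv') ?_
    rw [← rowReach_succ hd₄]
    intro s₅ t₅ row₅ k₅ ht₅
    have n₅ : ∀ x, 2 ≤ x → s₅.nmem x = s₂.nmem x := fun x hx => by
      rw [k₅.nmem x (by simp; omega)]
      exact (k₄.nmem x (by simp)).trans (k₃.nmem x (by simp))
    have n₂ : ∀ x, x ≤ 1 → s₂.nmem x = s.nmem x := fun x hx => by
      rw [k₂.nmem x (by simp; omega)]
      exact k₁.nmem x (by simp)
    have n₄ : ∀ x, s₄.nmem x = s₂.nmem x := fun x =>
      (k₄.nmem x (by simp)).trans (k₃.nmem x (by simp))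
    refine hQ s₅ _ ?_ row₅ ?_ ?_ ?_ ?_
    · refine ((((K₃.trans (k₄.mono ?_ ?_ ?_ ?_)).setR ?_ _).setN ?_ _).setN ?_ _).trans
        (k₅.mono ?_ ?_ ?_ ?_) <;> try grind
      rintro x ⟨hx1, hx2⟩
      exact ⟨by omega, .inl (by omega)⟩
    · refine col₂.congr (n₅ _ (by omega)) (n₅ _ (by omega)) fun x hx => ?_
      rw [k₅.rmem _ (by simp; omega)]
      exact (k₄.rmem _ (by simp)).trans (k₃.rmem _ (by simp; omega))
    · have : s₅.nreg 6 = s₃.nreg 6 := by simp [k₅.nreg 6 (by simp), k₄.nreg 6 (by simp)]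
      rw [this]
      refine buf₃.congr fun j hj => ?_
      rw [k₅.rmem _ (by simp; omega)]
      exact k₄.rmem _ (by simp)
    · simpa [k₅.nreg 6 (by simp), k₄.nreg 6 (by simp)] using hlt₃
    · have e1 := n₅ (2 * c) (by omega)
      have e2 := n₅ (2 * c + 1) (by omega)
      have e3 := n₂ 0 (by omega)
      have e4 := n₂ 1 (by omega)
      have e5 := n₄ 0
      have e7 := n₄ 1
      have e8 := k₁.nmem (2 * c) (by simp)
      have e9 := k₁.nmem (2 * c + 1) (by simp)
      simp only [laneSize, RExp.size] at ht₂ ht₅ ⊢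
      rw [e1, e2]
      simp only [zero_add] at ht₅ ⊢
      rw [e5, e7, e3, e4] at ht₅
      rw [e8, e9] at ht₂
      omega
  refine wp_record h (c := c) (k := s.nreg 6) (v := v'') (hi := s₁.rreg 1) ?_ (by simp [e6])
    (by simp) (by simp [hi₂]) (by omega) (fun hle => ?_) (fun hgt => ?_)
  · simp [K₂.nreg 5 (by simp), h5]
  · refine finish _ _ le_rfl ?_ ?_ ?_ ?_
    · refine (((K₂.setR (by simp) _).setN (by simp) _).storeR ?_ _).storeR ?_ _
      · exact ⟨by omega, .inl (by omega)⟩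
      · exact ⟨by omega, .inl (by omega)⟩
    · refine (((((Keeps.refl _ _ _ _ s₂).setR ?_ _).setN ?_ _).storeR ?_ _).storeR ?_ _)
      · simp
      · simp
      · simp; omega
      · simp; omega
    · obtain ⟨x, hx⟩ := hv''.1 hle
      have hdoor := (hd₁ x).1 hx.door
      -- The best start reaches some `x` of the door; from there the right end `hi` is reached by
      -- monotonicity.
      simp only [Function.update_self]
      refine hbuf.push (v := v'') (hi := s₁.rreg 1) (fun j hj => ?_) (by simp) (by simp) hc ?_ ?_
      · rw [Function.update_of_ne (by omega), Function.update_of_ne (by omega)]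
        exact buf₂ j hj
      · exact hx.mono hdoor.2 ((hd₁ _).2 ⟨hdoor.1.trans hdoor.2, le_rfl⟩)
      · exact fun y a hy => ⟨hv''.2 a ⟨y, hy⟩, ((hd₁ y).1 hy.door).2⟩
    · simp
      omega
  · refine finish _ _ (by norm_num) (K₂.setR (by simp) _) ((Keeps.refl _ _ _ _ s₂).setR ?_ _) ?_ ?_
    · simp
    · simp only [e6]
      refine hbuf.skip buf₂ fun x a hx => ?_
      -- A reachable point of this door would have a start of at most `n`, so a void best value
      -- means that there is none.
      have h1 := hv''.2 a ⟨x, hx⟩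
      have h2 := hx.matched.2.1
      have h3 := hx.door.2.1.2
      have h4 : (c : ℝ) + 1 ≤ T.card := by exact_mod_cast hcn
      dsimp only at h2 h3
      linarith
    · simp [e6]
      omega

end Cell

/-! ### Evaluating a reference curve -/

/-- The set covered by all intervals of the trajectory that match the curve up to line `k`. -/
def reachCover {d : ℕ} (q p : ℕ → Point d) (r : ℝ) (n k : ℕ) : Set ℝ :=
  {x | ∃ c < n, ∃ z ∈ colReach q p r k c, x ∈ Set.Icc z.2 (c + z.1)}

theorem IsBuffer.cover_eq {d : ℕ} {q p : ℕ → Point d} {r : ℝ} {n k b len : ℕ} {f : ℕ → ℝ}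
    (h : IsBuffer q p r k n b len f) :
    {x | ∃ j < len, x ∈ Set.Icc (f (b + 2 * j)) (f (b + 2 * j + 1))} = reachCover q p r n k := by
  ext x
  constructor
  · rintro ⟨j, hj, hx⟩
    obtain ⟨c, y, -, h2, h3, h4⟩ := h.sound j hj
    exact ⟨c, h2, _, h3, by rwa [h4] at hx⟩
  · rintro ⟨c, hc, ⟨y, a⟩, hz, hx1, hx2⟩
    obtain ⟨j, hj, h1, h2⟩ := h.complete c hc y a hz
    exact ⟨j, hj, h1.trans hx1, hx2.trans h2⟩

/-- The machine contains the tables of the universe and of the covered intervals. -/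
structure Tables (m : Machine) (lenU lenC e : ℕ) : Prop where
  tableU : IsTable m 3 4 3 lenU
  tableC : IsTable m 5 6 4 lenC
  maxU : 2 * lenU ≤ m.maxInt
  maxC : 2 * lenC ≤ m.maxInt
  ltU : lenU < 2 ^ e
  ltC : lenC < 2 ^ e

/-- The number of newly covered intervals for the reference curve with `k` vertices from the
vertex `i` of `S`. -/
noncomputable def pairValue {d : ℕ} (T S : Curve d) (r : ℝ) (m : Machine) (lenU lenC i k : ℕ) : ℕ :=
  countIn m 3 4 lenU (reachCover (S.from i) T.vertex r T.card k) -
    countIn m 5 6 lenC (reachCover (S.from i) T.vertex r T.card k)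

/-- The reference curves considered up to the start `i` and the number `k` of vertices. -/
def pairsUpTo (cardS ℓ i k : ℕ) : Set (ℕ × ℕ) :=
  {z | 1 ≤ z.1 ∧ 1 ≤ z.2 ∧ z.2 ≤ ℓ ∧ z.1 + (z.2 - 1) ≤ cardS ∧ (z.1 < i ∨ z.1 = i ∧ z.2 ≤ k)}

/-- The store contains an optimal pathlet for some reference curve, and its value. -/
def HasOutput {d : ℕ} (T S : Curve d) (ℓ : ℕ) (r : ℝ) (m : Machine) (lenU lenC : ℕ)
    (s : Store) : Prop :=
  ∃ i k, 1 ≤ i ∧ 1 ≤ k ∧ k ≤ ℓ ∧ i + (k - 1) ≤ S.card ∧ s.nreg 0 = i ∧ s.nreg 1 = i + (k - 1) ∧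
    s.nreg 2 < T.card ∧ IsBuffer (S.from i) T.vertex r k T.card 0 (s.nreg 2) s.rmem ∧
    s.nreg 7 = pairValue T S r m lenU lenC i k

/-- The output of the store is the best for the reference curves in `P`. -/
def HasBest {d : ℕ} (T S : Curve d) (ℓ : ℕ) (r : ℝ) (m : Machine) (lenU lenC : ℕ)
    (P : Set (ℕ × ℕ)) (s : Store) : Prop :=
  (∀ z ∈ P, pairValue T S r m lenU lenC z.1 z.2 ≤ s.nreg 7) ∧
    (HasOutput T S ℓ r m lenU lenC s ∨ s.nreg 7 = 0 ∧ P = ∅)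

theorem HasBest.congr {d : ℕ} {T S : Curve d} {ℓ : ℕ} {r : ℝ} {m : Machine} {lenU lenC : ℕ}
    {P : Set (ℕ × ℕ)} {s s' : Store} (h : HasBest T S ℓ r m lenU lenC P s)
    (h0 : s'.nreg 0 = s.nreg 0) (h1 : s'.nreg 1 = s.nreg 1) (h2 : s'.nreg 2 = s.nreg 2)
    (h7 : s'.nreg 7 = s.nreg 7) (hr : ∀ x < 2 * T.card, s'.rmem x = s.rmem x) :
    HasBest T S ℓ r m lenU lenC P s' := by
  obtain ⟨hP, h⟩ := h
  refine ⟨fun z hz => h7 ▸ hP z hz, h.imp ?_ fun h => h7 ▸ h⟩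
  rintro ⟨i, k, e1, e2, e3, e4, e5, e6, e7, e8, e9⟩
  refine ⟨i, k, e1, e2, e3, e4, h0 ▸ e5, h1 ▸ e6, h2 ▸ e7, ?_, h7 ▸ e9⟩
  rw [h2]
  exact e8.congr fun j hj => hr _ (by omega)

/-- Copy the buffer to the output. -/
def copy : Cmd :=
  .setN 22 (.const 0) ;;
  .loop (.ltN (.reg 22) (.mul (.const 2) (.reg 6)))
    (.storeR (.reg 22) (.mem (.add (.mul (.const 2) (.inp 0)) (.reg 22))) ;;
      .setN 22 (.add (.reg 22) (.const 1)))

/-- Compute the value of the current reference curve and update the output. -/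
def evaluate : Cmd :=
  sweep 3 4 3 ;; .setN 9 (.reg 8) ;; sweep 5 6 4 ;; .setN 9 (.sub (.reg 9) (.reg 8)) ;;
  .ite (.ltN (.reg 9) (.reg 7)) .skip
    (.setN 7 (.reg 9) ;; .setN 0 (.reg 3) ;; .setN 1 (.add (.reg 3) (.sub (.reg 4) (.const 1))) ;;
      .setN 2 (.reg 6) ;; copy)

section Row

variable {d : ℕ} {T S : Curve d} {ℓ : ℕ} {r : ℝ} {m : Machine} {lenU lenC e : ℕ}

theorem wp_copy (h : Setup T S ℓ r m) {s : Store} (h6 : s.nreg 6 < T.card)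
    {Q : Store → ℕ → Prop}
    (hQ : ∀ s' t, Keeps {22} ∅ ∅ (Set.Iio (2 * T.card)) s s' →
      (∀ j < 2 * s.nreg 6, s'.rmem j = s.rmem (2 * T.card + j)) →
      t ≤ 50 * T.card → Q s' t) : wp m copy s Q := by
  have hb := h.bounds
  have hcm := h.cells_le
  have hl := h.length
  simp only [copy, wp, NExp.Ok, NExp.val, NExp.size]
  refine ⟨by omega, ?_⟩
  refine wp_loop (I := fun s' u => ∃ k, s'.nreg 22 = k ∧ k ≤ 2 * s.nreg 6 ∧
      Keeps {22} ∅ ∅ (Set.Iio (2 * T.card)) s s' ∧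
      (∀ j < k, s'.rmem j = s.rmem (2 * T.card + j)) ∧ u = 20 * (2 * s.nreg 6 - k)) ?_ ?_
      (u := 20 * (2 * s.nreg 6)) ?_ ?_
  · rintro s' u ⟨k, hk, hle, hK, -⟩
    simp [hK.nreg 6 (by simp)]
    omega
  · rintro s' u ⟨k, hk, hle, hK, hj, rfl⟩ hlt
    simp only [BExp.val, NExp.val, hk, hK.nreg 6 (by simp)] at hlt
    simp only [wp, NExp.Ok, NExp.val, NExp.size, RExp.Ok, RExp.val, RExp.size, BExp.size, hk,
      h.inN_zero, true_and]
    refine ⟨by omega, by omega, .intro (20 * (2 * s.nreg 6 - (k + 1)))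
      ⟨k + 1, by simp, by omega, ?_, ?_, rfl⟩ (by omega)⟩
    · exact (hK.storeR (by simp; omega) _).setN (by simp) _
    · intro j hj'
      rcases (Nat.lt_succ_iff.1 hj').eq_or_lt with rfl | hj'
      · simp only [Function.update_self]
        exact hK.rmem _ (by simp)
      · simp only
        rw [Function.update_of_ne hj'.ne]
        exact hj j hj'
  · exact ⟨0, by simp, by omega, (Keeps.refl _ _ _ _ s).setN (by simp) _,
      fun j hj => by omega, rfl⟩
  · rintro s' t u ⟨k, hk, hle, hK, hj, rfl⟩ hn ht
    simp only [BExp.val, NExp.val, hk, hK.nreg 6 (by simp), not_lt] at hn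
    refine hQ s' _ hK (fun j hj' => hj j (by omega)) ?_
    simp only [BExp.size, NExp.size] at ht
    omega

/-- The two sweeps compute the minuend and the subtrahend of `pairValue`. The output is replaced
also on ties, so the first curve is stored even if its value is `0`. -/
theorem wp_evaluate (h : Setup T S ℓ r m) (hU : Tables m lenU lenC e) {s : Store} {i k : ℕ}
    (h3 : s.nreg 3 = i) (h4 : s.nreg 4 = k) (h11 : s.rreg 11 = T.card + 1) (hi : 1 ≤ i)
    (hk : 1 ≤ k) (hkl : k ≤ ℓ) (hik : i + (k - 1) ≤ S.card) (h6 : s.nreg 6 < T.card)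
    (hbuf : IsBuffer (S.from i) T.vertex r k T.card (2 * T.card) (s.nreg 6) s.rmem)
    (hbest : HasBest T S ℓ r m lenU lenC (pairsUpTo S.card ℓ i (k - 1)) s)
    {Q : Store → ℕ → Prop}
    (hQ : ∀ s' t, Keeps {0, 1, 2, 7, 8, 9, 17, 18, 19, 20, 21, 22} {7, 8, 9, 10} ∅
        (Set.Iio (2 * T.card)) s s' →
      HasBest T S ℓ r m lenU lenC (pairsUpTo S.card ℓ i k) s' →
      t ≤ 1000 * (e + 1) * T.card + 70 * T.card → Q s' t) :
    wp m evaluate s Q := by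
  have hb := h.bounds
  have hcm := h.cells_le
  have hST := h.card_le
  have hl := h.length
  have hpairs : ∀ z ∈ pairsUpTo S.card ℓ i k, z ∈ pairsUpTo S.card ℓ i (k - 1) ∨ z = (i, k) := by
    rintro ⟨i', k'⟩ ⟨z1, z2, z3, z4, z5⟩
    rcases z5 with z5 | ⟨z5, z6⟩
    · exact .inl ⟨z1, z2, z3, z4, .inl z5⟩
    · dsimp only at z5 z6
      subst z5
      rcases z6.eq_or_lt with rfl | z6
      · exact .inr rfl
      · exact .inl ⟨z1, z2, z3, z4, .inr ⟨rfl, by dsimp only; omega⟩⟩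
  have hab : ∀ j < s.nreg 6, s.rmem (2 * T.card + 2 * j) ≤ s.rmem (2 * T.card + 2 * j + 1) := by
    intro j hj
    obtain ⟨c, x, -, -, h1, h2⟩ := hbuf.sound j hj
    rw [h2]
    exact h1.matched.2.1
  have hbn : ∀ j < s.nreg 6, s.rmem (2 * T.card + 2 * j + 1) < s.rreg 11 := by
    intro j hj
    obtain ⟨c, x, -, h0, h1, h2⟩ := hbuf.sound j hj
    have h3 := h1.door.2.1.2
    have h4 : (c : ℝ) + 1 ≤ T.card := by exact_mod_cast h0
    dsimp only at h3
    rw [h2, h11]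
    linarith
  unfold evaluate
  simp only [wp.eq_6]
  refine wp_sweep hcm (by omega) hU.tableU hU.maxU hU.ltU h.inN_zero (by omega) (by omega)
    (by rw [h11]; positivity) hab hbn hbuf.sorted ?_
  rw [hbuf.cover_eq]
  intro s₁ t₁ k₁ hU₁ ht₁
  simp only [wp.eq_2]
  refine ⟨trivial, ?_⟩
  have e6 : s₁.nreg 6 = s.nreg 6 := k₁.nreg 6 (by simp)
  have e11 : s₁.rreg 11 = s.rreg 11 := k₁.rreg 11 (by simp)
  have er : s₁.rmem = s.rmem := funext fun x => k₁.rmem x (by simp)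
  refine wp_sweep (n := T.card) hcm (by omega) hU.tableC hU.maxC hU.ltC h.inN_zero (by omega)
    (by simp [e6]; omega) (by simp [e11, h11]; positivity) (by simpa [e6, er] using hab)
    (by simpa [e6, er, e11] using hbn) (by simpa [e6, er] using hbuf.sorted) ?_
  intro s₂ t₂ k₂ hC₂ ht₂
  simp only [ne_eq, Nat.reduceEqDiff, not_false_eq_true, Function.update_of_ne, e6, er] at hC₂
  rw [hbuf.cover_eq] at hC₂
  have e9 : s₂.nreg 9 = s₁.nreg 8 := by simp [k₂.nreg 9 (by simp)]
  have hval : s₂.nreg 9 - s₂.nreg 8 = pairValue T S r m lenU lenC i k := by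
    rw [e9, hU₁, hC₂]
    rfl
  have hle : s₂.nreg 9 ≤ lenU := by
    rw [e9, hU₁]
    exact countIn_le _ _ _ _ _
  have hUm := hU.maxU
  have K₂ : Keeps {0, 1, 2, 7, 8, 9, 17, 18, 19, 20, 21, 22} {7, 8, 9, 10} ∅
      (Set.Iio (2 * T.card)) s s₂ := by
    refine ((k₁.mono ?_ ?_ ?_ ?_).setN ?_ _).trans (k₂.mono ?_ ?_ ?_ ?_) <;>
      simp [Set.insert_subset_iff]
  have hN : ∀ x, x ∉ ({8, 9, 17, 18, 19, 20, 21} : Set ℕ) → s₂.nreg x = s.nreg x := by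
    intro x hx
    simp at hx
    simp [k₂.nreg x (by simp; omega), k₁.nreg x (by simp; omega), hx]
  have er₂ : s₂.rmem = s.rmem := funext fun x => (k₂.rmem x (by simp)).trans (k₁.rmem x (by simp))
  have ht : t₁ + t₂ ≤ 1000 * (e + 1) * T.card := by
    simp only [ne_eq, Nat.reduceEqDiff, not_false_eq_true, Function.update_of_ne, e6] at ht₂
    have : 500 * (e + 1) * (s.nreg 6 + 1) ≤ 500 * (e + 1) * T.card := Nat.mul_le_mul_left _ h6
    calc _ ≤ 500 * (e + 1) * T.card + 500 * (e + 1) * T.card := by omega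
      _ = _ := by ring
  simp only [wp, NExp.Ok, NExp.val, NExp.size, BExp.Ok, BExp.val, BExp.size, hval,
    Function.update_self, ne_eq, Nat.reduceEqDiff, not_false_eq_true, Function.update_of_ne,
    true_and, hN 7 (by simp), hN 3 (by simp), hN 4 (by simp), hN 6 (by simp), h3, h4,
    OfNat.ofNat_ne_zero, OfNat.ofNat_ne_one]
  obtain ⟨hb1, hb2⟩ := hbest
  refine ⟨by omega, fun hlt => ?_, fun hge => ⟨by omega, ?_⟩⟩
  · refine hQ _ _ (K₂.setN (by simp) _) ⟨fun z hz => ?_, .inl ?_⟩ (by have := h.two_le; omega)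
    · simp only [ne_eq, Nat.reduceEqDiff, not_false_eq_true, Function.update_of_ne, hN 7 (by simp)]
      rcases hpairs z hz with hz | rfl
      · exact hb1 z hz
      · exact hlt.le
    · obtain ⟨i', k', e1, e2, e3, e4, e5, e6, e7, e8, e9⟩ :=
        hb2.resolve_right fun h => by omega
      refine ⟨i', k', e1, e2, e3, e4, ?_, ?_, ?_, ?_, ?_⟩
      · simpa [hN 0 (by simp)] using e5
      · simpa [hN 1 (by simp)] using e6
      · simpa [hN 2 (by simp)] using e7
      · simpa [hN 2 (by simp), er₂] using e8
      · simpa [hN 7 (by simp)] using e9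
  · refine wp_copy h (by simpa [hN 6 (by simp)] using h6) ?_
    intro s₃ t₃ k₃ hr₃ ht₃
    simp [hN 6 (by simp), er₂] at hr₃
    refine hQ _ _ ?_ ⟨fun z hz => ?_, .inl ⟨i, k, hi, hk, hkl, hik, ?_, ?_, ?_, ?_, ?_⟩⟩ ?_
    · refine (((((K₂.setN ?_ _).setN ?_ _).setN ?_ _).setN ?_ _).setN ?_ _).trans
        (k₃.mono ?_ ?_ ?_ ?_) <;> simp
    · simp [k₃.nreg 7 (by simp)]
      rcases hpairs z hz with hz | rfl
      · exact (hb1 z hz).trans (not_lt.1 hge)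
      · exact le_rfl
    · simp [k₃.nreg 0 (by simp)]
    · simp [k₃.nreg 1 (by simp)]
    · simpa [k₃.nreg 2 (by simp)] using h6
    · simp [k₃.nreg 2 (by simp)]
      exact hbuf.congr fun j hj => by rw [zero_add]; exact hr₃ j hj
    · simp [k₃.nreg 7 (by simp)]
    · have := h.two_le
      omega

/-! ### Processing a row of the free space diagram -/

/-- Processing a cell changes the size of one column lane only; this form updates the total
potential without subtraction of natural numbers. -/
theorem sum_add_eq_of_eq_off {n c : ℕ} {f g : ℕ → ℕ} (hc : c ∈ Finset.Ico 1 n)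
    (h : ∀ c' ∈ Finset.Ico 1 n, c' ≠ c → f c' = g c') :
    ∑ c' ∈ Finset.Ico 1 n, f c' + g c = ∑ c' ∈ Finset.Ico 1 n, g c' + f c := by
  rw [← Finset.add_sum_erase _ f hc, ← Finset.add_sum_erase _ g hc,
    Finset.sum_congr rfl fun c' hc' => h c' (Finset.mem_of_mem_erase hc')
      (Finset.ne_of_mem_erase hc')]
  ring

/-- Process all cells between two lines, and the reference curve that ends at the upper line. -/
def row (d : ℕ) : Cmd :=
  selectRow ;; laneReset (.ofN (.const 0)) (.reg 11) ;; .setN 6 (.const 0) ;; .setN 5 (.const 1) ;;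
  .loop (.ltN (.reg 5) (.inp 0)) (cell d ;; .setN 5 (.add (.reg 5) (.const 1))) ;;
  evaluate

theorem LaneAt.congr_of_keeps {A B C D : Set ℕ} {N : ℝ} {s s' : Store} {b a cap : ℕ}
    {R : Set (ℝ × ℝ)} (h : LaneAt N s b a cap R) (hk : Keeps A B C D s s') (h0 : a ∉ C)
    (h1 : a + 1 ∉ C) (hD : ∀ k < 2 * cap, b + k ∉ D) : LaneAt N s' b a cap R :=
  h.congr (hk.nmem _ h0) (hk.nmem _ h1) fun k hkc => hk.rmem _ (hD k hkc)

theorem Keeps.laneSize_eq {A B C D : Set ℕ} {s s' : Store} (h : Keeps A B C D s s') {a : ℕ}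
    (h0 : a ∉ C) (h1 : a + 1 ∉ C) : laneSize s' a = laneSize s a := by
  rw [laneSize, laneSize, h.nmem _ h0, h.nmem _ h1]

/-- The budget of the loop is a fixed amount per remaining column plus the potential of all column
lanes and of the row lane. The potential of the column lanes is handed on to the next row, so it
appears on both sides of the time bound. The row lane starts void, because nothing crosses the first
vertex of `T`. -/
theorem wp_row (h : Setup T S ℓ r m) (hU : Tables m lenU lenC e) {s : Store} {i k : ℕ}
    (h3 : s.nreg 3 = i) (h4 : s.nreg 4 = k + 1) (h11 : s.rreg 11 = T.card + 1)
    (h12 : s.rreg 12 = r) (hi : 1 ≤ i) (hkl : k + 1 ≤ ℓ) (hik : i + k ≤ S.card)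
    (hcol : ∀ c, 1 ≤ c → c < T.card → LaneAt T.card s (colBase T.card ℓ c) (2 * c) (k + 1)
      (colReach (S.from i) T.vertex r k c))
    (hbest : HasBest T S ℓ r m lenU lenC (pairsUpTo S.card ℓ i k) s)
    {Q : Store → ℕ → Prop}
    (hQ : ∀ (s' : Store) t, s'.nreg 3 = i → s'.nreg 4 = k + 1 → s'.rreg 11 = T.card + 1 →
        s'.rreg 12 = r →
      (∀ c, 1 ≤ c → c < T.card → LaneAt T.card s' (colBase T.card ℓ c) (2 * c) (k + 2)
        (colReach (S.from i) T.vertex r (k + 1) c)) →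
      HasBest T S ℓ r m lenU lenC (pairsUpTo S.card ℓ i (k + 1)) s' →
      t + 100 * ∑ c ∈ Finset.Ico 1 T.card, laneSize s' (2 * c) ≤
        100 * ∑ c ∈ Finset.Ico 1 T.card, laneSize s (2 * c) + 10000 * (d + e + 1) * T.card →
      Q s' t) : wp m (row d) s Q := by
  have hb := h.bounds
  have hcm := h.cells_le
  have hl := h.length
  have h2 := h.two_le
  have h6n : ∀ c, 1 ≤ c → 6 * T.card + 2 * (ℓ + 1) ≤ colBase T.card ℓ c := fun c hc => by
    simpa [colBase] using colBase_add_le (n := T.card) (ℓ := ℓ) (c := 0) hc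
  unfold row
  simp only [wp.eq_6]
  refine wp_selectRow h ?_
  refine wp_laneReset (N := T.card) (b := 4 * T.card) (a := 0) (cap := 1)
    (R := rowReach (S.from i) T.vertex r k 1) hcm (by simp) (by simp) (by omega) (by omega) le_rfl
    (by simp) (fun s' _ hr => by simp [hr]) (fun hle => ?_) (fun x a hx => ?_) ?_
  · simp only [RExp.val, h11] at hle
    linarith
  · rw [rowReach_one] at hx
    exact hx.elim
  intro s₁ t₁ row₁ k₁ sz₁ ht₁
  have K₁ : Keeps {5, 6, 10, 11, 12, 13, 14, 15, 16} {0, 1, 2, 3, 4, 5, 6, 10, 13} {0, 1}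
      (Set.Ico (4 * T.card) (6 * T.card)) s s₁ := by
    refine (((Keeps.refl _ _ _ _ s).setN ?_ _).setN ?_ _).trans (k₁.mono ?_ ?_ ?_ ?_) <;> grind
  simp only [wp.eq_2, NExp.Ok, NExp.val, NExp.size]
  refine ⟨by omega, by omega, ?_⟩
  refine wp_loop (I := fun s' u => ∃ c, s'.nreg 5 = c ∧ 1 ≤ c ∧ c ≤ T.card ∧
      Keeps {5, 6, 10, 11, 12, 13, 14, 15, 16} {0, 1, 2, 3, 4, 5, 6, 10, 13} Set.univ
        (Set.Ici (2 * T.card)) s s' ∧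
      LaneAt T.card s' (4 * T.card) 0 c (rowReach (S.from i) T.vertex r k c) ∧
      (∀ c', 1 ≤ c' → c' < c → LaneAt T.card s' (colBase T.card ℓ c') (2 * c') (k + 2)
        (colReach (S.from i) T.vertex r (k + 1) c')) ∧
      (∀ c', c ≤ c' → c' < T.card → LaneAt T.card s' (colBase T.card ℓ c') (2 * c') (k + 1)
        (colReach (S.from i) T.vertex r k c')) ∧
      IsBuffer (S.from i) T.vertex r (k + 1) c (2 * T.card) (s'.nreg 6) s'.rmem ∧
      s'.nreg 6 < c ∧ u = (T.card - c) * (200 * (d + 1) + 3020) +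
        100 * (∑ c ∈ Finset.Ico 1 T.card, laneSize s' (2 * c) + laneSize s' 0)) ?_ ?_
      (u := (T.card - 1) * (200 * (d + 1) + 3020) +
        100 * (∑ c ∈ Finset.Ico 1 T.card, laneSize s (2 * c) + 1)) ?_ ?_
  · rintro s' u ⟨c, -⟩
    simp only [BExp.Ok, NExp.Ok, h.inN_zero, true_and]
    omega
  · rintro s' u ⟨c, hc5, hc1, hcn, hK, hrow, hdone, htodo, hbuf, h6, rfl⟩ hlt
    simp only [BExp.val, NExp.val, hc5, h.inN_zero] at hlt
    simp only [wp.eq_6]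
    refine wp_cell h (c := c) (by rw [hK.nreg 3 (by simp), h3]) (by rw [hK.nreg 4 (by simp), h4])
      hc5 (by rw [hK.rreg 12 (by simp), h12]) (by rw [hK.rreg 11 (by simp), h11]) hi hik hkl hc1
      hlt h6 hrow (htodo c le_rfl hlt) hbuf ?_
    intro s₂ t₂ k₂ hrow₂ hcol₂ hbuf₂ h6₂ ht₂
    have hlane : ∀ c' cap R, 1 ≤ c' → c' ≠ c → cap ≤ ℓ + 1 →
        LaneAt T.card s' (colBase T.card ℓ c') (2 * c') cap R →
        LaneAt T.card s₂ (colBase T.card ℓ c') (2 * c') cap R := by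
      intro c' cap R h1 hne hcap hL
      refine hL.congr_of_keeps k₂ (by simp; omega) (by simp; omega) ?_
      rintro x hx ⟨-, hx2 | ⟨hx1, hx2⟩⟩
      · have := h6n c' h1
        omega
      · rcases lt_or_gt_of_ne hne with hlt | hlt
        · have := colBase_add_le (n := T.card) (ℓ := ℓ) hlt
          omega
        · have := colBase_add_le (n := T.card) (ℓ := ℓ) hlt
          omega
    have hsum := sum_add_eq_of_eq_off (n := T.card) (c := c)
      (f := fun c => laneSize s₂ (2 * c)) (g := fun c => laneSize s' (2 * c))
      (Finset.mem_Ico.2 ⟨hc1, hlt⟩) (fun c' hc' hne => by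
        rw [Finset.mem_Ico] at hc'
        exact k₂.laneSize_eq (by simp; omega) (by simp; omega))
    have e5 : s₂.nreg 5 = c := by rw [k₂.nreg 5 (by simp), hc5]
    simp only [wp.eq_2, NExp.Ok, NExp.val, NExp.size, e5, true_and]
    refine ⟨by omega, .intro ((T.card - (c + 1)) * (200 * (d + 1) + 3020) +
        100 * (∑ c ∈ Finset.Ico 1 T.card, laneSize s₂ (2 * c) + laneSize s₂ 0))
      ⟨c + 1, by simp, by omega, by omega, ?_, hrow₂, fun c' h1 h2 => ?_, fun c' h1 h2 => ?_, ?_,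
        ?_, rfl⟩ ?_⟩
    · refine (hK.trans (k₂.mono ?_ ?_ ?_ ?_)).setN ?_ _ <;> try grind
      exact fun x hx => hx.1
    · rcases (Nat.lt_succ_iff.1 h2).eq_or_lt with rfl | h2
      · exact hcol₂
      · exact hlane c' _ _ h1 h2.ne (by omega) (hdone c' h1 h2)
    · exact hlane c' _ _ (by omega) (by omega) (by omega) (htodo c' (by omega) h2)
    · simpa using hbuf₂
    · simpa using h6₂
    · have : T.card - c = T.card - (c + 1) + 1 := by omega
      rw [this, add_mul _ 1, one_mul]
      simp only [BExp.size, NExp.size]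
      omega
  · refine ⟨1, by simp, le_rfl, by omega, ?_, row₁, fun c' _ _ => by omega, fun c' h1 h2 => ?_,
      ?_, by simp, ?_⟩
    · refine ((K₁.mono ?_ ?_ ?_ ?_).setN ?_ _).setN ?_ _ <;> grind
    · refine LaneAt.congr (s := s₁) ?_ rfl rfl fun _ _ => rfl
      refine (hcol c' h1 h2).congr_of_keeps K₁ (by simp; omega) (by simp; omega) fun x _ => ?_
      have := h6n c' h1
      simp
      omega
    · simpa using IsBuffer.empty _ _ _ _ _ _
    · have : ∑ c ∈ Finset.Ico 1 T.card, laneSize s₁ (2 * c) =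
          ∑ c ∈ Finset.Ico 1 T.card, laneSize s (2 * c) :=
        Finset.sum_congr rfl fun c hc => by
          rw [Finset.mem_Ico] at hc
          exact K₁.laneSize_eq (by simp; omega) (by simp; omega)
      simp only [laneSize] at this sz₁ ⊢
      rw [this, sz₁]
  · rintro s' t u ⟨c, hc5, hc1, hcn, hK, hrow, hdone, htodo, hbuf, h6, rfl⟩ hn ht
    simp only [BExp.val, NExp.val, hc5, h.inN_zero, not_lt] at hn
    obtain rfl : c = T.card := le_antisymm hcn hn
    refine wp_evaluate h hU (k := k + 1) (by rw [hK.nreg 3 (by simp), h3])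
      (by rw [hK.nreg 4 (by simp), h4]) (by rw [hK.rreg 11 (by simp), h11]) hi (by omega) hkl
      (by simpa using hik) h6 hbuf ?_ ?_
    · exact hbest.congr (hK.nreg _ (by simp)) (hK.nreg _ (by simp)) (hK.nreg _ (by simp))
        (hK.nreg _ (by simp)) fun x hx => hK.rmem _ (by simpa using hx)
    intro s₂ t₂ k₂ hbest₂ ht₂
    refine hQ s₂ _ ?_ ?_ ?_ ?_ (fun c h1 h2 => ?_) hbest₂ ?_
    · rw [k₂.nreg 3 (by simp), hK.nreg 3 (by simp), h3]
    · rw [k₂.nreg 4 (by simp), hK.nreg 4 (by simp), h4]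
    · rw [k₂.rreg 11 (by simp), hK.rreg 11 (by simp), h11]
    · rw [k₂.rreg 12 (by simp), hK.rreg 12 (by simp), h12]
    · refine (hdone c h1 h2).congr_of_keeps k₂ (by simp) (by simp) fun x _ => ?_
      have := h6n c h1
      simp
      omega
    · have : ∑ c ∈ Finset.Ico 1 T.card, laneSize s₂ (2 * c) =
          ∑ c ∈ Finset.Ico 1 T.card, laneSize s' (2 * c) :=
        Finset.sum_congr rfl fun c hc => k₂.laneSize_eq (by simp) (by simp)
      rw [this]
      simp only [RExp.size, NExp.size, BExp.size] at ht₁ ht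
      have hmul : (T.card - 1) * (200 * (d + 1) + 3020) ≤ T.card * (200 * (d + 1) + 3020) :=
        Nat.mul_le_mul_right _ (by omega)
      -- The bound is split into the cost of the cells, of the evaluation, and slack, so that what
      -- remains is linear.
      have h5 : 10000 * (d + e + 1) * T.card = T.card * (200 * (d + 1) + 3020) +
          1000 * (e + 1) * T.card + 70 * T.card + 9800 * d * T.card + 9000 * e * T.card +
          5710 * T.card := by ring
      rw [h5]
      omega

end Row

/-! ### The program -/

/-- Initialize the lane of the current column at line `0`. -/
def initCell (d : ℕ) : Cmd :=
  hdoor d ;; selectCol ;;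
  .ite (.ltR (.reg 1) (.reg 0)) (laneReset (.ofN (.const 0)) (.reg 11))
    (laneReset (.reg 0) (.add (.ofN (.reg 5)) (.reg 0)))

/-- Process all reference curves that start at the vertex `nreg 3` of `S`. -/
def rows (d : ℕ) : Cmd :=
  .setN 4 (.const 0) ;; .setN 5 (.const 1) ;;
  .loop (.ltN (.reg 5) (.inp 0)) (initCell d ;; .setN 5 (.add (.reg 5) (.const 1))) ;;
  .setN 4 (.const 1) ;;
  .loop (.and (.not (.ltN (.inp 2) (.reg 4)))
      (.not (.ltN (.inp 1) (.add (.reg 3) (.sub (.reg 4) (.const 1))))))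
    (row d ;; .setN 4 (.add (.reg 4) (.const 1)))

/-- Find an optimal vertex-to-vertex pathlet. -/
def main (d : ℕ) : Cmd :=
  .setR 11 (.ofN (.add (.inp 0) (.const 1))) ;;
  .setR 12 (.mul (.ofN (.const 4)) (.inp 0 (.const 0))) ;;
  .setN 3 (.const 1) ;;
  .loop (.not (.ltN (.inp 1) (.reg 3))) (rows d ;; .setN 3 (.add (.reg 3) (.const 1)))

section Main

variable {d : ℕ} {T S : Curve d} {ℓ : ℕ} {r : ℝ} {m : Machine} {lenU lenC e : ℕ}

/-- At line `0` the only point reachable from `a` is `a` itself, so the left end of the door, with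
itself as start, dominates all others: it is least both as a position and as a start. One entry per
column suffices. -/
theorem wp_initCell (h : Setup T S ℓ r m) {s : Store} {i c : ℕ} (h3 : s.nreg 3 = i)
    (h4 : s.nreg 4 = 0) (h5 : s.nreg 5 = c) (h11 : s.rreg 11 = T.card + 1) (h12 : s.rreg 12 = r)
    (hi : 1 ≤ i) (hiS : i ≤ S.card) (hc : 1 ≤ c) (hcn : c < T.card) {Q : Store → ℕ → Prop}
    (hQ : ∀ s' t, Keeps {10, 11, 14, 15, 16} {0, 1, 3, 4, 5, 6} {2 * c, 2 * c + 1}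
        (Set.Ico (colBase T.card ℓ c) (colBase T.card ℓ c + 2 * (ℓ + 1))) s s' →
      LaneAt T.card s' (colBase T.card ℓ c) (2 * c) 1 (colReach (S.from i) T.vertex r 0 c) →
      laneSize s' (2 * c) = 1 → t ≤ 100 * (d + 1) + 100 → Q s' t) : wp m (initCell d) s Q := by
  have hb := h.bounds
  have hcm := h.cells_le
  have hcb := h.colBase_le hcn
  unfold initCell
  simp only [wp.eq_6]
  refine wp_hdoor h h3 h4 h5 h12 hi (by omega) (by omega) hc hcn ?_
  intro s₁ t₁ k₁ hd₁ ht₁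
  have e5 : s₁.nreg 5 = c := by rw [k₁.nreg 5 (by simp), h5]
  have e11 : s₁.rreg 11 = T.card + 1 := by rw [k₁.rreg 11 (by simp), h11]
  refine wp_selectCol h e5 hcn ?_
  have hK : ∀ {s' t}, Keeps ∅ ∅ {2 * c, 2 * c + 1}
      {colBase T.card ℓ c, colBase T.card ℓ c + 1}
      ⟨Function.update (Function.update s₁.nreg 10 (colBase T.card ℓ c)) 11 (2 * c), s₁.rreg,
        s₁.nmem, s₁.rmem⟩ s' →
      LaneAt T.card s' (colBase T.card ℓ c) (2 * c) 1 (colReach (S.from i) T.vertex r 0 c) →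
      laneSize s' (2 * c) = 1 → t ≤ 100 * (d + 1) + 100 → Q s' t := by
    intro s' t k' hl hs ht
    refine hQ s' t ((((k₁.mono ?_ ?_ ?_ ?_).setN ?_ _).setN ?_ _).trans (k'.mono ?_ ?_ ?_ ?_)) hl
      hs ht <;> grind
  simp only [wp, BExp.Ok, RExp.Ok, BExp.val, RExp.val, BExp.size, RExp.size]
  refine ⟨by simp, fun hlt => ?_, fun hle => ?_⟩
  · refine wp_laneReset (N := T.card) (b := colBase T.card ℓ c) (a := 2 * c) (cap := 1)
      (R := colReach (S.from i) T.vertex r 0 c) hcm (by simp) (by simp) (by omega) (by omega) le_rfl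
      (by simp) (fun s' _ hr => by simp [hr]) (fun hle => ?_) (fun x a hx => ?_) ?_
    · simp only [RExp.val, e11] at hle
      linarith
    · have := (hd₁ x).1 hx.1
      exact absurd (this.1.trans this.2) (not_le.2 hlt)
    · intro s' t' hl hk hs ht
      refine hK hk hl hs ?_
      simp only [RExp.size, NExp.size] at ht
      omega
  · rw [not_lt] at hle
    refine wp_laneReset (N := T.card) (b := colBase T.card ℓ c) (a := 2 * c) (cap := 1)
      (R := colReach (S.from i) T.vertex r 0 c) hcm (by simp) (by simp) (by omega) (by omega) le_rfl
      (by simp) (fun s' hn hr => by simp [hr, hn]) (fun _ => ?_) (fun x a hx => ?_) ?_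
    · simpa [colReach, HReach, e5] using (hd₁ _).2 ⟨le_rfl, hle⟩
    · obtain ⟨hx1, hx2⟩ := hx
      have := ((hd₁ x).1 hx1).1
      refine ⟨this, ?_⟩
      simp only [RExp.val, NExp.val, ne_eq, Nat.reduceEqDiff, not_false_eq_true,
        Function.update_of_ne, e5]
      dsimp only at hx2
      linarith
    · intro s' t' hl hk hs ht
      refine hK hk hl hs ?_
      simp only [RExp.size, NExp.size] at ht
      omega

/-- The loop over lines stops when the curve gets too long or `S` ends; either way the start `i` has
been exhausted. -/
theorem pairsUpTo_eq_succ {cardS ℓ i k : ℕ} (h : ℓ ≤ k ∨ cardS < i + k) :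
    pairsUpTo cardS ℓ i k = pairsUpTo cardS ℓ (i + 1) 0 := by
  ext ⟨i', k'⟩
  simp only [pairsUpTo, Set.mem_ofPred_eq]
  omega

/-- The time for all reference curves with the same start. -/
def rowsTime (d e n ℓ : ℕ) : ℕ :=
  n * (100 * (d + 1) + 220) + ℓ * (10000 * (d + e + 1) * n + 20) + 100

theorem wp_rows (h : Setup T S ℓ r m) (hU : Tables m lenU lenC e) {s : Store} {i : ℕ}
    (h3 : s.nreg 3 = i) (h11 : s.rreg 11 = T.card + 1) (h12 : s.rreg 12 = r) (hi : 1 ≤ i)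
    (hiS : i ≤ S.card) (hbest : HasBest T S ℓ r m lenU lenC (pairsUpTo S.card ℓ i 0) s)
    {Q : Store → ℕ → Prop}
    (hQ : ∀ (s' : Store) t, s'.nreg 3 = i → s'.rreg 11 = T.card + 1 → s'.rreg 12 = r →
      HasBest T S ℓ r m lenU lenC (pairsUpTo S.card ℓ (i + 1) 0) s' →
      t ≤ rowsTime d e T.card ℓ → Q s' t) : wp m (rows d) s Q := by
  have hb := h.bounds
  have hcm := h.cells_le
  have hl := h.length
  have h2 := h.two_le
  have hST := h.card_le
  have h6n : ∀ c, 1 ≤ c → 6 * T.card + 2 * (ℓ + 1) ≤ colBase T.card ℓ c := fun c hc => by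
    simpa [colBase] using colBase_add_le (n := T.card) (ℓ := ℓ) (c := 0) hc
  unfold rows
  simp only [wp.eq_6, wp.eq_2, NExp.Ok, NExp.val, NExp.size]
  refine ⟨by omega, by omega, ?_⟩
  refine wp_loop (I := fun s' u => ∃ c, s'.nreg 5 = c ∧ 1 ≤ c ∧ c ≤ T.card ∧ s'.nreg 4 = 0 ∧
      Keeps {4, 5, 10, 11, 14, 15, 16} {0, 1, 3, 4, 5, 6} Set.univ (Set.Ici (2 * T.card)) s s' ∧
      (∀ c', 1 ≤ c' → c' < c → LaneAt T.card s' (colBase T.card ℓ c') (2 * c') 1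
        (colReach (S.from i) T.vertex r 0 c') ∧ laneSize s' (2 * c') = 1) ∧
      u = (T.card - c) * (100 * (d + 1) + 120)) ?_ ?_
      (u := (T.card - 1) * (100 * (d + 1) + 120)) ?_ ?_
  · rintro s' u ⟨c, -⟩
    simp only [BExp.Ok, NExp.Ok, h.inN_zero, true_and]
    omega
  · rintro s' u ⟨c, hc5, hc1, hcn, hc4, hK, hdone, rfl⟩ hlt
    simp only [BExp.val, NExp.val, hc5, h.inN_zero] at hlt
    simp only [wp.eq_6]
    refine wp_initCell h (by rw [hK.nreg 3 (by simp), h3]) hc4 hc5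
      (by rw [hK.rreg 11 (by simp), h11]) (by rw [hK.rreg 12 (by simp), h12]) hi hiS hc1 hlt ?_
    intro s₂ t₂ k₂ hl₂ hs₂ ht₂
    have e5 : s₂.nreg 5 = c := by rw [k₂.nreg 5 (by simp), hc5]
    simp only [wp.eq_2, NExp.Ok, NExp.val, NExp.size, e5, true_and]
    refine ⟨by omega, .intro ((T.card - (c + 1)) * (100 * (d + 1) + 120))
      ⟨c + 1, by simp, by omega, by omega, ?_, ?_, fun c' h1 h2 => ?_, rfl⟩ ?_⟩
    · simp [k₂.nreg 4 (by simp), hc4]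
    · refine (hK.trans (k₂.mono ?_ ?_ ?_ ?_)).setN ?_ _ <;> grind
    · rcases (Nat.lt_succ_iff.1 h2).eq_or_lt with rfl | h2
      · exact ⟨hl₂, hs₂⟩
      · obtain ⟨hL, hs⟩ := hdone c' h1 h2
        refine ⟨?_, ?_⟩
        · refine LaneAt.congr (s := s₂) ?_ rfl rfl fun _ _ => rfl
          refine hL.congr_of_keeps k₂ (by simp; omega) (by simp; omega) fun x hx => ?_
          have := colBase_add_le (n := T.card) (ℓ := ℓ) h2
          simp
          omega
        · exact (k₂.laneSize_eq (by simp; omega) (by simp; omega)).trans hs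
    · have : T.card - c = T.card - (c + 1) + 1 := by omega
      rw [this, add_mul _ 1, one_mul]
      simp only [BExp.size, NExp.size]
      omega
  · refine ⟨1, by simp, le_rfl, by omega, by simp, ?_, fun c' _ _ => by omega, rfl⟩
    exact ((Keeps.refl _ _ _ _ s).setN (by simp) _).setN (by simp) _
  rintro s₁ t₁ u₁ ⟨c, hc5, hc1, hcn, -, k₁, hdone, -⟩ hn ht₁
  simp only [BExp.val, NExp.val, hc5, h.inN_zero, not_lt] at hn
  obtain rfl : c = T.card := le_antisymm hcn hn
  refine ⟨by omega, ?_⟩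
  -- After initialization each lane has one entry; this potential is the term `100 * (T.card - 1)`
  -- in the budget below.
  have hsum : ∑ c ∈ Finset.Ico 1 T.card, laneSize s₁ (2 * c) = T.card - 1 := by
    rw [Finset.sum_congr rfl fun c hc => (hdone c (Finset.mem_Ico.1 hc).1
        (Finset.mem_Ico.1 hc).2).2]
    simp
  refine wp_loop (I := fun s' u => ∃ k, s'.nreg 4 = k + 1 ∧ k ≤ ℓ ∧ s'.nreg 3 = i ∧
      s'.rreg 11 = T.card + 1 ∧ s'.rreg 12 = r ∧
      (∀ c, 1 ≤ c → c < T.card → LaneAt T.card s' (colBase T.card ℓ c) (2 * c) (k + 1)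
        (colReach (S.from i) T.vertex r k c)) ∧
      HasBest T S ℓ r m lenU lenC (pairsUpTo S.card ℓ i k) s' ∧
      u = (ℓ - k) * (10000 * (d + e + 1) * T.card + 20) +
        100 * ∑ c ∈ Finset.Ico 1 T.card, laneSize s' (2 * c)) ?_ ?_
      (u := ℓ * (10000 * (d + e + 1) * T.card + 20) + 100 * (T.card - 1)) ?_ ?_
  · rintro s' u ⟨k, hk4, hkl, hk3, -⟩
    simp only [BExp.Ok, BExp.val, NExp.Ok, NExp.val, h.inN_one, h.inN_two, hk4, hk3, true_and]
    exact ⟨⟨⟨by omega, by omega⟩, trivial⟩, fun _ => ⟨⟨by omega, by omega⟩, ⟨by omega, by omega⟩,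
      by omega⟩⟩
  · rintro s' u ⟨k, hk4, hkl, hk3, hk11, hk12, hL, hB, rfl⟩ hlt
    simp only [BExp.val, NExp.val, h.inN_one, h.inN_two, hk4, hk3, not_lt,
      Nat.add_sub_cancel] at hlt
    simp only [wp.eq_6]
    refine wp_row h hU hk3 hk4 hk11 hk12 hi hlt.1 hlt.2 hL hB ?_
    intro s₂ t₂ e3 e4 e11 e12 hL₂ hB₂ ht₂
    simp only [wp.eq_2, NExp.Ok, NExp.val, NExp.size, e4, true_and]
    refine ⟨by omega, .intro ((ℓ - (k + 1)) * (10000 * (d + e + 1) * T.card + 20) +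
        100 * ∑ c ∈ Finset.Ico 1 T.card, laneSize s₂ (2 * c))
      ⟨k + 1, by simp, hlt.1, by simpa using e3, e11, e12, hL₂, ?_, rfl⟩ ?_⟩
    · exact hB₂.congr (by simp) (by simp) (by simp) (by simp) fun _ _ => rfl
    · have : ℓ - k = ℓ - (k + 1) + 1 := by omega
      rw [this, add_mul _ 1, one_mul]
      simp only [BExp.size, NExp.size]
      omega
  · refine ⟨0, by simp, by omega, ?_, ?_, ?_, fun c h1 h2 => (hdone c h1 h2).1, ?_, ?_⟩
    · simp [k₁.nreg 3 (by simp), h3]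
    · simp [k₁.rreg 11 (by simp), h11]
    · simp [k₁.rreg 12 (by simp), h12]
    · exact hbest.congr (by simp [k₁.nreg 0 (by simp)]) (by simp [k₁.nreg 1 (by simp)])
        (by simp [k₁.nreg 2 (by simp)]) (by simp [k₁.nreg 7 (by simp)])
        fun x hx => k₁.rmem _ (by simpa using hx)
    · simp only [laneSize] at hsum ⊢
      rw [hsum, Nat.sub_zero]
  · rintro s' t u ⟨k, hk4, hkl, hk3, hk11, hk12, hL, hB, -⟩ hn ht
    simp only [BExp.val, NExp.val, h.inN_one, h.inN_two, hk4, hk3, not_lt,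
      Nat.add_sub_cancel, not_and_or, not_le] at hn
    refine hQ s' _ hk3 hk11 hk12 ?_ ?_
    · rwa [← pairsUpTo_eq_succ (k := k) (by omega)]
    · simp only [NExp.size, BExp.size] at ht₁ ht
      have hmul : (T.card - 1) * (100 * (d + 1) + 120) ≤ T.card * (100 * (d + 1) + 120) :=
        Nat.mul_le_mul_right _ (by omega)
      have h5 : T.card * (100 * (d + 1) + 220) = T.card * (100 * (d + 1) + 120) + 100 * T.card := by
        ring
      rw [rowsTime, h5]
      omega

theorem wp_main (h : Setup T S ℓ r m) (hU : Tables m lenU lenC e)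
    (hΔ : 1 ≤ (m.inR.getD 0 []).length) (hr : r = 4 * (m.inR.getD 0 []).getD 0 0)
    (hℓ : 1 ≤ ℓ) {Q : Store → ℕ → Prop}
    (hQ : ∀ s t, HasOutput T S ℓ r m lenU lenC s →
      (∀ i k, 1 ≤ i → 1 ≤ k → k ≤ ℓ → i + (k - 1) ≤ S.card →
        pairValue T S r m lenU lenC i k ≤ s.nreg 7) →
      t ≤ T.card * (rowsTime d e T.card ℓ + 20) + 50 → Q s t) :
    wp m (main d) Store.zero Q := by
  have hb := h.bounds
  have hcm := h.cells_le
  have hl := h.length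
  have h2 := h.two_le
  have hST := h.card_le
  have hS := S.card_pos
  unfold main
  simp only [wp.eq_6, wp.eq_2, wp.eq_3, NExp.Ok, NExp.val, NExp.size, RExp.Ok, RExp.val, RExp.size,
    h.inN_zero]
  refine ⟨by omega, ⟨by omega, by omega⟩, by omega, ?_⟩
  refine wp_loop (I := fun s' u => ∃ i, s'.nreg 3 = i ∧ 1 ≤ i ∧ i ≤ S.card + 1 ∧
      s'.rreg 11 = T.card + 1 ∧ s'.rreg 12 = r ∧
      HasBest T S ℓ r m lenU lenC (pairsUpTo S.card ℓ i 0) s' ∧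
      u = (S.card + 1 - i) * (rowsTime d e T.card ℓ + 20)) ?_ ?_
      (u := S.card * (rowsTime d e T.card ℓ + 20)) ?_ ?_
  · rintro s' u ⟨i, -⟩
    simp only [BExp.Ok, NExp.Ok, h.inN_one]
    exact ⟨⟨by omega, by omega⟩, trivial⟩
  · rintro s' u ⟨i, hi3, hi1, hiS, h11, h12, hB, rfl⟩ hlt
    simp only [BExp.val, NExp.val, hi3, h.inN_one, not_lt] at hlt
    simp only [wp.eq_6]
    refine wp_rows h hU hi3 h11 h12 hi1 hlt hB ?_
    intro s₂ t₂ e3 e11 e12 hB₂ ht₂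
    simp only [wp.eq_2, NExp.Ok, NExp.val, NExp.size, e3, true_and]
    refine ⟨by omega, .intro ((S.card + 1 - (i + 1)) * (rowsTime d e T.card ℓ + 20))
      ⟨i + 1, by simp, by omega, by omega, e11, e12, ?_, rfl⟩ ?_⟩
    · exact hB₂.congr (by simp) (by simp) (by simp) (by simp) fun _ _ => rfl
    · have : S.card + 1 - i = S.card + 1 - (i + 1) + 1 := by omega
      rw [this, add_mul _ 1, one_mul]
      simp only [BExp.size, NExp.size]
      omega
  · refine ⟨1, by simp, le_rfl, by omega, ?_, ?_, ?_, by simp⟩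
    · simp
    · simp [hr]
    · have : pairsUpTo S.card ℓ 1 0 = ∅ := by
        refine Set.eq_empty_of_forall_notMem ?_
        rintro z ⟨z1, z2, -, -, z3⟩
        omega
      rw [this]
      exact ⟨by simp, .inr ⟨by simp [Store.zero], rfl⟩⟩
  · rintro s' t u ⟨i, hi3, hi1, hiS, h11, h12, ⟨hB, hO⟩, -⟩ hn ht
    simp only [BExp.val, NExp.val, hi3, h.inN_one, not_lt, not_le] at hn
    refine hQ s' _ (hO.resolve_right ?_) (fun i' k' h1 h2 h3 h4 => ?_) ?_
    -- The curve that consists of the first vertex of `S` alone has been considered, so the output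
    -- exists.
    · rintro ⟨-, h0⟩
      have : ((1, 1) : ℕ × ℕ) ∈ pairsUpTo S.card ℓ i 0 := ⟨le_rfl, le_rfl, hℓ, by dsimp only; omega,
        .inl (by dsimp only; omega)⟩
      rw [h0] at this
      exact this
    · exact hB (i', k') ⟨h1, h2, h3, h4, .inl (by dsimp only; omega)⟩
    · have := Nat.mul_le_mul_right (rowsTime d e T.card ℓ + 20) hST
      simp only [BExp.size, NExp.size] at ht
      omega

end Main

/-! ### The input and the output of the program -/

section Input

variable {d : ℕ}

theorem Curve.length_coords (P : Curve d) : P.coords.length = P.card * d := by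
  simp [Curve.coords]

theorem Curve.getD_coords (P : Curve d) {c : ℕ} (h1 : 1 ≤ c) (hc : c ≤ P.card) (j : Fin d) :
    P.coords.getD ((c - 1) * d + j) 0 = P.vertex c j := by
  have hlt : (c - 1) * d + j < P.card * d :=
    (Nat.add_lt_add_left j.isLt _).trans_le (offset_le h1 hc)
  have hd : ((c - 1) * d + j) / d = c - 1 := by
    rw [mul_comm, Nat.mul_add_div j.pos, Nat.div_eq_of_lt j.isLt, add_zero]
  have hm : ((c - 1) * d + j) % d = j := by
    rw [mul_comm, Nat.mul_add_mod, Nat.mod_eq_of_lt j.isLt]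
  rw [List.getD_eq_getElem _ _ (by rwa [P.length_coords])]
  simp only [Curve.coords, List.getElem_ofFn, Curve.vertex]
  have e1 : Fin.divNat (⟨(c - 1) * d + j, hlt⟩ : Fin (P.card * d)) =
      ⟨min c P.card - 1, by omega⟩ := by
    ext
    simp only [Fin.coe_divNat, hd]
    omega
  have e2 : Fin.modNat (⟨(c - 1) * d + j, hlt⟩ : Fin (P.card * d)) = j := by
    ext
    simp only [Fin.coe_modNat, hm]
  rw [e1, e2]

theorem setup_inputMachine {T S : Curve d} {ℓ : ℕ} {Δ : ℝ} {tabU tabC : List (ℝ × ℝ)}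
    {cells maxInt : ℕ} (hT : 2 ≤ T.card) (hS : S.card ≤ T.card) (hΔ : 0 ≤ Δ)
    (h1 : 6 * T.card + T.card * (2 * (ℓ + 1)) ≤ cells) (h2 : cells ≤ maxInt)
    (h3 : T.card * d + d ≤ maxInt) :
    Setup T S ℓ (4 * Δ) (inputMachine T S ℓ Δ tabU tabC cells maxInt) where
  two_le := hT
  card_le := hS
  nonneg := by positivity
  length := le_rfl
  inN_zero := rfl
  inN_one := rfl
  inN_two := rfl
  pointT c h1 hc := ⟨(offset_le h1 hc).trans_eq T.length_coords.symm, T.getD_coords h1 hc⟩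
  pointS c h1 hc := ⟨(offset_le h1 hc).trans_eq S.length_coords.symm, S.getD_coords h1 hc⟩
  le_cells := h1
  cells_le := h2
  le_maxInt := h3

variable {L : List (ℝ × ℝ)} {A U : Set (ℝ × ℝ)} {n : ℕ} {m : Machine} {kl kr li : ℕ}

theorem IsSearchTable.nodup (h : IsSearchTable L A) : L.Nodup :=
  h.1.imp fun hlt heq => (heq ▸ hlt).false

theorem IsSearchTable.length_eq (h : IsSearchTable L A) : L.length = A.ncard := by
  classical
  rw [← List.toFinset_card_of_nodup h.nodup, ← Set.ncard_coe_finset]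
  congr 1
  ext J
  simp [h.2]

theorem IsSearchTable.isTable (h : IsSearchTable L A) (hU : IsUniverse n U) (hA : A ⊆ U)
    (hli : li < m.inN.length) (hlen : m.inN.getD li 0 = L.length)
    (hl : m.inR.getD kl [] = L.map Prod.fst) (hr : m.inR.getD kr [] = L.map Prod.snd) :
    IsTable m kl kr li L.length := by
  obtain ⟨-, hlt, hdisj, -⟩ := hU
  refine ⟨hli, hlen, by rw [hl, List.length_map], by rw [hr, List.length_map], fun i hi => ?_,
      fun i j hij hj => ?_⟩
  · rw [hl, hr, List.getD_eq_getElem _ _ (by simpa), List.getD_eq_getElem _ _ (by simpa)]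
    simpa using hlt _ (hA ((h.2 _).1 (List.getElem_mem hi)))
  · have hi := hij.trans hj
    rw [hl, hr, List.getD_eq_getElem _ _ (by simpa), List.getD_eq_getElem _ _ (by simpa)]
    simp only [List.getElem_map]
    have h1 := List.pairwise_iff_getElem.1 h.1 i j hi hj hij
    have hUi := hA ((h.2 _).1 (List.getElem_mem hi))
    have hUj := hA ((h.2 _).1 (List.getElem_mem hj))
    by_contra hn
    -- If the earlier interval ended after the later one began, a point just right of that beginning
    -- would lie in both interiors.
    obtain ⟨x, hx1, hx2⟩ := exists_between (lt_min (not_le.1 hn) (hlt _ hUj))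
    rw [lt_min_iff] at hx2
    exact Set.disjoint_left.1 (hdisj _ hUi _ hUj fun he => (he ▸ h1).false)
      (show x ∈ Set.Ioo _ _ from ⟨h1.trans hx1, hx2.1⟩) ⟨hx1, hx2.2⟩

theorem IsSearchTable.countIn_eq (h : IsSearchTable L A) (hl : m.inR.getD kl [] = L.map Prod.fst)
    (hr : m.inR.getD kr [] = L.map Prod.snd) (W : Set ℝ) :
    countIn m kl kr L.length W = {J ∈ A | Set.Icc J.1 J.2 ⊆ W}.ncard := by
  classical
  have hI : ∀ i (hi : i < L.length), tableIcc m kl kr i = Set.Icc L[i].1 L[i].2 := by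
    intro i hi
    rw [tableIcc, hl, hr, List.getD_eq_getElem _ _ (by simpa), List.getD_eq_getElem _ _ (by simpa)]
    simp
  rw [countIn, ← Finset.card_image_of_injOn (f := fun i => L.getD i 0), ← Set.ncard_coe_finset]
  · congr 1
    ext J
    simp only [Finset.coe_image, Finset.coe_filter, Finset.mem_range, Set.mem_image,
      Set.mem_ofPred_eq]
    constructor
    · rintro ⟨i, ⟨hi, hW⟩, rfl⟩
      rw [List.getD_eq_getElem _ _ hi]
      exact ⟨(h.2 _).1 (List.getElem_mem hi), hI i hi ▸ hW⟩
    · rintro ⟨hJ, hW⟩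
      obtain ⟨i, hi, rfl⟩ := List.mem_iff_getElem.1 ((h.2 J).2 hJ)
      exact ⟨i, ⟨hi, hI i hi ▸ hW⟩, List.getD_eq_getElem _ _ hi⟩
  · intro i hi j hj hij
    simp only [Finset.coe_filter, Finset.mem_range, Set.mem_ofPred_eq] at hi hj
    simp only [List.getD_eq_getElem _ _ hi.1, List.getD_eq_getElem _ _ hj.1] at hij
    exact (h.nodup.getElem_inj_iff).1 hij

theorem covSet_subset (U : Set (ℝ × ℝ)) (C : Set (Pathlet d)) : covSet U C ⊆ U :=
  Set.iUnion₂_subset fun _ _ => Set.sep_subset _ _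

/-- Because `A ⊆ U`, removing `A` removes exactly the intervals of `A` inside `W`. Two counts
therefore replace any bookkeeping of which intervals are already covered. -/
theorem ncard_sdiff_eq_sub (hU : U.Finite) (hA : A ⊆ U) (W : Set ℝ) :
    ({J ∈ U | Set.Icc J.1 J.2 ⊆ W} \ A).ncard =
      {J ∈ U | Set.Icc J.1 J.2 ⊆ W}.ncard - {J ∈ A | Set.Icc J.1 J.2 ⊆ W}.ncard := by
  have hs : {J ∈ A | Set.Icc J.1 J.2 ⊆ W} ⊆ {J ∈ U | Set.Icc J.1 J.2 ⊆ W} :=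
    fun J hJ => ⟨hA hJ.1, hJ.2⟩
  rw [← Set.ncard_sdiff hs ((hU.subset hA).subset (Set.sep_subset _ _))]
  congr 1
  ext J
  simp only [Set.mem_sdiff, Set.mem_ofPred_eq, not_and]
  tauto

theorem uncovered_le_of_support_subset (hU : U.Finite) (C : Set (Pathlet d)) {q : Pathlet d}
    {W : Set ℝ} (h : q.support ⊆ W) :
    uncovered U C q ≤ ({J ∈ U | Set.Icc J.1 J.2 ⊆ W} \ covSet U C).ncard :=
  Set.ncard_le_ncard (fun _ hJ => ⟨⟨hJ.1.1, hJ.1.2.trans h⟩, hJ.2⟩)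
    ((hU.subset (Set.sep_subset _ _)).subset Set.sdiff_subset)

/-- The completeness half of optimality: no pathlet with this reference curve covers a point outside
the set computed by the program. -/
theorem IsPathlet.support_subset {T S : Curve d} {ℓ : ℕ} {r : ℝ} {q : Pathlet d}
    (hq : IsPathlet T ℓ r q) (hT : 2 ≤ T.card) {i j : ℕ} (h : 1 ≤ i ∧ i ≤ j ∧ j ≤ S.card)
    (href : q.ref = S.sub i j h) :
    q.support ⊆ reachCover (S.from i) T.vertex r T.card (j - i + 1) := by
  intro x hx
  simp only [Pathlet.support, Set.mem_iUnion₂] at hx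
  obtain ⟨⟨a, b⟩, hI, hx⟩ := hx
  obtain ⟨ha, hab, hb, hd⟩ := hq.2 _ hI
  rw [href] at hd
  dsimp only at ha hab hb hd
  have h1b : 1 ≤ ⌊b⌋₊ := Nat.le_floor (by exact_mod_cast ha.trans hab)
  have hfb : (⌊b⌋₊ : ℝ) ≤ b := Nat.floor_le (by linarith)
  have hlt := Nat.lt_floor_add_one b
  -- The column of `b`; the minimum puts `b = n` on the last edge, since no edge begins at the
  -- vertex `n`.
  refine ⟨min ⌊b⌋₊ (T.card - 1), by omega, (b - (min ⌊b⌋₊ (T.card - 1) : ℕ), a),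
    hReach_of_frechetDist_sub_le h ha hab hb (by omega) ?_ ?_ hd, ?_⟩
  · exact (Nat.cast_le.2 (min_le_left _ _)).trans hfb
  · rcases le_total ⌊b⌋₊ (T.card - 1) with hle | hle
    · rw [min_eq_left hle]
      exact hlt.le
    · rw [min_eq_right hle, Nat.cast_sub (by omega)]
      push_cast
      linarith
  · simpa using hx

/-- The pathlet in the output. -/
theorem HasOutput.exists_pathlet {T S : Curve d} {ℓ : ℕ} {r : ℝ} {lenU lenC : ℕ} {s : Store}
    (h : HasOutput T S ℓ r m lenU lenC s) (hr : 0 ≤ r) :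
    ∃ p : Pathlet d, (∀ cells, 2 * T.card ≤ cells → Outputs S cells s p) ∧ IsPathlet T ℓ r p ∧
      IsVertexToVertex S p ∧ s.nreg 7 =
        countIn m 3 4 lenU p.support - countIn m 5 6 lenC p.support := by
  obtain ⟨i, k, hi, hk, hkl, hik, h0, h1, h2, hbuf, h7⟩ := h
  have hs : 1 ≤ s.nreg 0 ∧ s.nreg 0 ≤ s.nreg 1 ∧ s.nreg 1 ≤ S.card := by omega
  have hij : s.nreg 1 - s.nreg 0 + 1 = k := by omega
  refine ⟨⟨S.sub _ _ hs, {I | ∃ k < s.nreg 2, I = (s.rmem (2 * k), s.rmem (2 * k + 1))}⟩,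
    fun cells hc => ⟨⟨hs, rfl⟩, by omega, rfl⟩, ⟨hij.trans_le hkl, ?_⟩, ⟨_, _, hs, rfl⟩, ?_⟩
  · rintro _ ⟨j, hj, rfl⟩
    obtain ⟨c, x, -, hc, hR, hx⟩ := hbuf.sound j hj
    rw [zero_add] at hR hx
    have := frechetDist_sub_le_of_hReach (T := T) (S := S) hs hr hc
      (a := s.rmem (2 * j)) (x := x) (by rw [hij, h0]; exact hR)
    rwa [← hx] at this
  · have hW : reachCover (S.from i) T.vertex r T.card k = ⋃ I ∈ {I : ℝ × ℝ | ∃ k < s.nreg 2,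
        I = (s.rmem (2 * k), s.rmem (2 * k + 1))}, Set.Icc I.1 I.2 := by
      rw [← hbuf.cover_eq]
      ext x
      simp only [zero_add, Set.mem_ofPred_eq, Set.mem_iUnion]
      constructor
      · rintro ⟨j, hj, hx⟩
        exact ⟨_, ⟨j, hj, rfl⟩, hx⟩
      · rintro ⟨_, ⟨j, hj, rfl⟩, hx⟩
        exact ⟨j, hj, hx⟩
    rw [h7, pairValue, hW]
    rfl

end Input

/-! ### The resources -/

theorem natLog_le_two_mul_log {n : ℕ} (hn : 2 ≤ n) : (Nat.log 2 n : ℝ) ≤ 2 * Real.log n := by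
  have h1 : (2 : ℝ) ^ Nat.log 2 n ≤ n := by exact_mod_cast Nat.pow_log_le_self 2 (by omega)
  have h2 := Real.log_le_log (by positivity) h1
  rw [Real.log_pow] at h2
  have := Real.log_two_gt_d9
  nlinarith [(Nat.log 2 n).cast_nonneg (α := ℝ)]

theorem half_le_log {n : ℕ} (hn : 2 ≤ n) : 1 / 2 ≤ Real.log n := by
  have h1 : Real.log 2 ≤ Real.log n := Real.log_le_log two_pos (by exact_mod_cast hn)
  linarith [Real.log_two_gt_d9]

/-- Both tables have at most `K * n ^ 3` entries, so this exponent, which is `O(log n)` for fixed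
`K`, bounds the rounds of a binary search. -/
theorem mul_pow_lt_two_pow (K n : ℕ) :
    K * n ^ 3 < 2 ^ (K + 3 * Nat.log 2 n + 3) := by
  have h1 : n ^ 3 < (2 ^ (Nat.log 2 n + 1)) ^ 3 :=
    Nat.pow_lt_pow_left (Nat.lt_pow_succ_log_self one_lt_two n) (by norm_num)
  calc K * n ^ 3 ≤ 2 ^ K * n ^ 3 := Nat.mul_le_mul_right _ K.lt_two_pow_self.le
    _ < 2 ^ K * (2 ^ (Nat.log 2 n + 1)) ^ 3 := Nat.mul_lt_mul_of_pos_left h1 (by positivity)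
    _ = _ := by ring

theorem rowsTime_le {d e n ℓ : ℕ} (hn : 1 ≤ n) (hℓ : 1 ≤ ℓ) :
    n * (rowsTime d e n ℓ + 20) + 50 ≤ 11000 * (d + e + 1) * (n ^ 2 * ℓ) := by
  have h1 : n ≤ n * ℓ := Nat.le_mul_of_pos_right _ hℓ
  have h2 : ℓ ≤ n * ℓ := Nat.le_mul_of_pos_left _ hn
  have h3 : rowsTime d e n ℓ + 70 ≤ 11000 * (d + e + 1) * (n * ℓ) := by
    have := Nat.mul_le_mul_right (100 * (d + 1) + 220) h1
    have h4 : d * (n * ℓ) ≤ (d + e) * (n * ℓ) := Nat.mul_le_mul_right _ (by omega)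
    rw [rowsTime]
    calc _ ≤ n * ℓ * (100 * (d + 1) + 220) + ℓ * (10000 * (d + e + 1) * n + 20) + 170 := by linarith
      _ = 10000 * (d + e + 1) * (n * ℓ) + 100 * (d * (n * ℓ)) + 320 * (n * ℓ) + 20 * ℓ + 170 := by
        ring
      _ ≤ 10000 * (d + e + 1) * (n * ℓ) + 1000 * ((d + e) * (n * ℓ)) + 1000 * (n * ℓ) := by omega
      _ = _ := by ring
  calc _ ≤ n * (rowsTime d e n ℓ + 70) := by
        rw [mul_add, mul_add]
        omega
    _ ≤ n * (11000 * (d + e + 1) * (n * ℓ)) := Nat.mul_le_mul_left _ h3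
    _ = _ := by ring

end Subtraj

/-! ### The theorem: optimality of the output and the bounds on time, memory and word size -/

theorem mainTheorem9 (d : ℕ) :
    ∃ prog : Cmd, ∀ K : ℕ, ∃ c : ℕ,
      ∀ (T S : Curve d) (ℓ : ℕ) (Δ : ℝ) (U : Set (ℝ × ℝ)) (C : Set (Pathlet d))
        (tabU tabC : List (ℝ × ℝ)),
        2 ≤ T.card → S.card ≤ T.card → 2 ≤ ℓ → 0 ≤ Δ →
        IsUniverse T.card U → U.ncard ≤ K * T.card ^ 3 →
        IsSearchTable tabU U → IsSearchTable tabC (covSet U C) →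
        ∃ (cells maxInt time : ℕ) (s : Store) (p : Pathlet d),
          Exec (inputMachine T S ℓ Δ tabU tabC cells maxInt) prog Store.zero s time ∧
          Outputs S cells s p ∧
          IsOptimalVertexToVertex T S U C ℓ (4 * Δ) p ∧
          (time : ℝ) ≤ c * ((T.card : ℝ) ^ 2 * ℓ * Real.log T.card ^ 2) ∧
          (cells : ℝ) ≤ c * ((T.card : ℝ) * ℓ * Real.log T.card) ∧
          maxInt ≤ c * (T.card * ℓ) ^ c := by
  refine ⟨main d, fun K => ⟨100000 * (d + K + 7), ?_⟩⟩
  intro T S ℓ Δ U C tabU tabC hT hS hℓ hΔ hU hcard htU htC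
  obtain ⟨e, he⟩ : ∃ e, e = K + 3 * Nat.log 2 T.card + 3 := ⟨_, rfl⟩
  obtain ⟨cells, hcells⟩ : ∃ x, x = 6 * T.card + T.card * (2 * (ℓ + 1)) := ⟨_, rfl⟩
  -- Words must hold memory addresses, offsets into the coordinate arrays, and the sum of two table
  -- indices in a binary search.
  obtain ⟨maxInt, hmax⟩ : ∃ x, x = cells + (T.card * d + d) + 2 * (K * T.card ^ 3) := ⟨_, rfl⟩
  have hsub := covSet_subset U C
  have hlenU : tabU.length ≤ K * T.card ^ 3 := htU.length_eq.trans_le hcard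
  have hlenC : tabC.length ≤ K * T.card ^ 3 :=
    htC.length_eq.trans_le ((Set.ncard_le_ncard hsub hU.1).trans hcard)
  have h2e : K * T.card ^ 3 < 2 ^ e := he ▸ mul_pow_lt_two_pow K _
  obtain ⟨m, hm⟩ : ∃ m, m = inputMachine T S ℓ Δ tabU tabC cells maxInt := ⟨_, rfl⟩
  have hsetup : Setup T S ℓ (4 * Δ) m :=
    hm ▸ setup_inputMachine hT hS hΔ hcells.ge (by omega) (by omega)
  have hmm : m.maxInt = maxInt := by rw [hm]; rfl
  have htab : Tables m tabU.length tabC.length e :=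
    { tableU := htU.isTable hU le_rfl (by simp [hm, inputMachine]) (by rw [hm]; rfl)
        (by rw [hm]; rfl) (by rw [hm]; rfl)
      tableC := htC.isTable hU hsub (by simp [hm, inputMachine]) (by rw [hm]; rfl)
        (by rw [hm]; rfl) (by rw [hm]; rfl)
      maxU := by omega
      maxC := by omega
      ltU := hlenU.trans_lt h2e
      ltC := hlenC.trans_lt h2e }
  obtain ⟨s, time, hexec, hout, hbest, htime⟩ := wp.exec (wp_main (Q := fun s t =>
      HasOutput T S ℓ (4 * Δ) m tabU.length tabC.length s ∧
      (∀ i k, 1 ≤ i → 1 ≤ k → k ≤ ℓ → i + (k - 1) ≤ S.card →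
        pairValue T S (4 * Δ) m tabU.length tabC.length i k ≤ s.nreg 7) ∧
      t ≤ T.card * (rowsTime d e T.card ℓ + 20) + 50)
    hsetup htab (by rw [hm]; exact le_rfl) (by rw [hm]; rfl) (by omega)
    fun s t h1 h2 h3 => ⟨h1, h2, h3⟩)
  obtain ⟨p, hp, hpath, hvv, hval⟩ := hout.exists_pathlet (by positivity)
  have hcount : ∀ W : Set ℝ, countIn m 3 4 tabU.length W - countIn m 5 6 tabC.length W =
      ({J ∈ U | Set.Icc J.1 J.2 ⊆ W} \ covSet U C).ncard := fun W => by
    rw [ncard_sdiff_eq_sub hU.1 hsub, htU.countIn_eq (by rw [hm]; rfl) (by rw [hm]; rfl),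
      htC.countIn_eq (by rw [hm]; rfl) (by rw [hm]; rfl)]
  refine ⟨cells, maxInt, time, s, p, hm ▸ hexec, hp _ (by omega), ⟨⟨hpath, hvv⟩,
      fun q hq hqv => ?_⟩,
    ?_, ?_, ?_⟩
  · obtain ⟨i, j, h, href⟩ := hqv
    have hle := hbest i (j - i + 1) h.1 (by omega) (by simpa [href, Curve.sub] using hq.1)
      (by omega)
    rw [hval, hcount, pairValue, hcount] at hle
    exact (uncovered_le_of_support_subset hU.1 C (hq.support_subset hT h href)).trans hle
  · have hlog := natLog_le_two_mul_log hT
    have hhalf := half_le_log hT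
    have h1 : (time : ℝ) ≤ 11000 * (d + e + 1) * (T.card ^ 2 * ℓ) := by
      exact_mod_cast htime.trans (rowsTime_le (by omega) (by omega))
    -- With `L = log n ≥ 1 / 2`, the left side is at most `d + K + 4 + 6 L`. Now `6 L ≤ 3 L ^ 2 + 3`
    -- and `1 ≤ 4 L ^ 2`; hence the constants `7` and `9`, and `9 * 11000 ≤ 100000`.
    have h2 : (d + e + 1 : ℝ) ≤ 9 * (d + K + 7) * Real.log T.card ^ 2 := by
      rw [he]
      push_cast
      have h0 : (0 : ℝ) ≤ d + K + 7 := by positivity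
      nlinarith [mul_le_mul_of_nonneg_left (show (1 : ℝ) ≤ 4 * Real.log T.card ^ 2 by nlinarith) h0,
        sq_nonneg (Real.log T.card - 1)]
    calc (time : ℝ) ≤ 11000 * (9 * (d + K + 7) * Real.log T.card ^ 2) * (T.card ^ 2 * ℓ) := by
          refine h1.trans ?_
          gcongr
      _ ≤ 100000 * (d + K + 7) * (T.card ^ 2 * ℓ * Real.log T.card ^ 2) := by
          have : 0 ≤ (d + K + 7 : ℝ) * (T.card ^ 2 * ℓ * Real.log T.card ^ 2) := by positivity
          linarith
      _ = _ := by push_cast; ring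
  · have hhalf := half_le_log hT
    have h1 : T.card ≤ T.card * ℓ := Nat.le_mul_of_pos_right _ (by omega)
    have h2 : cells ≤ 10 * (T.card * ℓ) := by
      rw [hcells]
      linarith
    have h3 : (cells : ℝ) ≤ 10 * (T.card * ℓ) := by exact_mod_cast h2
    calc (cells : ℝ) ≤ 10 * (T.card * ℓ) * (2 * Real.log T.card) :=
          h3.trans (le_mul_of_one_le_right (by positivity) (by linarith))
      _ = 20 * (T.card * ℓ * Real.log T.card) := by ring
      _ ≤ _ := by
          gcongr
          push_cast
          linarith [d.cast_nonneg (α := ℝ), K.cast_nonneg (α := ℝ)]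
  · have h1 : T.card ≤ T.card * ℓ := Nat.le_mul_of_pos_right _ (by omega)
    have h2 : T.card * ℓ ≤ (T.card * ℓ) ^ 3 := Nat.le_self_pow (by norm_num) _
    have h3 : T.card ^ 3 ≤ (T.card * ℓ) ^ 3 := Nat.pow_le_pow_left h1 3
    have h4 : 0 < T.card * ℓ := by positivity
    have h5 : d ≤ d * (T.card * ℓ) ^ 3 := Nat.le_mul_of_pos_right _ (by positivity)
    calc maxInt ≤ (10 + 2 * d + 2 * K) * (T.card * ℓ) ^ 3 := by
          have h6 := Nat.mul_le_mul_left K h3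
          have h7 := Nat.mul_le_mul_left d (h1.trans h2)
          rw [hmax, hcells]
          linarith
      _ ≤ _ := Nat.mul_le_mul (by omega) (Nat.pow_le_pow_right h4 (by omega))
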